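/- Let $F$ be an algebraically closed field of characteristic zero. Algebras are associative $F$-algebras, not necessarily with a unit, and polynomials are elements of the free nonunital algebra $F\langle x_1,x_2,\dots\rangle$; $\mathrm{Id}(A)$ denotes the set of polynomial identities of an algebra $A$, and two algebras are PI-equivalent if they have the same identities. For a finite-dimensional algebra $A$ let $J(A)$ be its Jacobson radical, $n_A\ge 1$ the least integer $n\geq 1$ with $J(A)^{n}=0$, $d(A)=\dim_F A/J(A)$, and $\mathrm{Par}(A)=(d(A),n_A-1)$. Pairs in $\mathbb{Z}_{\ge 0}^2$ are ordered lexicographically. The Kemer index is $\mathrm{Ind}(A)=(d,s)$. Here $d=\lim_{\nu\to\infty} d_\nu$, where $d_\nu$ is the largest $r$ such that some multilinear polynomial $f\notin \mathrm{Id}(A)$ alternates on $\nu$ disjoint sets of $r$ variables; and $s=\lim_{\nu\to\infty} s_\nu$, where $s_\nu$ is the largest $j$ such that some multilinear $f\notin\mathrm{Id}(A)$ alternates on $\nu$ sets of $d$ variables and on $j$ sets of $d+1$ variables, all disjoint. $A$ is \emph{basic} if it is not PI-equivalent to a product $B_1\times\cdots\times B_r$ of finite-dimensional $F$-algebras with $\mathrm{Par}(B_i)<\mathrm{Par}(A)$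 for all $i$. A \emph{Wedderburn--Malcev decomposition} of $A$ is a vector space decomposition $A=\overline{A}\oplus J(A)$, where $\overline A=A_1\times\cdots\times A_q$ is a subalgebra that is a direct product of simple algebras $A_1,\dots,A_q$ (the simple components). With respect to it, evaluations of a multilinear polynomial are taken with values in $A_1\cup\cdots\cup A_q\cup J(A)$; values in $J(A)$ are called radical. For a multilinear polynomial $f\notin\mathrm{Id}(A)$, $A$ is \emph{full with respect to $f$} if in every nonvanishing evaluation of $f$ every simple component contains the value of some variable of $f$, and $A$ \emph{has property $K$ with respect to $f$} if $f$ vanishes on every evaluation with fewer than $n_A-1$ radical values. We say that $A$ \emph{is full and satisfies property $K$} if there is a multilinear polynomial $f\notin \mathrm{Id}(A)$ such that $A$ is full with respect to $f$ and has property $K$ with respect to the same $f$. \textbf{Proposition.} For a nonzero finite-dimensional algebra $A$ over $F$ the following conditions are equivalent: (1) $A$ is basic; (2) $A$ is full and satisfies property $K$, with respect to some Wedderburn--Malcev decomposition of $A$; (2') $A$ is full and satisfies property $K$, with respect to every Wedderburn--Malcev decomposition of $A$; (3) $\mathrm{Ind}(A)=\mathrm{Par}(A)=(d(A),n_A-1)$.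 -/

import Mathlib

open Filter

universe u v w

namespace KemerPI

/-! Algebras are associative and not necessarily unital. -/

noncomputable section

section Polynomials

/-- The free (associative, nonunital) algebra `F⟨x₀, x₁, …⟩` on countably many noncommuting
variables: formal linear combinations of nonempty words in the variables. -/
abbrev FreeAlg (F : Type u) [Field F] : Type u := MonoidAlgebra F (FreeSemigroup ℕ)

variable {F : Type u} [Field F]

/-- The list of letters of a word. -/
def letters (m : FreeSemigroup ℕ) : List ℕ := m.head :: m.tail

/-- The support of `f`: the words that occur in `f` with a nonzero coefficient. -/
def words (f : FreeAlg F) : Finset (FreeSemigroup ℕ) := f.coeff.support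

/-- `f` is a multilinear polynomial whose set of variables is `S`: every monomial of `f` contains
each variable of `S` exactly once, and no other variable. -/
def IsMultilinearIn (S : Finset ℕ) (f : FreeAlg F) : Prop :=
  ∀ m ∈ words f, (letters m : Multiset ℕ) = S.val

/-- `f` is a multilinear polynomial. -/
def IsMultilinear (f : FreeAlg F) : Prop := ∃ S : Finset ℕ, IsMultilinearIn S f

/-- `f` is multilinear on the set of variables `X`: every monomial of `f` contains each variable
of `X` exactly once (the other variables are arbitrary). -/
def IsMultilinearOn (X : Finset ℕ) (f : FreeAlg F) : Prop :=
  ∀ m ∈ words f, ∀ x ∈ X, (letters m).count x = 1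

/-- Renaming the variables of a polynomial. -/
def rename (σ : ℕ → ℕ) (f : FreeAlg F) : FreeAlg F :=
  MonoidAlgebra.mapDomain (FreeSemigroup.map σ) f

/-- `f` is alternating on the set of variables `X`: it is of the form
`∑ σ ∈ Sym(X), sgn(σ) h(x_σ(1), …, x_σ(n), Y)` with `h(X, Y)` multilinear on `X`. -/
def IsAlternatingOn (X : Finset ℕ) (f : FreeAlg F) : Prop :=
  ∃ h : FreeAlg F, IsMultilinearOn X h ∧
    f = ∑ σ : Equiv.Perm X,
      ((Equiv.Perm.sign σ : ℤ) : F) • rename (Equiv.Perm.ofSubtype σ : Equiv.Perm ℕ) h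

/-- The value of the polynomial `f` under the substitution `xᵢ ↦ e i`. -/
def evalPoly {A : Type v} [NonUnitalRing A] [Module F A] [IsScalarTower F A A]
    [SMulCommClass F A A] (e : ℕ → A) (f : FreeAlg F) : A :=
  MonoidAlgebra.liftMagma F (FreeSemigroup.lift e) f

end Polynomials

section Identities

variable (F : Type u) [Field F]

/-- `Id(A)`: the polynomial identities of `A`. -/
def identities (A : Type v) [NonUnitalRing A] [Module F A] [IsScalarTower F A A]
    [SMulCommClass F A A] : Set (FreeAlg F) :=
  {f | ∀ e : ℕ → A, evalPoly e f = 0}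

/-- `A` and `B` are PI-equivalent. -/
def PIEquivalent (A : Type v) [NonUnitalRing A] [Module F A] [IsScalarTower F A A]
    [SMulCommClass F A A] (B : Type w) [NonUnitalRing B] [Module F B] [IsScalarTower F B B]
    [SMulCommClass F B B] : Prop :=
  identities F A = identities F B

end Identities

section KemerIndex

variable {F : Type u} [Field F] (Γ : Set (FreeAlg F))

/-- There is a multilinear polynomial outside `Γ` with `ν` alternating sets of cardinality `r` and
`j` alternating sets of cardinality `r + 1`, all these sets being pairwise disjoint. -/
def HasAlternatingOutside (ν r j : ℕ) : Prop :=
  ∃ f : FreeAlg F, f ∉ Γ ∧ IsMultilinear f ∧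
    ∃ X : Fin ν ⊕ Fin j → Finset ℕ,
      Pairwise (fun a b => Disjoint (X a) (X b)) ∧
      (∀ a, (X (Sum.inl a)).card = r) ∧
      (∀ b, (X (Sum.inr b)).card = r + 1) ∧
      ∀ c, IsAlternatingOn (X c) f

/-- `d_ν`: the largest `r` such that some multilinear polynomial outside `Γ` alternates on `ν`
disjoint sets of cardinality `r`. (Meaningful for `ν ≥ 1`; only the limit in `ν` is used.) -/
def dSeq (ν : ℕ) : ℕ := sSup {r | HasAlternatingOutside Γ ν r 0}

/-- The first Kemer parameter, `d = lim d_ν`. -/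
def kemerD : ℕ := limUnder atTop (dSeq Γ)

/-- `s_ν`: the largest `j` such that some multilinear polynomial outside `Γ` alternates on `ν`
sets of cardinality `d` and on `j` sets of cardinality `d + 1`, all of them disjoint. -/
def sSeq (ν : ℕ) : ℕ := sSup {j | HasAlternatingOutside Γ ν (kemerD Γ) j}

/-- The second Kemer parameter, `s = lim s_ν`. -/
def kemerS : ℕ := limUnder atTop (sSeq Γ)

/-- The Kemer index `Ind(Γ) = (d, s)`, in `ℕ × ℕ` with the lexicographic order. -/
def kemerIndex : ℕ ×ₗ ℕ := toLex (kemerD Γ, kemerS Γ)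

end KemerIndex

section Radical

theorem isUnit_one_add_swap {R : Type*} [Ring R] {x y : R} (h : IsUnit (1 + x * y)) :
    IsUnit (1 + y * x) := by
  obtain ⟨c, hc1, hc2⟩ := isUnit_iff_exists.1 h
  refine isUnit_iff_exists.2 ⟨1 - y * c * x, ?_, ?_⟩
  · calc (1 + y * x) * (1 - y * c * x) = 1 + y * x - y * ((1 + x * y) * c) * x := by noncomm_ring
      _ = 1 := by rw [hc1]; noncomm_ring
  · calc (1 - y * c * x) * (1 + y * x) = 1 + y * x - y * (c * (1 + x * y)) * x := by noncomm_ring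
      _ = 1 := by rw [hc2]; noncomm_ring

theorem isQuasiregular_add_mul (F : Type u) [Field F] {A : Type v} [NonUnitalRing A] [Module F A]
    [IsScalarTower F A A] [SMulCommClass F A A] {r s : A} (hr : ∀ a, IsQuasiregular (r * a))
    (hs : ∀ a, IsQuasiregular (s * a)) (a : A) : IsQuasiregular ((r + s) * a) := by
  rw [isQuasiregular_iff_isUnit' F]
  obtain ⟨c, hc1, hc2⟩ := isUnit_iff_exists.1 ((isQuasiregular_iff_isUnit' F).1 (hr a))
  set R : Unitization F A := Unitization.inr r
  set S : Unitization F A := Unitization.inr s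
  set T : Unitization F A := Unitization.inr a
  have hRa : (Unitization.inr (r * a) : Unitization F A) = R * T := Unitization.inr_mul F r a
  rw [hRa] at hc1 hc2
  have key : ∃ b : A, T * c = Unitization.inr b := by
    refine ⟨(T * c).snd, ?_⟩
    ext <;> simp [T]
  obtain ⟨b, hb⟩ := key
  have h1 : IsUnit (1 + S * (T * c)) := by
    have := (isQuasiregular_iff_isUnit' F).1 (hs b)
    rwa [Unitization.inr_mul, ← hb] at this
  have h2 : IsUnit (1 + c * (S * T)) := by
    apply isUnit_one_add_swap
    rwa [mul_assoc]
  have h3 : IsUnit (1 + R * T) := isUnit_iff_exists.2 ⟨c, hc1, hc2⟩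
  have h4 : (1 + (Unitization.inr ((r + s) * a) : Unitization F A))
      = (1 + R * T) * (1 + c * (S * T)) := by
    have : (1 + R * T) * (1 + c * (S * T)) = 1 + R * T + ((1 + R * T) * c) * (S * T) := by
      noncomm_ring
    rw [this, hc1, Unitization.inr_mul, Unitization.inr_add]
    noncomm_ring
  rw [h4]
  exact h3.mul h2

variable (F : Type u) [Field F] (A : Type v) [NonUnitalRing A] [Module F A] [IsScalarTower F A A]
  [SMulCommClass F A A]

/-- The Jacobson radical `J(A)`: the set of all `r` such that every element of `rA` is
quasi-invertible. -/
def jacobsonRadical : Submodule F A where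
  carrier := {r | ∀ a : A, IsQuasiregular (r * a)}
  add_mem' hr hs := isQuasiregular_add_mul F hr hs
  zero_mem' a := by rw [zero_mul]; exact ⟨1, rfl⟩
  smul_mem' c r hr a := by
    have := hr (c • a)
    rwa [mul_smul_comm, ← smul_mul_assoc] at this

variable {F A} in
/-- The powers of a subspace `I` of `A`: `I ^ n` is spanned by the products of `n` elements
of `I` for `n ≥ 1`, and `I ^ 0 = A`. -/
def subspacePow (I : Submodule F A) : ℕ → Submodule F A
  | 0 => ⊤
  | 1 => I
  | n + 2 => Submodule.span F {z | ∃ x ∈ subspacePow I (n + 1), ∃ y ∈ I, z = x * y}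

/-- The nilpotency index `n_A` of `J(A)`: the least `n ≥ 1` with `J(A) ^ n = 0`. -/
def nilIndex : ℕ := sInf {n | 1 ≤ n ∧ subspacePow (jacobsonRadical F A) n = ⊥}

/-- `d(A)`: the dimension of the semisimple part `A / J(A)`. -/
def dimSemisimple : ℕ := Module.finrank F (A ⧸ jacobsonRadical F A)

/-- `Par(A) = (d(A), n_A - 1)`, in `ℕ × ℕ` with the lexicographic order. -/
def parameter : ℕ ×ₗ ℕ := toLex (dimSemisimple F A, nilIndex F A - 1)

/-- `A` is basic: it is not PI-equivalent to a product `B₁ × ⋯ × B_r` of finite dimensional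
algebras with `Par(Bᵢ) < Par(A)` for all `i`. -/
def IsBasic : Prop :=
  ¬ ∃ (r : ℕ) (B : Fin r → Type (max u v)) (_ : ∀ i, NonUnitalRing (B i))
      (_ : ∀ i, Module F (B i)) (_ : ∀ i, IsScalarTower F (B i) (B i))
      (_ : ∀ i, SMulCommClass F (B i) (B i)),
      0 < r ∧ (∀ i, FiniteDimensional F (B i)) ∧ PIEquivalent F A (∀ i, B i) ∧
      ∀ i, parameter F (B i) < parameter F A

/-- A Wedderburn–Malcev decomposition `A = A₁ × ⋯ × A_q ⊕ J(A)`: subalgebras `A₁, …, A_q` of `A`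
that are simple, annihilate each other and are linearly independent, and whose sum
(the semisimple subalgebra) is a vector space complement of `J(A)`. -/
structure WedderburnMalcev where
  q : ℕ
  comp : Fin q → NonUnitalSubalgebra F A
  simple : ∀ i, IsSimpleRing (comp i)
  mul_eq_zero : ∀ i j, i ≠ j → ∀ a ∈ comp i, ∀ b ∈ comp j, a * b = 0
  indep : iSupIndep fun i => (comp i).toSubmodule
  isCompl : IsCompl (⨆ i, (comp i).toSubmodule) (jacobsonRadical F A)

variable {F A}

/-- An evaluation `e` of the variables in `S` such that every value is either semisimple (lies in
a simple component) or radical (lies in `J(A)`). -/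
def WedderburnMalcev.IsAdmissible (W : WedderburnMalcev F A) (S : Finset ℕ) (e : ℕ → A) : Prop :=
  ∀ x ∈ S, (∃ i, e x ∈ W.comp i) ∨ e x ∈ jacobsonRadical F A

/-- `A` is full with respect to `f`, a multilinear polynomial in the variables `S`: in each
nonvanishing evaluation of `f`, every simple component is represented among the values. -/
def WedderburnMalcev.IsFullWrt (W : WedderburnMalcev F A) (S : Finset ℕ) (f : FreeAlg F) : Prop :=
  ∀ e : ℕ → A, W.IsAdmissible S e → evalPoly e f ≠ 0 → ∀ i, ∃ x ∈ S, e x ∈ W.comp i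

open Classical in
/-- `A` has property `K` with respect to `f`, a multilinear polynomial in the variables `S`:
`f` vanishes in each evaluation with fewer than `n_A - 1` radical values. -/
def WedderburnMalcev.HasPropertyKWrt (W : WedderburnMalcev F A) (S : Finset ℕ)
    (f : FreeAlg F) : Prop :=
  ∀ e : ℕ → A, W.IsAdmissible S e →
    (S.filter fun x => e x ∈ jacobsonRadical F A).card < nilIndex F A - 1 → evalPoly e f = 0

/-- `A` is full and satisfies property `K`: there is a multilinear polynomial, not an identity of
`A`, with respect to which `A` is full and has property `K`. -/
def WedderburnMalcev.IsFullWithPropertyK (W : WedderburnMalcev F A) : Prop :=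
  ∃ (S : Finset ℕ) (f : FreeAlg F), IsMultilinearIn S f ∧ f ∉ identities F A ∧
    W.IsFullWrt S f ∧ W.HasPropertyKWrt S f

end Radical

end

end KemerPI

/-! Write d = d(A), s = n_A - 1 and J = J(A). The equivalence is proved along the cycle (1) ⇒ (2') ⇒
(2) ⇒ (3) ⇒ (1).

(1) ⇒ (2'). Let K = F[t]/(t^m) with m = max(s, 1). Inside A ⊗ K, which satisfies all identities of
A, consider for each i the subalgebra B_i spanned by A_j ⊗ 1 with j ≠ i and by J ⊗ t^k with k ≥ 0;
if s > 0, consider also B_0, spanned by all A_j ⊗ 1 and by J ⊗ t^k with k ≥ 1. In B_i the semisimple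
dimension drops. In B_0 a product of s elements of the radical part carries t^s = 0, so the
nilpotency index drops. Since A is basic, it is not PI-equivalent to the product of these algebras,
and some multilinear f is an identity of all of them but not of A (`IsBasic.exists_multilinear`).
Vanishing on B_i says that A is full with respect to f. Vanishing on B_0, at semisimple values a ⊗ 1
and radical values r ⊗ t, says f(e) ⊗ t^k = 0 with k the number of radical values; for k < s this
forces f(e) = 0, which is property K.

(2') ⇒ (2) is Wedderburn's principal theorem (`exists_wedderburnMalcev`), obtained by lifting matrix
units in the unitization of A.

(2) ⇒ (3). A multilinear polynomial alternating on n_A disjoint sets with more than d elements is an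
identity, because each set must receive a radical value (`mem_identities_of_alternating`). This
bounds the Kemer index from above. For the lower bound, f has a nonzero value at Peirce-homogeneous
arguments, and exactly s of them are radical. The unit of each component can be multiplied in as the
value of a new variable u_i (`MatrixUnits.exists_slottedPolynomial`). By multilinearity this unit
becomes one diagonal matrix unit E_αα, and E_αα is the product of ν + s rounds of factors E_αa ·
E_ab · E_bα, each round running over all matrix units of the component. The middle variables of one
round, taken over all components, form a set of d variables; s of these sets are enlarged by one
radical variable each. After alternation only the identity permutation contributes: the outer
factors determine the middle one among the matrix units, and moving a radical variable lowers the
number of radical values, which property K forbids (`SlottedPolynomial.hasAlternatingOutside`).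

(3) ⇒ (1). If A were PI-equivalent to a product of algebras B_i with smaller parameters, a
polynomial realizing Ind(A) = Par(A) with many sets of size d would be a nonidentity of some B_i,
against the upper bound for B_i (`isBasic_of_kemerIndex_eq`). -/

namespace KemerPI

noncomputable section

set_option linter.unusedSectionVars false

/-! ### Evaluation of noncommutative polynomials and multilinearity -/

section Evaluation

variable {F : Type u} [Field F]
variable {A : Type v} [NonUnitalRing A] [Module F A] [IsScalarTower F A A] [SMulCommClass F A A]
variable {B : Type w} [NonUnitalRing B] [Module F B] [IsScalarTower F B B] [SMulCommClass F B B]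

/-- Evaluation of polynomials as a homomorphism. -/
def evalHom (e : ℕ → A) : FreeAlg F →ₙₐ[F] A :=
  MonoidAlgebra.liftMagma F (FreeSemigroup.lift e)

/-- The value of a word. -/
def wordVal (e : ℕ → A) (m : FreeSemigroup ℕ) : A := FreeSemigroup.lift e m

@[simp] theorem evalPoly_zero (e : ℕ → A) : evalPoly e (0 : FreeAlg F) = 0 :=
  map_zero (evalHom e)

@[simp] theorem evalPoly_add (e : ℕ → A) (f g : FreeAlg F) :
    evalPoly e (f + g) = evalPoly e f + evalPoly e g := map_add (evalHom e) f g

@[simp] theorem evalPoly_smul (e : ℕ → A) (c : F) (f : FreeAlg F) :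
    evalPoly e (c • f) = c • evalPoly e f := map_smul (evalHom e) c f

@[simp] theorem evalPoly_mul (e : ℕ → A) (f g : FreeAlg F) :
    evalPoly e (f * g) = evalPoly e f * evalPoly e g := map_mul (evalHom e) f g

theorem evalPoly_sum {ι : Type*} (e : ℕ → A) (s : Finset ι) (f : ι → FreeAlg F) :
    evalPoly e (∑ i ∈ s, f i) = ∑ i ∈ s, evalPoly e (f i) := map_sum (evalHom e) f s

@[simp] theorem wordVal_of (e : ℕ → A) (x : ℕ) : wordVal e (FreeSemigroup.of x) = e x := rfl

@[simp] theorem wordVal_mul (e : ℕ → A) (m m' : FreeSemigroup ℕ) :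
    wordVal e (m * m') = wordVal e m * wordVal e m' := map_mul (FreeSemigroup.lift e) m m'

theorem evalPoly_single (e : ℕ → A) (m : FreeSemigroup ℕ) (c : F) :
    evalPoly e (MonoidAlgebra.single m c) = c • wordVal e m := by
  simp [evalPoly, wordVal, MonoidAlgebra.liftMagma]

theorem evalPoly_eq_sum (e : ℕ → A) (f : FreeAlg F) :
    evalPoly e f = ∑ m ∈ words f, f.coeff m • wordVal e m := by
  conv_lhs => rw [← MonoidAlgebra.sum_coeff_single f]
  rw [Finsupp.sum, evalPoly_sum]
  exact Finset.sum_congr rfl fun m _ => evalPoly_single e m _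

/-- The polynomial consisting of a single word. -/
def mono (m : FreeSemigroup ℕ) : FreeAlg F := MonoidAlgebra.single m 1

@[simp] theorem evalPoly_mono (e : ℕ → A) (m : FreeSemigroup ℕ) :
    evalPoly e (mono m : FreeAlg F) = wordVal e m := by
  rw [mono, evalPoly_single, one_smul]

@[simp] theorem letters_of (x : ℕ) : letters (FreeSemigroup.of x) = [x] := rfl

@[simp] theorem letters_mul (m m' : FreeSemigroup ℕ) :
    letters (m * m') = letters m ++ letters m' := rfl

/-- There is no empty product in a nonunital algebra. In the unitization a word can be cut at a
letter without separate treatment of empty ends. -/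
theorem inr_wordVal (e : ℕ → A) (m : FreeSemigroup ℕ) :
    (Unitization.inr (wordVal e m) : Unitization F A)
      = ((letters m).map fun x => (Unitization.inr (e x) : Unitization F A)).prod := by
  induction m using FreeSemigroup.recOnMul with
  | ih1 x => simp
  | ih2 x y hx hy => simp [Unitization.inr_mul, hy]

theorem map_wordVal (φ : A →ₙₐ[F] B) (e : ℕ → A) (m : FreeSemigroup ℕ) :
    φ (wordVal e m) = wordVal (fun x => φ (e x)) m := by
  induction m using FreeSemigroup.recOnMul with
  | ih1 x => simp
  | ih2 x y hx hy => simp [hy]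

theorem map_evalPoly (φ : A →ₙₐ[F] B) (e : ℕ → A) (f : FreeAlg F) :
    φ (evalPoly e f) = evalPoly (fun x => φ (e x)) f := by
  simp [evalPoly_eq_sum, map_sum, map_wordVal]

theorem evalPoly_evalPoly (e : ℕ → A) (p : ℕ → FreeAlg F) (f : FreeAlg F) :
    evalPoly e (evalPoly p f) = evalPoly (fun x => evalPoly e (p x)) f :=
  map_evalPoly (evalHom e) p f

theorem wordVal_map (e : ℕ → A) (σ : ℕ → ℕ) (m : FreeSemigroup ℕ) :
    wordVal e (FreeSemigroup.map σ m) = wordVal (e ∘ σ) m := by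
  induction m using FreeSemigroup.recOnMul with
  | ih1 x => simp
  | ih2 x y hx hy => simp [hy]

theorem letters_map (σ : ℕ → ℕ) (m : FreeSemigroup ℕ) :
    letters (FreeSemigroup.map σ m) = (letters m).map σ := by
  induction m using FreeSemigroup.recOnMul with
  | ih1 x => simp
  | ih2 x y hx hy => simp [hy]

theorem rename_eq_sum (σ : ℕ → ℕ) (f : FreeAlg F) :
    rename σ f = ∑ m ∈ words f, MonoidAlgebra.single (FreeSemigroup.map σ m) (f.coeff m) := by
  conv_lhs => rw [← MonoidAlgebra.sum_coeff_single f]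
  rw [rename, Finsupp.sum]
  apply MonoidAlgebra.coeff_injective
  ext m
  simp [MonoidAlgebra.mapDomain, Finsupp.mapDomain_finsetSum, words]

theorem evalPoly_rename (e : ℕ → A) (σ : ℕ → ℕ) (f : FreeAlg F) :
    evalPoly e (rename σ f) = evalPoly (e ∘ σ) f := by
  rw [rename_eq_sum, evalPoly_sum, evalPoly_eq_sum]
  simp [evalPoly_single, wordVal_map]

@[simp] theorem mono_mul (m m' : FreeSemigroup ℕ) :
    (mono (m * m') : FreeAlg F) = mono m * mono m' := by
  simp [mono, MonoidAlgebra.single_mul_single]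

theorem rename_eq_evalPoly (σ : ℕ → ℕ) (f : FreeAlg F) :
    rename σ f = evalPoly (fun x => (mono (FreeSemigroup.of (σ x)) : FreeAlg F)) f := by
  rw [rename_eq_sum, evalPoly_eq_sum]
  refine Finset.sum_congr rfl fun m _ => ?_
  have : wordVal (fun x => (mono (FreeSemigroup.of (σ x)) : FreeAlg F)) m
      = mono (FreeSemigroup.map σ m) := by
    clear * -
    induction m using FreeSemigroup.recOnMul with
    | ih1 x => simp
    | ih2 x y hx hy => simp [hy]
  rw [this, mono]
  simp [MonoidAlgebra.smul_single]

theorem mem_words_sum {ι : Type*} {s : Finset ι} {f : ι → FreeAlg F} {m : FreeSemigroup ℕ}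
    (h : m ∈ words (∑ i ∈ s, f i)) : ∃ i ∈ s, m ∈ words (f i) := by
  by_contra hc
  push Not at hc
  simp only [words, Finsupp.mem_support_iff, MonoidAlgebra.coeff_sum, Finsupp.finsetSum_apply]
    at h hc
  exact h (Finset.sum_eq_zero fun i hi => by simpa using hc i hi)

theorem mem_words_smul {c : F} {f : FreeAlg F} {m : FreeSemigroup ℕ}
    (h : m ∈ words (c • f)) : m ∈ words f := by
  simp only [words, Finsupp.mem_support_iff, MonoidAlgebra.coeff_smul, Finsupp.smul_apply] at h ⊢
  exact fun h0 => h (by rw [h0, smul_zero])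

theorem mem_words_single {c : F} {m m' : FreeSemigroup ℕ}
    (h : m ∈ words (MonoidAlgebra.single m' c : FreeAlg F)) : m = m' := by
  classical
  by_contra hne
  simp [words, Ne.symm hne] at h

theorem mem_words_rename {σ : ℕ → ℕ} {f : FreeAlg F} {m : FreeSemigroup ℕ}
    (h : m ∈ words (rename σ f)) : ∃ m' ∈ words f, m = FreeSemigroup.map σ m' := by
  rw [rename_eq_sum] at h
  obtain ⟨m', hm', h⟩ := mem_words_sum h
  exact ⟨m', hm', mem_words_single h⟩

theorem IsMultilinearIn.sum {ι : Type*} {s : Finset ι} {f : ι → FreeAlg F} {S : Finset ℕ}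
    (h : ∀ i ∈ s, IsMultilinearIn S (f i)) : IsMultilinearIn S (∑ i ∈ s, f i) := by
  intro m hm
  obtain ⟨i, hi, hm⟩ := mem_words_sum hm
  exact h i hi m hm

theorem IsMultilinearIn.smul {f : FreeAlg F} {S : Finset ℕ} (h : IsMultilinearIn S f) (c : F) :
    IsMultilinearIn S (c • f) := fun m hm => h m (mem_words_smul hm)

theorem IsMultilinearIn.rename {f : FreeAlg F} {S : Finset ℕ} (h : IsMultilinearIn S f)
    (σ : Equiv.Perm ℕ) (hσ : ∀ x, x ∈ S ↔ σ x ∈ S) : IsMultilinearIn S (rename σ f) := by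
  intro m hm
  obtain ⟨m', hm', rfl⟩ := mem_words_rename hm
  rw [letters_map, ← Multiset.map_coe, h m' hm']
  have : S.map σ.toEmbedding = S := by
    ext x
    simp only [Finset.mem_map_equiv]
    rw [hσ]; simp
  conv_rhs => rw [← this]
  rfl

theorem IsMultilinearIn.mem_iff {f : FreeAlg F} {S : Finset ℕ} (h : IsMultilinearIn S f)
    {m : FreeSemigroup ℕ} (hm : m ∈ words f) (x : ℕ) : x ∈ letters m ↔ x ∈ S := by
  rw [← Finset.mem_val, ← h m hm, Multiset.mem_coe]

theorem IsMultilinearIn.count_eq_one {f : FreeAlg F} {S : Finset ℕ} (h : IsMultilinearIn S f)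
    {m : FreeSemigroup ℕ} (hm : m ∈ words f) {x : ℕ} (hx : x ∈ S) :
    (letters m).count x = 1 := by
  rw [← Multiset.coe_count, h m hm]
  exact Multiset.count_eq_one_of_mem S.nodup hx

theorem IsMultilinearIn.isMultilinearOn {f : FreeAlg F} {S X : Finset ℕ}
    (h : IsMultilinearIn S f) (hX : X ⊆ S) : IsMultilinearOn X f :=
  fun _ hm _ hx => h.count_eq_one hm (hX hx)

theorem wordVal_congr {e e' : ℕ → A} {m : FreeSemigroup ℕ} (h : ∀ x ∈ letters m, e x = e' x) :
    wordVal e m = wordVal e' m := by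
  induction m using FreeSemigroup.recOnMul with
  | ih1 x => simpa using h
  | ih2 x y hx hy =>
    rw [wordVal_mul, wordVal_mul, hx fun z hz => h z (by simp_all),
      hy fun z hz => h z (by simp_all)]

theorem IsMultilinearIn.evalPoly_congr {f : FreeAlg F} {S : Finset ℕ} (h : IsMultilinearIn S f)
    {e e' : ℕ → A} (he : ∀ x ∈ S, e x = e' x) : evalPoly e f = evalPoly e' f := by
  rw [evalPoly_eq_sum, evalPoly_eq_sum]
  refine Finset.sum_congr rfl fun m hm => ?_
  rw [wordVal_congr fun x hx => he x ((h.mem_iff hm x).1 hx)]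

/-- A word is linear in a letter that occurs in it exactly once. -/
theorem wordVal_update (e : ℕ → A) {m : FreeSemigroup ℕ} {x : ℕ} (hx : (letters m).count x = 1) :
    ∃ P Q : Unitization F A, ∀ v : A,
      (Unitization.inr (wordVal (Function.update e x v) m) : Unitization F A)
        = P * Unitization.inr v * Q := by
  have hmem : x ∈ letters m := List.count_pos_iff.1 (by omega)
  obtain ⟨l₁, l₂, hl⟩ := List.append_of_mem hmem
  have hcount : l₁.count x = 0 ∧ l₂.count x = 0 := by
    rw [hl, List.count_append, List.count_cons_self] at hx
    omega
  have key : ∀ l : List ℕ, l.count x = 0 → ∀ v : A,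
      (l.map fun y => (Unitization.inr (Function.update e x v y) : Unitization F A))
        = l.map fun y => Unitization.inr (e y) := by
    intro l hl v
    refine List.map_congr_left fun y hy => ?_
    have : y ≠ x := by
      rintro rfl
      exact List.count_eq_zero.1 hl hy
    rw [Function.update_of_ne this]
  refine ⟨(l₁.map fun y => (Unitization.inr (e y) : Unitization F A)).prod,
    (l₂.map fun y => (Unitization.inr (e y) : Unitization F A)).prod, fun v => ?_⟩
  rw [inr_wordVal, hl, List.map_append, List.prod_append, List.map_cons, List.prod_cons,
    key l₁ hcount.1, key l₂ hcount.2, Function.update_self, mul_assoc]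

theorem isLinearMap_wordVal_update (e : ℕ → A) {m : FreeSemigroup ℕ} {x : ℕ}
    (hx : (letters m).count x = 1) :
    IsLinearMap F fun v => wordVal (Function.update e x v) m := by
  obtain ⟨P, Q, h⟩ := wordVal_update (F := F) e hx
  constructor
  · intro v w
    apply Unitization.inr_injective (R := F)
    rw [h, Unitization.inr_add, Unitization.inr_add, h, h, mul_add, add_mul]
  · intro c v
    apply Unitization.inr_injective (R := F)
    rw [h, Unitization.inr_smul, Unitization.inr_smul, h, mul_smul_comm, smul_mul_assoc]

/-- A multilinear polynomial is linear in each of its variables. -/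
theorem IsMultilinearIn.isLinearMap {f : FreeAlg F} {S : Finset ℕ} (h : IsMultilinearIn S f)
    (e : ℕ → A) {x : ℕ} (hx : x ∈ S) :
    IsLinearMap F fun v => evalPoly (Function.update e x v) f := by
  constructor
  · intro v w
    simp only [evalPoly_eq_sum, ← Finset.sum_add_distrib, ← smul_add]
    refine Finset.sum_congr rfl fun m hm => ?_
    rw [(isLinearMap_wordVal_update (F := F) e (h.count_eq_one hm hx)).map_add]
  · intro c v
    simp only [evalPoly_eq_sum, Finset.smul_sum]
    refine Finset.sum_congr rfl fun m hm => ?_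
    rw [(isLinearMap_wordVal_update (F := F) e (h.count_eq_one hm hx)).map_smul, smul_comm]

/-- If a multilinear polynomial has a nonzero value at arguments taken from linear spans, then it
has a nonzero value at arguments taken from the spanning sets. -/
theorem IsMultilinearIn.exists_evalPoly_ne_zero {f : FreeAlg F} {S : Finset ℕ}
    (h : IsMultilinearIn S f) {e : ℕ → A} {B : ℕ → Set A}
    (he : ∀ x ∈ S, e x ∈ Submodule.span F (B x)) (hf : evalPoly e f ≠ 0) :
    ∃ e' : ℕ → A, (∀ x ∈ S, e' x ∈ B x) ∧ evalPoly e' f ≠ 0 := by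
  classical
  -- The arguments are replaced one at a time. Since `e'` agrees with `e` off `T`, a polynomial
  -- vanishing on all of `B y` in the slot `y` would, by linearity, also vanish at `e y`, the value
  -- still sitting there.
  suffices ∀ T ⊆ S, ∃ e' : ℕ → A, (∀ x ∈ T, e' x ∈ B x) ∧ (∀ x ∉ T, e' x = e x) ∧
      evalPoly e' f ≠ 0 by
    obtain ⟨e', h1, -, h2⟩ := this S subset_rfl
    exact ⟨e', h1, h2⟩
  intro T
  induction T using Finset.induction_on with
  | empty => exact fun _ => ⟨e, by simp, by simp, hf⟩
  | insert y T hy ih =>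
    intro hT
    obtain ⟨e', h1, h2, h3⟩ := ih fun x hx => hT (Finset.mem_insert_of_mem hx)
    have hyS := hT (Finset.mem_insert_self y T)
    obtain ⟨v, hv, hne⟩ : ∃ v ∈ B y, evalPoly (Function.update e' y v) f ≠ 0 := by
      by_contra hc
      push Not at hc
      set L := (h.isLinearMap e' hyS).mk' with hL
      have hle : Submodule.span F (B y) ≤ LinearMap.ker L :=
        Submodule.span_le.2 fun v hv => LinearMap.mem_ker.2 (hc v hv)
      have : evalPoly (Function.update e' y (e y)) f = 0 :=
        LinearMap.mem_ker.1 (hle (he y hyS))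
      rw [← h2 y hy, Function.update_eq_self] at this
      exact h3 this
    refine ⟨Function.update e' y v, ?_, ?_, hne⟩
    · intro x hx
      rcases Finset.mem_insert.1 hx with rfl | hx
      · simpa using hv
      · rw [Function.update_of_ne (fun hxy : x = y => hy (by rw [← hxy]; exact hx))]
        exact h1 x hx
    · intro x hx
      rw [Finset.mem_insert, not_or] at hx
      rw [Function.update_of_ne hx.1, h2 x hx.2]

theorem IsMultilinearIn.evalPoly_eq_zero_of_eq_zero {f : FreeAlg F} {S : Finset ℕ}
    (h : IsMultilinearIn S f) {e : ℕ → A} {x : ℕ} (hx : x ∈ S) (h0 : e x = 0) :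
    evalPoly e f = 0 := by
  have h1 : evalPoly (Function.update e x 0) f = 0 := (h.isLinearMap e hx).map_zero
  have h2 : Function.update e x 0 = e := by rw [← h0, Function.update_eq_self]
  rwa [h2] at h1

/-- Substituting words for the letters of a word. -/
theorem letters_lift (p : ℕ → FreeSemigroup ℕ) (m : FreeSemigroup ℕ) :
    letters (FreeSemigroup.lift p m) = (letters m).flatMap fun x => letters (p x) := by
  induction m using FreeSemigroup.recOnMul with
  | ih1 x => simp
  | ih2 x y hx hy => simp [hy]

theorem wordVal_mono (p : ℕ → FreeSemigroup ℕ) (m : FreeSemigroup ℕ) :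
    wordVal (fun x => (mono (p x) : FreeAlg F)) m = mono (FreeSemigroup.lift p m) := by
  induction m using FreeSemigroup.recOnMul with
  | ih1 x => simp
  | ih2 x y hx hy => simp [hy]

/-- Substituting words for the variables of a multilinear polynomial. -/
theorem IsMultilinearIn.subst {f : FreeAlg F} {S S' : Finset ℕ} (h : IsMultilinearIn S f)
    (p : ℕ → FreeSemigroup ℕ)
    (hp : (∑ x ∈ S, (letters (p x) : Multiset ℕ)) = S'.val) :
    IsMultilinearIn S' (evalPoly (fun x => (mono (p x) : FreeAlg F)) f) := by
  intro m hm
  rw [evalPoly_eq_sum] at hm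
  obtain ⟨m', hm', hm⟩ := mem_words_sum hm
  have hm := mem_words_smul hm
  rw [wordVal_mono] at hm
  rw [mem_words_single hm, letters_lift, ← hp, Finset.sum, ← h m' hm']
  generalize letters m' = l
  induction l with
  | nil => simp
  | cons a l ih =>
    rw [List.flatMap_cons, ← Multiset.coe_add, ih, ← Multiset.cons_coe, Multiset.map_cons,
      Multiset.sum_cons]

theorem words_mul {f g : FreeAlg F} {m : FreeSemigroup ℕ} (h : m ∈ words (f * g)) :
    ∃ m₁ ∈ words f, ∃ m₂ ∈ words g, m = m₁ * m₂ := by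
  classical
  have := MonoidAlgebra.support_coeff_mul_subset f g h
  obtain ⟨a, ha, b, hb, hab⟩ := Finset.mem_mul.1 this
  exact ⟨a, ha, b, hb, hab.symm⟩

theorem IsMultilinearIn.mul {f g : FreeAlg F} {S T : Finset ℕ} (hf : IsMultilinearIn S f)
    (hg : IsMultilinearIn T g) (h : Disjoint S T) :
    IsMultilinearIn (S.disjUnion T h) (f * g) := by
  intro m hm
  obtain ⟨a, ha, b, hb, rfl⟩ := words_mul hm
  rw [letters_mul, ← Multiset.coe_add, hf a ha, hg b hb]
  rfl

theorem isMultilinearIn_mono {S : Finset ℕ} {m : FreeSemigroup ℕ}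
    (h : (letters m : Multiset ℕ) = S.val) : IsMultilinearIn S (mono m : FreeAlg F) := by
  intro m' hm'
  rw [mem_words_single hm', h]

end Evaluation

/-! ### Alternating polynomials -/

section Alternation

variable {F : Type u} [Field F]
variable {A : Type v} [NonUnitalRing A] [Module F A] [IsScalarTower F A A] [SMulCommClass F A A]

theorem rename_smul (σ : ℕ → ℕ) (c : F) (f : FreeAlg F) :
    rename σ (c • f) = c • rename σ f := by
  simp only [rename_eq_evalPoly, evalPoly_smul]

theorem rename_sum {ι : Type*} (σ : ℕ → ℕ) (s : Finset ι) (f : ι → FreeAlg F) :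
    rename σ (∑ i ∈ s, f i) = ∑ i ∈ s, rename σ (f i) := by
  simp only [rename_eq_evalPoly, evalPoly_sum]

theorem rename_rename (σ τ : ℕ → ℕ) (f : FreeAlg F) :
    rename σ (rename τ f) = rename (σ ∘ τ) f := by
  rw [rename_eq_evalPoly σ, evalPoly_rename, rename_eq_evalPoly]
  rfl

theorem rename_id (f : FreeAlg F) : rename id f = f := by
  have : FreeSemigroup.map (id : ℕ → ℕ) = MulHom.id _ := FreeSemigroup.hom_ext rfl
  rw [rename, this]
  apply MonoidAlgebra.coeff_injective
  simp [MonoidAlgebra.mapDomain]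

/-- An alternating polynomial vanishes if two of the alternating variables have equal values. -/
theorem IsAlternatingOn.evalPoly_eq_zero {X : Finset ℕ} {f : FreeAlg F}
    (h : IsAlternatingOn X f) {e : ℕ → A} {x y : ℕ} (hx : x ∈ X) (hy : y ∈ X) (hxy : x ≠ y)
    (he : e x = e y) : evalPoly e f = 0 := by
  classical
  obtain ⟨g, -, rfl⟩ := h
  rw [evalPoly_sum]
  set s : Equiv.Perm X := Equiv.swap ⟨x, hx⟩ ⟨y, hy⟩ with hs
  have hne : (⟨x, hx⟩ : X) ≠ ⟨y, hy⟩ := fun h => hxy (congrArg Subtype.val h)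
  -- The summands of `σ` and `s * σ` take the same value with opposite signs.
  refine Finset.sum_involution (fun σ _ => s * σ) ?_ ?_ (fun _ _ => Finset.mem_univ _) ?_
  · intro σ _
    have h1 : e ∘ (Equiv.Perm.ofSubtype (s * σ) : Equiv.Perm ℕ)
        = e ∘ (Equiv.Perm.ofSubtype σ : Equiv.Perm ℕ) := by
      funext z
      have hsw : (Equiv.Perm.ofSubtype s : Equiv.Perm ℕ) = Equiv.swap x y := by
        rw [hs, Equiv.Perm.ofSubtype_swap_eq]
      rw [map_mul, hsw, Function.comp_apply, Function.comp_apply, Equiv.Perm.mul_apply,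
        Equiv.swap_apply_def]
      split_ifs with h1 h2
      · rw [h1, he]
      · rw [h2, he]
      · rfl
    rw [evalPoly_smul, evalPoly_smul, evalPoly_rename, evalPoly_rename, h1, map_mul, hs,
      Equiv.Perm.sign_swap hne]
    simp
  · intro σ _ _ hc
    have : s = 1 := by simpa using hc
    exact hne (Equiv.swap_eq_one_iff.1 (hs ▸ this))
  · intro σ _
    rw [← mul_assoc, hs, Equiv.swap_mul_self, one_mul]

theorem IsAlternatingOn.count_eq_one {X : Finset ℕ} {f : FreeAlg F} (h : IsAlternatingOn X f)
    {m : FreeSemigroup ℕ} (hm : m ∈ words f) {x : ℕ} (hx : x ∈ X) : (letters m).count x = 1 := by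
  obtain ⟨g, hg, rfl⟩ := h
  obtain ⟨σ, -, hm⟩ := mem_words_sum hm
  obtain ⟨m', hm', rfl⟩ := mem_words_rename (mem_words_smul hm)
  have hσ : x = (Equiv.Perm.ofSubtype σ : Equiv.Perm ℕ) (σ⁻¹ ⟨x, hx⟩ : X) := by
    rw [Equiv.Perm.ofSubtype_apply_coe]
    simp
  rw [letters_map, hσ, List.count_map_of_injective _ _ (Equiv.injective _)]
  exact hg m' hm' _ (σ⁻¹ ⟨x, hx⟩).2

theorem words_nonempty {f : FreeAlg F} (h : f ≠ 0) : (words f).Nonempty := by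
  rw [words, Finsupp.support_nonempty_iff]
  exact fun h0 => h (MonoidAlgebra.coeff_eq_zero.1 h0)

/-- Each word of an alternating polynomial contains every letter of `X`. The zero polynomial has no
words and alternates on any set, hence the hypothesis `h0`. -/
theorem IsAlternatingOn.subset {X S : Finset ℕ} {f : FreeAlg F} (h : IsAlternatingOn X f)
    (hf : IsMultilinearIn S f) (h0 : f ≠ 0) : X ⊆ S := by
  intro x hx
  obtain ⟨m, hm⟩ := words_nonempty h0
  rw [← hf.mem_iff hm]
  exact List.count_pos_iff.1 (by rw [h.count_eq_one hm hx]; exact one_pos)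

/-- In characteristic zero, a polynomial that changes its sign under transpositions of `X` is
alternating on `X`. -/
theorem isAlternatingOn_of_rename_swap [CharZero F] {X : Finset ℕ} {f : FreeAlg F}
    (hf : IsMultilinearOn X f)
    (h : ∀ x ∈ X, ∀ y ∈ X, x ≠ y → rename (Equiv.swap x y) f = -f) : IsAlternatingOn X f := by
  classical
  have key : ∀ σ : Equiv.Perm X, rename (Equiv.Perm.ofSubtype σ : Equiv.Perm ℕ) f
      = ((Equiv.Perm.sign σ : ℤ) : F) • f := by
    intro σ
    induction σ using Equiv.Perm.swap_induction_on with
    | one =>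
      have : ((Equiv.Perm.ofSubtype (1 : Equiv.Perm X) : Equiv.Perm ℕ) : ℕ → ℕ) = id := by
        rw [map_one]; rfl
      rw [this, rename_id]; simp
    | swap_mul σ x y hxy ih =>
      rw [map_mul, Equiv.Perm.coe_mul, ← rename_rename, ih, rename_smul,
        Equiv.Perm.ofSubtype_swap_eq,
        h x x.2 y y.2 (fun h => hxy (Subtype.ext h)), map_mul, Equiv.Perm.sign_swap hxy]
      simp
  set N : F := (Fintype.card (Equiv.Perm X) : F) with hN
  have hN0 : N ≠ 0 := by
    rw [hN]
    exact_mod_cast Fintype.card_ne_zero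
  -- All the signed renamings of `f` equal `f`, so their sum over Sym(X) is `N • f`.
  refine ⟨N⁻¹ • f, fun m hm => hf m (mem_words_smul hm), ?_⟩
  have : ∀ σ : Equiv.Perm X, ((Equiv.Perm.sign σ : ℤ) : F) •
      rename (Equiv.Perm.ofSubtype σ : Equiv.Perm ℕ) (N⁻¹ • f) = N⁻¹ • f := by
    intro σ
    rw [rename_smul, key, smul_comm N⁻¹, smul_smul]
    have h1 : ((Equiv.Perm.sign σ : ℤ) : F) * ((Equiv.Perm.sign σ : ℤ) : F) = 1 := by
      rw [← Int.cast_mul, ← Units.val_mul, Int.units_mul_self]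
      simp
    rw [h1, one_smul]
  rw [Finset.sum_congr rfl fun σ _ => this σ, Finset.sum_const, Finset.card_univ,
    ← Nat.cast_smul_eq_nsmul F, ← hN, smul_smul, mul_inv_cancel₀ hN0, one_smul]

/-- Alternating a multilinear polynomial on disjoint sets of variables, with control of a value. -/
theorem exists_alternating_of_eval [CharZero F] {ι : Type*} {S : Finset ℕ} {h : FreeAlg F}
    (hh : IsMultilinearIn S h) {X : ι → Finset ℕ} (hXS : ∀ c, X c ⊆ S)
    (hX : Pairwise fun a b => Disjoint (X a) (X b)) {e : ℕ → A} (he : evalPoly e h ≠ 0)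
    (hσ : ∀ σ : Equiv.Perm ℕ, (∀ c, ∀ x ∈ X c, σ x ∈ X c) → (∀ x, (∀ c, x ∉ X c) → σ x = x) →
      evalPoly (e ∘ σ) h ≠ 0 → σ = 1) :
    ∃ g : FreeAlg F, IsMultilinearIn S g ∧ evalPoly e g ≠ 0 ∧ ∀ c, IsAlternatingOn (X c) g := by
  classical
  -- `H` is the product of the groups Sym(X c), and the signed sum over it alternates on all the
  -- sets at once. At `e`, hypothesis `hσ` leaves only the summand of the identity.
  set H : Finset (Equiv.Perm S) := Finset.univ.filter fun σ =>
    (∀ c, ∀ x : S, (x : ℕ) ∈ X c → (σ x : ℕ) ∈ X c) ∧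
      ∀ x : S, (∀ c, (x : ℕ) ∉ X c) → σ x = x with hH
  have memH : ∀ σ : Equiv.Perm S, σ ∈ H ↔ (∀ c, ∀ x : S, (x : ℕ) ∈ X c → (σ x : ℕ) ∈ X c) ∧
      ∀ x : S, (∀ c, (x : ℕ) ∉ X c) → σ x = x := fun σ => by simp [hH]
  set g : FreeAlg F := ∑ σ ∈ H, ((Equiv.Perm.sign σ : ℤ) : F) •
    rename (Equiv.Perm.ofSubtype σ : Equiv.Perm ℕ) h with hg
  have hgS : IsMultilinearIn S g := by
    refine IsMultilinearIn.sum fun σ _ => ((hh.rename _ fun x => ?_).smul _)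
    constructor
    · intro hx
      rw [Equiv.Perm.ofSubtype_apply_of_mem _ hx]
      exact (σ ⟨x, hx⟩).2
    · intro hx
      by_contra hc
      rw [Equiv.Perm.ofSubtype_apply_of_not_mem _ hc] at hx
      exact hc hx
  refine ⟨g, hgS, ?_, fun c => ?_⟩
  · rw [hg, evalPoly_sum, Finset.sum_eq_single 1]
    · have h1 : ((Equiv.Perm.ofSubtype (1 : Equiv.Perm S) : Equiv.Perm ℕ) : ℕ → ℕ) = id := by
        rw [map_one]; rfl
      rw [h1, rename_id]
      simpa using he
    · intro σ hσH hne
      rw [memH] at hσH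
      rw [evalPoly_smul, evalPoly_rename]
      by_contra hc
      apply hne
      have hc' : evalPoly (e ∘ (Equiv.Perm.ofSubtype σ : Equiv.Perm ℕ)) h ≠ 0 :=
        fun h0 => hc (by rw [h0, smul_zero])
      have := hσ (Equiv.Perm.ofSubtype σ) ?_ ?_ hc'
      · exact Equiv.Perm.ofSubtype_injective (by rw [this, map_one])
      · intro c x hx
        rw [Equiv.Perm.ofSubtype_apply_of_mem _ (hXS c hx)]
        exact hσH.1 c ⟨x, hXS c hx⟩ hx
      · intro x hx
        by_cases hxS : x ∈ S
        · rw [Equiv.Perm.ofSubtype_apply_of_mem _ hxS, hσH.2 ⟨x, hxS⟩ hx]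
        · rw [Equiv.Perm.ofSubtype_apply_of_not_mem _ hxS]
    · intro h1
      exact absurd ((memH 1).2 ⟨fun _ _ hx => hx, fun _ _ => rfl⟩) h1
  · refine isAlternatingOn_of_rename_swap (hgS.isMultilinearOn (hXS c)) fun x hx y hy hxy => ?_
    set s : Equiv.Perm S := Equiv.swap ⟨x, hXS c hx⟩ ⟨y, hXS c hy⟩ with hs
    have hne : (⟨x, hXS c hx⟩ : S) ≠ ⟨y, hXS c hy⟩ := fun h => hxy (congrArg Subtype.val h)
    have hsw : (Equiv.Perm.ofSubtype s : Equiv.Perm ℕ) = Equiv.swap x y := by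
      rw [hs, Equiv.Perm.ofSubtype_swap_eq]
    have hss : s * s = 1 := Equiv.swap_mul_self _ _
    have hsX : ∀ c' (z : S), (z : ℕ) ∈ X c' → (s z : ℕ) ∈ X c' := by
      intro c' z hz
      rw [hs, Equiv.swap_apply_def]
      split_ifs with h1 h2
      · have : c' = c := by
          by_contra hcc
          exact Finset.disjoint_left.1 (hX hcc) hz (by rw [h1]; exact hx)
        rw [this]; exact hy
      · have : c' = c := by
          by_contra hcc
          exact Finset.disjoint_left.1 (hX hcc) hz (by rw [h2]; exact hy)
        rw [this]; exact hx
      · exact hz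
    have hsfix : ∀ z : S, (∀ c', (z : ℕ) ∉ X c') → s z = z := by
      intro z hz
      refine Equiv.swap_apply_of_ne_of_ne ?_ ?_
      · rintro rfl; exact hz c hx
      · rintro rfl; exact hz c hy
    have hsH : ∀ σ ∈ H, s * σ ∈ H := by
      intro σ hσ
      rw [memH] at hσ ⊢
      refine ⟨fun c' z hz => hsX c' _ (hσ.1 c' z hz), fun z hz => ?_⟩
      rw [Equiv.Perm.mul_apply, hσ.2 z hz, hsfix z hz]
    rw [hg, rename_sum, ← Finset.sum_neg_distrib]
    -- Left multiplication by the transposition `s` permutes `H` and reverses the signs.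
    refine Finset.sum_bij' (fun σ _ => s * σ) (fun σ _ => s * σ) hsH hsH ?_ ?_ ?_
    · intro σ _; rw [← mul_assoc, hss, one_mul]
    · intro σ _; rw [← mul_assoc, hss, one_mul]
    · intro σ _
      rw [rename_smul, rename_rename, ← hsw, ← Equiv.Perm.coe_mul, ← map_mul,
        map_mul Equiv.Perm.sign, hs, Equiv.Perm.sign_swap hne]
      simp

end Alternation

/-! ### The Jacobson radical of a nonunital algebra and its nilpotency -/

section Radical

variable {F : Type u} [Field F]
variable {A : Type v} [NonUnitalRing A] [Module F A] [IsScalarTower F A A] [SMulCommClass F A A]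

/-- An element of the unitization with zero scalar part. -/
theorem exists_inr_eq {x : Unitization F A} (h : x.fst = 0) : ∃ a : A, Unitization.inr a = x :=
  ⟨x.snd, by ext <;> simp [h]⟩

/-- The definition of the radical tests only products `r * b` with `b` in `A`. For t = r * y the
element b = -y * t lies in `A`, and 1 + r * b = 1 - t² = (1 + t)(1 - t), so 1 + t is invertible as
well. -/
theorem isUnit_one_add_of_mem {r : A} (hr : r ∈ jacobsonRadical F A) (y : Unitization F A) :
    IsUnit (1 + Unitization.inr r * y) := by
  obtain ⟨w, hw⟩ : ∃ w : A, Unitization.inr w = Unitization.inr r * y :=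
    exists_inr_eq (by simp)
  obtain ⟨b, hb⟩ : ∃ b : A, (Unitization.inr b : Unitization F A)
      = -(y * Unitization.inr w) := exists_inr_eq (by simp)
  have h1 : IsUnit (1 + (Unitization.inr (r * b) : Unitization F A)) :=
    (isQuasiregular_iff_isUnit' F).1 (hr b)
  rw [Unitization.inr_mul, hb, mul_neg, ← mul_assoc, ← hw] at h1
  set t : Unitization F A := Unitization.inr w
  obtain ⟨c, hc1, hc2⟩ := isUnit_iff_exists.1 h1
  have e1 : (1 + t) * ((1 - t) * c) = 1 := by
    refine Eq.trans ?_ hc1; noncomm_ring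
  have e2 : (c * (1 - t)) * (1 + t) = 1 := by
    refine Eq.trans ?_ hc2; noncomm_ring
  rw [← hw, isUnit_iff_exists]
  refine ⟨(1 - t) * c, e1, ?_⟩
  rwa [← left_inv_eq_right_inv e2 e1]

theorem mul_mem_jacobsonRadical_right {r : A} (hr : r ∈ jacobsonRadical F A) (a : A) :
    r * a ∈ jacobsonRadical F A := fun b => by
  rw [mul_assoc]; exact hr _

theorem mul_mem_jacobsonRadical_left {r : A} (hr : r ∈ jacobsonRadical F A) (a : A) :
    a * r ∈ jacobsonRadical F A := fun b => by
  rw [isQuasiregular_iff_isUnit' F, mul_assoc, Unitization.inr_mul]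
  apply isUnit_one_add_swap
  rw [← Unitization.inr_mul, ← isQuasiregular_iff_isUnit' F, mul_assoc]
  exact hr _

instance finiteDimensional_unitization [FiniteDimensional F A] :
    FiniteDimensional F (Unitization F A) :=
  Module.Finite.of_surjective
    (LinearMap.coprod (Algebra.linearMap F (Unitization F A)) (Unitization.inrHom F F A))
    fun x => ⟨(x.fst, x.snd), by
      ext <;> simp [Algebra.linearMap_apply, Unitization.algebraMap_eq_inl]⟩

theorem inr_mem_jacobson {r : A} (hr : r ∈ jacobsonRadical F A) :
    (Unitization.inr r : Unitization F A) ∈ Ring.jacobson (Unitization F A) := by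
  rw [← Ideal.jacobson_bot, Ideal.mem_jacobson_iff]
  intro y
  have h1 : IsUnit (1 + y * (Unitization.inr r : Unitization F A)) :=
    isUnit_one_add_swap (isUnit_one_add_of_mem hr y)
  obtain ⟨c, -, hc⟩ := isUnit_iff_exists.1 h1
  refine ⟨c, ?_⟩
  rw [Ideal.mem_bot, mul_assoc, sub_eq_zero, ← hc]
  noncomm_ring

theorem isNilpotent_of_mem_jacobson (R : Type*) [Ring R] [Algebra F R] [FiniteDimensional F R]
    {x : R} (hx : x ∈ Ring.jacobson R) : IsNilpotent x := by
  have := IsArtinianRing.of_finite F R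
  obtain ⟨n, hn⟩ := (IsSemiprimaryRing.isNilpotent : IsNilpotent (Ring.jacobson R))
  refine ⟨n, ?_⟩
  have := Ideal.pow_mem_pow hx n
  rwa [hn] at this

theorem isQuasiregular_of_isNilpotent {x : A}
    (hx : IsNilpotent (Unitization.inr x : Unitization F A)) : IsQuasiregular x :=
  (isQuasiregular_iff_isUnit' F).2 hx.isUnit_one_add

/-- This makes the structure theory of unital Artinian rings available. For the converse, the
Jacobson radical of the finite-dimensional unitization is nil, and nilpotent elements are
quasiregular. -/
theorem mem_jacobsonRadical_iff [FiniteDimensional F A] {r : A} :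
    r ∈ jacobsonRadical F A ↔
      (Unitization.inr r : Unitization F A) ∈ Ring.jacobson (Unitization F A) := by
  refine ⟨inr_mem_jacobson, fun h a => isQuasiregular_of_isNilpotent (F := F) ?_⟩
  refine isNilpotent_of_mem_jacobson (F := F) _ ?_
  rw [Unitization.inr_mul]
  exact Ideal.mul_mem_right _ _ h

/-! ### Powers of an ideal -/

section SubspacePow

variable {I : Submodule F A}

theorem mul_right_mem_subspacePow (hr : ∀ x ∈ I, ∀ a, x * a ∈ I) {n : ℕ} {x : A}
    (hx : x ∈ subspacePow I n) (a : A) : x * a ∈ subspacePow I n := by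
  match n with
  | 0 => exact Submodule.mem_top
  | 1 => exact hr x hx a
  | n + 2 =>
    rw [subspacePow] at hx ⊢
    induction hx using Submodule.span_induction with
    | mem z hz =>
      obtain ⟨u, hu, v, hv, rfl⟩ := hz
      exact Submodule.subset_span ⟨u, hu, v * a, hr v hv a, mul_assoc _ _ _⟩
    | zero => rw [zero_mul]; exact Submodule.zero_mem _
    | add y z _ _ hy hz => rw [add_mul]; exact Submodule.add_mem _ hy hz
    | smul c y _ hy => rw [smul_mul_assoc]; exact Submodule.smul_mem _ c hy

theorem mul_left_mem_subspacePow (hl : ∀ x ∈ I, ∀ a, a * x ∈ I) {n : ℕ} {x : A}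
    (hx : x ∈ subspacePow I n) (a : A) : a * x ∈ subspacePow I n := by
  match n with
  | 0 => exact Submodule.mem_top
  | 1 => exact hl x hx a
  | n + 2 =>
    rw [subspacePow] at hx ⊢
    induction hx using Submodule.span_induction with
    | mem z hz =>
      obtain ⟨u, hu, v, hv, rfl⟩ := hz
      exact Submodule.subset_span
        ⟨a * u, mul_left_mem_subspacePow hl hu a, v, hv, (mul_assoc _ _ _).symm⟩
    | zero => rw [mul_zero]; exact Submodule.zero_mem _
    | add y z _ _ hy hz => rw [mul_add]; exact Submodule.add_mem _ hy hz
    | smul c y _ hy => rw [mul_smul_comm]; exact Submodule.smul_mem _ c hy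

theorem mul_mem_subspacePow_succ {n : ℕ} {x y : A} (hx : x ∈ subspacePow I (n + 1)) (hy : y ∈ I) :
    x * y ∈ subspacePow I (n + 2) :=
  Submodule.subset_span ⟨x, hx, y, hy, rfl⟩

theorem subspacePow_succ_le (hr : ∀ x ∈ I, ∀ a, x * a ∈ I) (n : ℕ) :
    subspacePow I (n + 1) ≤ subspacePow I n := by
  match n with
  | 0 => exact le_top
  | n + 1 =>
    refine Submodule.span_le.2 ?_
    rintro _ ⟨u, hu, v, -, rfl⟩
    exact mul_right_mem_subspacePow hr hu v

theorem subspacePow_antitone (hr : ∀ x ∈ I, ∀ a, x * a ∈ I) : Antitone (subspacePow I) :=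
  antitone_nat_of_succ_le (subspacePow_succ_le hr)

theorem mul_mem_subspacePow (hr : ∀ x ∈ I, ∀ a, x * a ∈ I) (hl : ∀ x ∈ I, ∀ a, a * x ∈ I)
    {m n : ℕ} {x y : A} (hx : x ∈ subspacePow I m) (hy : y ∈ subspacePow I n) :
    x * y ∈ subspacePow I (m + n) := by
  match m, n with
  | m, 0 => exact mul_right_mem_subspacePow hr hx y
  | 0, n + 1 => rw [zero_add]; exact mul_left_mem_subspacePow hl hy x
  | m + 1, 1 => exact mul_mem_subspacePow_succ hx hy
  | m + 1, n + 2 =>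
    rw [subspacePow] at hy
    induction hy using Submodule.span_induction with
    | mem z hz =>
      obtain ⟨u, hu, v, hv, rfl⟩ := hz
      rw [← mul_assoc]
      have := mul_mem_subspacePow hr hl hx hu
      rw [show m + 1 + (n + 1) = (m + 1 + n) + 1 by ring] at this
      exact mul_mem_subspacePow_succ this hv
    | zero => rw [mul_zero]; exact Submodule.zero_mem _
    | add y z _ _ hy hz => rw [mul_add]; exact Submodule.add_mem _ hy hz
    | smul c y _ hy => rw [mul_smul_comm]; exact Submodule.smul_mem _ c hy

theorem inr_mem_pow_of_mem_subspacePow {K : Ideal (Unitization F A)} [K.IsTwoSided]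
    (hI : ∀ x ∈ I, Unitization.inr x ∈ K) {n : ℕ} {x : A} (hx : x ∈ subspacePow I (n + 1)) :
    (Unitization.inr x : Unitization F A) ∈ K ^ (n + 1) := by
  match n with
  | 0 => rw [zero_add, Submodule.pow_one]; exact hI x hx
  | n + 1 =>
    rw [subspacePow] at hx
    induction hx using Submodule.span_induction with
    | mem z hz =>
      obtain ⟨u, hu, v, hv, rfl⟩ := hz
      rw [Unitization.inr_mul, Submodule.pow_succ]
      exact Ideal.mul_mem_mul (inr_mem_pow_of_mem_subspacePow hI hu) (hI v hv)
    | zero => rw [Unitization.inr_zero]; exact Submodule.zero_mem _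
    | add y z _ _ hy hz => rw [Unitization.inr_add]; exact Submodule.add_mem _ hy hz
    | smul c y _ hy =>
      have : (Unitization.inr (c • y) : Unitization F A)
          = algebraMap F (Unitization F A) c * Unitization.inr y := by
        rw [← Algebra.smul_def, Unitization.inr_smul]
      rw [this]; exact Ideal.mul_mem_left _ _ hy

theorem inr_pow_of_mem {x : A} (hx : x ∈ I) (n : ℕ) :
    ∃ y ∈ subspacePow I (n + 1), (Unitization.inr x : Unitization F A) ^ (n + 1)
      = Unitization.inr y := by
  induction n with
  | zero => exact ⟨x, hx, by simp⟩
  | succ n ih =>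
    obtain ⟨y, hy, h⟩ := ih
    exact ⟨y * x, mul_mem_subspacePow_succ hy hx, by rw [pow_succ, h, Unitization.inr_mul]⟩

theorem isNilpotent_inr_of_subspacePow {n : ℕ} (hn : 1 ≤ n) (h : subspacePow I n = ⊥) {x : A}
    (hx : x ∈ I) : IsNilpotent (Unitization.inr x : Unitization F A) := by
  obtain ⟨n, rfl⟩ := Nat.exists_eq_add_of_le' hn
  obtain ⟨y, hy, hxy⟩ := inr_pow_of_mem hx n
  rw [h, Submodule.mem_bot] at hy
  exact ⟨n + 1, by rw [hxy, hy, Unitization.inr_zero]⟩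

/-- A right ideal consisting of nilpotent elements lies in the radical. -/
theorem le_jacobsonRadical (hr : ∀ x ∈ I, ∀ a, x * a ∈ I)
    (hI : ∀ x ∈ I, IsNilpotent (Unitization.inr x : Unitization F A)) :
    I ≤ jacobsonRadical F A :=
  fun x hx a => isQuasiregular_of_isNilpotent (F := F) (hI _ (hr x hx a))

end SubspacePow

/-! ### The nilpotency index -/

section NilIndex

variable [FiniteDimensional F A]

variable (F A) in
theorem exists_subspacePow_eq_bot :
    ∃ n, 1 ≤ n ∧ subspacePow (jacobsonRadical F A) n = ⊥ := by
  have := IsArtinianRing.of_finite F (Unitization F A)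
  obtain ⟨n, hn⟩ : IsNilpotent (Ring.jacobson (Unitization F A)) := IsSemiprimaryRing.isNilpotent
  refine ⟨n + 1, by omega, (Submodule.eq_bot_iff _).2 fun x hx => ?_⟩
  have h1 := inr_mem_pow_of_mem_subspacePow (K := Ring.jacobson (Unitization F A))
    (fun x hx => inr_mem_jacobson hx)
    hx
  rw [Submodule.pow_succ, hn, zero_mul, Ideal.zero_eq_bot, Ideal.mem_bot] at h1
  exact Unitization.inr_injective (R := F) (h1.trans (Unitization.inr_zero F).symm)

variable (F A) in
theorem nilIndex_spec :
    1 ≤ nilIndex F A ∧ subspacePow (jacobsonRadical F A) (nilIndex F A) = ⊥ :=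
  Nat.sInf_mem (exists_subspacePow_eq_bot F A)

theorem subspacePow_eq_bot_of_le {n : ℕ} (h : nilIndex F A ≤ n) :
    subspacePow (jacobsonRadical F A) n = ⊥ :=
  le_bot_iff.1 ((subspacePow_antitone (fun _ hx => mul_mem_jacobsonRadical_right hx) h).trans
    (nilIndex_spec F A).2.le)

theorem isNilpotent_inr_of_mem {x : A} (hx : x ∈ jacobsonRadical F A) :
    IsNilpotent (Unitization.inr x : Unitization F A) :=
  isNilpotent_inr_of_subspacePow (nilIndex_spec F A).1 (nilIndex_spec F A).2 hx

end NilIndex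

theorem nilIndex_le {n : ℕ} (hn : 1 ≤ n) (h : subspacePow (jacobsonRadical F A) n = ⊥) :
    nilIndex F A ≤ n := Nat.sInf_le ⟨hn, h⟩

-- The convention I ^ 0 = A lets nonradical letters count as factors of exponent zero.
open Classical in
theorem wordVal_mem_subspacePow (e : ℕ → A) (m : FreeSemigroup ℕ) :
    wordVal e m ∈ subspacePow (jacobsonRadical F A)
      ((letters m).countP fun x => e x ∈ jacobsonRadical F A) := by
  induction m using FreeSemigroup.recOnMul with
  | ih1 x =>
    by_cases hx : e x ∈ jacobsonRadical F A
    · simp [hx, subspacePow]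
    · simp [hx, subspacePow]
  | ih2 x y hx hy =>
    rw [wordVal_mul, letters_mul, List.countP_append]
    exact mul_mem_subspacePow (fun _ hx => mul_mem_jacobsonRadical_right hx)
      (fun _ hx => mul_mem_jacobsonRadical_left hx) hx hy

open Classical in
/-- A multilinear polynomial vanishes if there are at least `n_A` radical values. -/
theorem IsMultilinearIn.evalPoly_eq_zero_of_card [FiniteDimensional F A] {f : FreeAlg F}
    {S : Finset ℕ} (hf : IsMultilinearIn S f) {e : ℕ → A}
    (h : nilIndex F A ≤ (S.filter fun x => e x ∈ jacobsonRadical F A).card) :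
    evalPoly e f = 0 := by
  rw [evalPoly_eq_sum]
  refine Finset.sum_eq_zero fun m hm => ?_
  have h1 := wordVal_mem_subspacePow (F := F) e m
  have h2 : (letters m).countP (fun x => e x ∈ jacobsonRadical F A)
      = (S.filter fun x => e x ∈ jacobsonRadical F A).card := by
    rw [← Multiset.coe_countP, hf m hm, Finset.card_def, Finset.filter_val,
      ← Multiset.countP_eq_card_filter]
  rw [h2, subspacePow_eq_bot_of_le h, Submodule.mem_bot] at h1
  rw [h1, smul_zero]

theorem parameter_lt_iff {B : Type w} [NonUnitalRing B] [Module F B] [IsScalarTower F B B]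
    [SMulCommClass F B B] : parameter F B < parameter F A ↔
      dimSemisimple F B < dimSemisimple F A ∨
      dimSemisimple F B = dimSemisimple F A ∧ nilIndex F B - 1 < nilIndex F A - 1 :=
  Prod.Lex.toLex_lt_toLex

variable [FiniteDimensional F A]

/-- This and the next lemma bound the parameters of an algebra whose radical is not known exactly,
from an approximate decomposition V + N with N inside the radical. The dimension of V bounds d(A),
and if the bound is attained then N is forced to be the whole radical. -/
theorem dimSemisimple_le_of_sup_eq_top {V N : Submodule F A} (hN : N ≤ jacobsonRadical F A)
    (hV : V ⊔ N = ⊤) : dimSemisimple F A ≤ Module.finrank F V := by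
  have h1 := Submodule.finrank_quotient_add_finrank (jacobsonRadical F A)
  have h2 := Submodule.finrank_mono hN
  have h3 := Submodule.finrank_add_le_finrank_add_finrank V N
  rw [hV, finrank_top] at h3
  rw [dimSemisimple]
  omega

theorem eq_jacobsonRadical_of_finrank_le {V N : Submodule F A} (hN : N ≤ jacobsonRadical F A)
    (hV : V ⊔ N = ⊤) (hd : Module.finrank F V ≤ dimSemisimple F A) :
    N = jacobsonRadical F A := by
  have h1 := Submodule.finrank_quotient_add_finrank (jacobsonRadical F A)
  have h3 := Submodule.finrank_add_le_finrank_add_finrank V N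
  rw [hV, finrank_top] at h3
  rw [dimSemisimple] at hd
  exact Submodule.eq_of_le_of_finrank_le hN (by omega)

end Radical

/-! ### The upper bound on alternation -/

section Bound

variable {F : Type u} [Field F]
variable {A : Type v} [NonUnitalRing A] [Module F A] [IsScalarTower F A A] [SMulCommClass F A A]
  [FiniteDimensional F A]

/-- An alternating multilinear polynomial vanishes if the values of the alternating variables lie
in a subspace of too small a dimension. -/
theorem IsAlternatingOn.evalPoly_eq_zero_of_finrank_lt {S X : Finset ℕ} {f : FreeAlg F}
    (h : IsAlternatingOn X f) (hf : IsMultilinearIn S f) {V : Submodule F A} {e : ℕ → A}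
    (he : ∀ x ∈ X, e x ∈ V) (hV : Module.finrank F V < X.card) : evalPoly e f = 0 := by
  by_contra hne
  have hXS : X ⊆ S := h.subset hf fun h0 => hne (by rw [h0, evalPoly_zero])
  have hdep : ¬ LinearIndependent F (fun x : X => (⟨e x, he x x.2⟩ : V)) := by
    intro hli
    have := hli.fintype_card_le_finrank
    rw [Fintype.card_coe] at this
    omega
  -- The linear relation is put into the slot `x₀`. The terms with x ≠ x₀ repeat a value and vanish
  -- by alternation, which leaves `g x₀` times the value of `f`.
  obtain ⟨g, hg, x₀, hx₀⟩ := Fintype.not_linearIndependent_iff.1 hdep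
  set L := (hf.isLinearMap e (hXS x₀.2)).mk' with hL
  have hLe : ∀ x : X, x ≠ x₀ → L (e x) = 0 := by
    intro x hx
    have hx' : (x : ℕ) ≠ x₀ := fun h => hx (Subtype.ext h)
    refine h.evalPoly_eq_zero (e := Function.update e x₀ (e x)) x.2 x₀.2 hx' ?_
    rw [Function.update_self, Function.update_of_ne hx']
  have hsum : ∑ x : X, g x • e x = 0 := by
    simpa using congrArg Subtype.val hg
  have h1 := congrArg L hsum
  rw [map_sum, map_zero, Finset.sum_eq_single x₀
    (fun x _ hx => by rw [map_smul, hLe x hx, smul_zero])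
    (fun h => absurd (Finset.mem_univ _) h), map_smul] at h1
  have h2 : L (e x₀) = evalPoly e f := by
    change evalPoly (Function.update e x₀ (e x₀)) f = _
    rw [Function.update_eq_self]
  rw [h2] at h1
  exact (smul_ne_zero hx₀ hne) h1

/-- A multilinear polynomial with at least `n_A` alternating sets of cardinality greater than
`d(A)` is an identity of `A`. -/
theorem mem_identities_of_alternating {ι : Type*} [Fintype ι] {S : Finset ℕ} {f : FreeAlg F}
    (hf : IsMultilinearIn S f) {X : ι → Finset ℕ}
    (hX : Pairwise fun a b => Disjoint (X a) (X b)) (hcard : ∀ c, dimSemisimple F A < (X c).card)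
    (halt : ∀ c, IsAlternatingOn (X c) f) (hn : nilIndex F A ≤ Fintype.card ι) :
    f ∈ identities F A := by
  classical
  intro e
  by_contra hne
  have hf0 : f ≠ 0 := fun h0 => hne (by rw [h0, evalPoly_zero])
  obtain ⟨V, hV⟩ := Submodule.exists_isCompl (jacobsonRadical F A)
  have hVd : Module.finrank F V = dimSemisimple F A :=
    (LinearEquiv.finrank_eq (Submodule.quotientEquivOfIsCompl _ _ hV)).symm
  have hspan : Submodule.span F ((V : Set A) ∪ jacobsonRadical F A) = ⊤ := by
    rw [Submodule.span_union, Submodule.span_eq, Submodule.span_eq, sup_comm, hV.sup_eq_top]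
  obtain ⟨e', he', hne'⟩ := hf.exists_evalPoly_ne_zero
    (B := fun _ => (V : Set A) ∪ jacobsonRadical F A)
    (fun x _ => by rw [hspan]; exact Submodule.mem_top) hne
  have hXS : ∀ c, X c ⊆ S := fun c => (halt c).subset hf hf0
  -- Without a radical value, all the values on `X c` would lie in `V`, whose dimension d(A) is less
  -- than the number of variables.
  have key : ∀ c, ∃ x ∈ X c, e' x ∈ jacobsonRadical F A := by
    intro c
    by_contra hc
    push Not at hc
    refine hne' ((halt c).evalPoly_eq_zero_of_finrank_lt hf (V := V) (fun x hx => ?_)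
      (by rw [hVd]; exact hcard c))
    rcases he' x (hXS c hx) with h | h
    · exact h
    · exact absurd h (hc x hx)
  choose x hx hxJ using key
  have hinj : Function.Injective x := by
    intro a b hab
    by_contra hne
    exact Finset.disjoint_left.1 (hX hne) (hx a) (by rw [hab]; exact hx b)
  refine hne' (hf.evalPoly_eq_zero_of_card (hn.trans ?_))
  rw [← Finset.card_univ, ← Finset.card_image_of_injective _ hinj]
  refine Finset.card_le_card fun y hy => ?_
  obtain ⟨c, -, rfl⟩ := Finset.mem_image.1 hy
  exact Finset.mem_filter.2 ⟨hXS c (hx c), hxJ c⟩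

end Bound

/-! ### The Kemer index: stabilization, attainment, and (3) ⇒ (1) -/

section Index

variable {F : Type u} [Field F]

theorem HasAlternatingOutside.mono {Γ : Set (FreeAlg F)} {ν ν' r j j' : ℕ}
    (h : HasAlternatingOutside Γ ν' r j') (hν : ν ≤ ν') (hj : j ≤ j') :
    HasAlternatingOutside Γ ν r j := by
  obtain ⟨f, hf, hm, X, h1, h2, h3, h4⟩ := h
  refine ⟨f, hf, hm, X ∘ Sum.map (Fin.castLE hν) (Fin.castLE hj), ?_, fun a => h2 _,
    fun b => h3 _, fun c => h4 _⟩
  intro a b hab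
  refine h1 fun h => hab ?_
  exact Sum.map_injective.2 ⟨Fin.castLE_injective hν, Fin.castLE_injective hj⟩ h

theorem HasAlternatingOutside.right {Γ : Set (FreeAlg F)} {ν r j : ℕ}
    (h : HasAlternatingOutside Γ ν r j) : HasAlternatingOutside Γ j (r + 1) 0 := by
  obtain ⟨f, hf, hm, X, h1, h2, h3, h4⟩ := h
  refine ⟨f, hf, hm, Sum.elim (fun b => X (Sum.inr b)) Fin.elim0, ?_, fun b => h3 b,
    fun b => b.elim0, ?_⟩
  · rintro (a | a) (b | b) hab
    · exact h1 fun h => hab (by simpa using h)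
    · exact b.elim0
    · exact a.elim0
    · exact a.elim0
  · rintro (a | a)
    · exact h4 _
    · exact a.elim0

theorem limUnder_eq_of_eventually {a : ℕ → ℕ} {c n : ℕ} (h : ∀ m ≥ n, a m = c) :
    limUnder atTop a = c := by
  refine Tendsto.limUnder_eq (tendsto_const_nhds.congr' ?_)
  filter_upwards [eventually_ge_atTop n] with m hm using (h m hm).symm

/-- A decreasing sequence of natural numbers stabilizes. Monotonicity is required only from `n` on,
because for ν = 0 the set defining `dSeq` puts no condition on r and its supremum is a default
value. -/
theorem exists_eq_limUnder {a : ℕ → ℕ} {n : ℕ} (h : ∀ l ≥ n, ∀ m ≥ l, a m ≤ a l) :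
    ∃ k ≥ n, ∀ m ≥ k, a m = limUnder atTop a := by
  obtain ⟨k, hk, hmin⟩ : ∃ k ≥ n, ∀ m ≥ n, a k ≤ a m := by
    obtain ⟨k, hk⟩ := exists_minimalFor_of_wellFoundedLT (fun m => n ≤ m) a ⟨n, le_rfl⟩
    refine ⟨k, hk.1, fun m hm => ?_⟩
    by_contra hc
    exact hc (hk.2 hm (by omega))
  have hconst : ∀ m ≥ k, a m = a k := fun m hm => le_antisymm (h k hk m hm) (hmin m (hk.trans hm))
  exact ⟨k, hk, fun m hm => by rw [limUnder_eq_of_eventually hconst, hconst m hm]⟩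

variable {A : Type v} [NonUnitalRing A] [Module F A] [IsScalarTower F A A] [SMulCommClass F A A]
  [FiniteDimensional F A]

theorem lt_nilIndex_of_hasAlternatingOutside {ν r j : ℕ}
    (h : HasAlternatingOutside (identities F A) ν r j) (hr : dimSemisimple F A < r) :
    ν < nilIndex F A := by
  obtain ⟨f, hf, ⟨S, hm⟩, X, h1, h2, h3, h4⟩ := h
  by_contra hc
  exact hf (mem_identities_of_alternating hm (X := fun a => X (Sum.inl a))
    (fun a b hab => h1 fun h => hab (Sum.inl_injective h)) (fun c => by rw [h2]; exact hr)
    (fun c => h4 _) (by rw [Fintype.card_fin]; omega))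

theorem bddAbove_hasAlternatingOutside {ν : ℕ} (hν : 1 ≤ ν) :
    BddAbove {r | HasAlternatingOutside (identities F A) ν r 0} := by
  refine ⟨Module.finrank F A, fun r h => ?_⟩
  obtain ⟨f, hf, ⟨S, hm⟩, X, h1, h2, h3, h4⟩ := h
  by_contra hc
  refine hf fun e => (h4 (Sum.inl ⟨0, hν⟩)).evalPoly_eq_zero_of_finrank_lt hm (V := ⊤)
    (fun _ _ => Submodule.mem_top) ?_
  rw [finrank_top, h2]
  omega

theorem le_dSeq {ν r : ℕ} (hν : 1 ≤ ν) (h : HasAlternatingOutside (identities F A) ν r 0) :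
    r ≤ dSeq (identities F A) ν := le_csSup (bddAbove_hasAlternatingOutside hν) h

variable (F A) in
theorem exists_dSeq_eq : ∃ k ≥ 1, ∀ ν ≥ k, dSeq (identities F A) ν = kemerD (identities F A) :=
  exists_eq_limUnder fun _ hl _ hm =>
    csSup_le_csSup' (bddAbove_hasAlternatingOutside hl) fun _ hr => hr.mono hm le_rfl

-- Once d_k = d, there cannot be k alternating sets of size d + 1. The bound does not depend on ν,
-- so the sets defining s_ν are bounded and their suprema are attained.
variable (F A) in
theorem bddAbove_hasAlternatingOutside_kemerD : ∃ b, ∀ ν j,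
    HasAlternatingOutside (identities F A) ν (kemerD (identities F A)) j → j < b := by
  obtain ⟨k, hk, h⟩ := exists_dSeq_eq F A
  refine ⟨k, fun ν j hj => ?_⟩
  by_contra hc
  have := le_dSeq hk (hj.right.mono (not_lt.1 hc) le_rfl)
  rw [h k le_rfl] at this
  omega

variable (F A) in
theorem exists_sSeq_eq : ∃ k, ∀ ν ≥ k, sSeq (identities F A) ν = kemerS (identities F A) := by
  obtain ⟨b, hb⟩ := bddAbove_hasAlternatingOutside_kemerD F A
  obtain ⟨k, -, hk⟩ := exists_eq_limUnder (a := sSeq (identities F A)) (n := 0) fun l _ m hm =>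
    csSup_le_csSup' ⟨b, fun j hj => (hb _ _ hj).le⟩ fun _ hr => hr.mono hm le_rfl
  exact ⟨k, hk⟩

theorem isAlternatingOn_empty [CharZero F] (f : FreeAlg F) : IsAlternatingOn ∅ f :=
  isAlternatingOn_of_rename_swap (fun _ _ x hx => absurd hx (Finset.notMem_empty x))
    fun x hx => absurd hx (Finset.notMem_empty x)

-- A single variable with empty alternating sets shows that the suprema defining the index are taken
-- over nonempty sets. This is where A ≠ 0 enters.
variable (F A) in
theorem hasAlternatingOutside_zero [CharZero F] [Nontrivial A] (ν : ℕ) :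
    HasAlternatingOutside (identities F A) ν 0 0 := by
  obtain ⟨a, ha⟩ := exists_ne (0 : A)
  refine ⟨mono (FreeSemigroup.of 0), fun h => ha ?_, ⟨{0}, isMultilinearIn_mono rfl⟩,
    fun _ => ∅, fun _ _ _ => Finset.disjoint_empty_left _, fun _ => rfl, fun b => b.elim0,
    fun _ => isAlternatingOn_empty _⟩
  simpa using h fun _ => a

variable (F A) in
/-- The Kemer index is attained, for all `ν`. -/
theorem hasAlternatingOutside_kemer [CharZero F] [Nontrivial A] (ν : ℕ) :
    HasAlternatingOutside (identities F A) ν (kemerD (identities F A))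
      (kemerS (identities F A)) := by
  obtain ⟨k, hk, h⟩ := exists_dSeq_eq F A
  have hd : ∀ ν, HasAlternatingOutside (identities F A) ν (kemerD (identities F A)) 0 := by
    intro ν
    have : HasAlternatingOutside (identities F A) (max k ν) (dSeq (identities F A) (max k ν)) 0 :=
      Nat.sSup_mem ⟨0, hasAlternatingOutside_zero F A _⟩
        (bddAbove_hasAlternatingOutside (hk.trans (le_max_left _ _)))
    rw [h _ (le_max_left _ _)] at this
    exact this.mono (le_max_right _ _) le_rfl
  obtain ⟨l, hl⟩ := exists_sSeq_eq F A
  obtain ⟨b, hb⟩ := bddAbove_hasAlternatingOutside_kemerD F A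
  have : HasAlternatingOutside (identities F A) (max l ν) (kemerD (identities F A))
      (sSeq (identities F A) (max l ν)) :=
    Nat.sSup_mem ⟨0, hd _⟩ ⟨b, fun j hj => (hb _ _ hj).le⟩
  rw [hl _ (le_max_left _ _)] at this
  exact this.mono (le_max_right _ _) le_rfl

/-- The upper bounds hold in every finite-dimensional algebra by
`lt_nilIndex_of_hasAlternatingOutside`; only the existence of enough alternating nonidentities has
to be assumed. -/
theorem kemerIndex_eq_parameter
    (h : ∀ ν, HasAlternatingOutside (identities F A) ν (dimSemisimple F A) (nilIndex F A - 1)) :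
    kemerIndex (identities F A) = parameter F A := by
  have hd : kemerD (identities F A) = dimSemisimple F A := by
    refine limUnder_eq_of_eventually (n := nilIndex F A) fun ν hν => ?_
    refine IsGreatest.csSup_eq ⟨(h ν).mono le_rfl (Nat.zero_le _), fun r hr => ?_⟩
    by_contra hc
    have := lt_nilIndex_of_hasAlternatingOutside hr (not_le.1 hc)
    omega
  have hs : kemerS (identities F A) = nilIndex F A - 1 := by
    refine limUnder_eq_of_eventually (n := 0) fun ν _ => ?_
    rw [sSeq, hd]
    refine IsGreatest.csSup_eq ⟨h ν, fun j hj => ?_⟩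
    have := lt_nilIndex_of_hasAlternatingOutside hj.right (Nat.lt_succ_self _)
    omega
  rw [kemerIndex, parameter, hd, hs]

/-- The projection of a product of algebras. -/
def piProj {ι : Type*} (B : ι → Type w) [∀ i, NonUnitalRing (B i)] [∀ i, Module F (B i)] (i : ι) :
    (∀ i, B i) →ₙₐ[F] B i where
  toFun x := x i
  map_smul' _ _ := rfl
  map_zero' := rfl
  map_add' _ _ := rfl
  map_mul' _ _ := rfl

theorem mem_identities_pi {ι : Type*} {B : ι → Type w} [∀ i, NonUnitalRing (B i)]
    [∀ i, Module F (B i)] [∀ i, IsScalarTower F (B i) (B i)] [∀ i, SMulCommClass F (B i) (B i)]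
    {f : FreeAlg F} : f ∈ identities F (∀ i, B i) ↔ ∀ i, f ∈ identities F (B i) := by
  classical
  constructor
  · intro h i e
    have := congrArg (piProj (F := F) B i) (h fun x => Pi.single i (e x))
    rw [map_evalPoly, map_zero] at this
    simpa [piProj] using this
  · intro h e
    funext i
    have := map_evalPoly (piProj (F := F) B i) e f
    exact this.trans (h i _)

/-- An algebra whose Kemer index equals its parameter is basic. -/
theorem isBasic_of_kemerIndex_eq [CharZero F] [Nontrivial A]
    (h : kemerIndex (identities F A) = parameter F A) : IsBasic F A := by
  rintro ⟨r, B, _, _, _, _, -, hfd, hPI, hlt⟩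
  have h' := toLex_inj.1 h
  rw [Prod.mk.injEq] at h'
  obtain ⟨hd, hs⟩ := h'
  -- This many sets of size d(A) are enough for any of the factors, whichever one `f` turns out not
  -- to vanish on.
  have hA := hasAlternatingOutside_kemer F A (∑ i, nilIndex F (B i))
  rw [hd, hs] at hA
  obtain ⟨f, hf, hrest⟩ := hA
  rw [hPI, mem_identities_pi] at hf
  push Not at hf
  obtain ⟨i, hi⟩ := hf
  have hB : HasAlternatingOutside (identities F (B i)) _ _ _ := ⟨f, hi, hrest⟩
  -- If d(B i) < d(A), the sets of size d(A) are already too large and too many for `B i`. If the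
  -- dimensions agree, then n_A - 1 ≥ n_{B i}, and the n_A - 1 sets of size d(A) + 1 are too many.
  rcases parameter_lt_iff.1 (hlt i) with hlt | ⟨heq, hlt⟩
  · have h1 := lt_nilIndex_of_hasAlternatingOutside hB hlt
    have h2 := Finset.single_le_sum (f := fun i => nilIndex F (B i)) (fun _ _ => Nat.zero_le _)
      (Finset.mem_univ i)
    omega
  · have h1 := lt_nilIndex_of_hasAlternatingOutside hB.right (by omega)
    omega

end Index

/-! ### Reduction to multilinear identities in characteristic zero -/

section Multilinearization

variable {F : Type u} [Field F]
variable {A : Type v} [NonUnitalRing A] [Module F A] [IsScalarTower F A A] [SMulCommClass F A A]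

open Classical in
/-- The part of a polynomial that consists of the words with a given property. -/
def part (p : FreeSemigroup ℕ → Prop) (f : FreeAlg F) : FreeAlg F :=
  ∑ m ∈ (words f).filter p, MonoidAlgebra.single m (f.coeff m)

open Classical in
theorem evalPoly_part (p : FreeSemigroup ℕ → Prop) (f : FreeAlg F) (e : ℕ → A) :
    evalPoly e (part p f) = ∑ m ∈ (words f).filter p, f.coeff m • wordVal e m := by
  rw [part, evalPoly_sum]
  exact Finset.sum_congr rfl fun m _ => evalPoly_single e m _

theorem mem_words_part {p : FreeSemigroup ℕ → Prop} {f : FreeAlg F} {m : FreeSemigroup ℕ}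
    (h : m ∈ words (part p f)) : m ∈ words f ∧ p m := by
  classical
  obtain ⟨m', hm', h⟩ := mem_words_sum h
  rw [mem_words_single h]
  exact Finset.mem_filter.1 hm'

theorem wordVal_smul (c : ℕ → F) (e : ℕ → A) (m : FreeSemigroup ℕ) :
    wordVal (fun x => c x • e x) m = ((letters m).map c).prod • wordVal e m := by
  induction m using FreeSemigroup.recOnMul with
  | ih1 x => simp
  | ih2 x y hx hy =>
    simp only [wordVal_mul, hx, hy, letters_mul, List.map_append, List.prod_append, mul_smul,
      smul_mul_assoc, mul_smul_comm]
    rw [smul_comm]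

theorem list_prod_eq_eval (c : ℕ → F) (l : List ℕ) :
    (l.map c).prod = MvPolynomial.eval c
      (MvPolynomial.monomial (Multiset.toFinsupp (l : Multiset ℕ)) 1) := by
  induction l with
  | nil => simp
  | cons a l ih =>
    rw [List.map_cons, List.prod_cons, ih, ← Multiset.cons_coe, ← Multiset.singleton_add, map_add]
    simp [MvPolynomial.eval_monomial, Finsupp.prod_add_index', pow_add]

open Classical in
/-- The multihomogeneous parts of a polynomial identity are identities. -/
theorem part_mem_identities [Infinite F] {f : FreeAlg F} (hf : f ∈ identities F A)
    (μ : Multiset ℕ) : part (fun m => (letters m : Multiset ℕ) = μ) f ∈ identities F A := by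
  intro e
  rw [evalPoly_part, ← Module.forall_dual_apply_eq_zero_iff F]
  intro φ
  -- Scaling the variable x by c x turns the value of `f` under `φ` into a commutative polynomial in
  -- c. It vanishes as a function on an infinite field, so each coefficient is zero, and the
  -- coefficient at `μ` belongs to the part of content `μ`.
  set p : MvPolynomial ℕ F := ∑ m ∈ words f, MvPolynomial.monomial
    (Multiset.toFinsupp (letters m : Multiset ℕ)) (f.coeff m * φ (wordVal e m)) with hp
  have hp0 : p = 0 := by
    refine MvPolynomial.funext fun c => ?_
    have h1 := congrArg φ (hf fun x => c x • e x)
    rw [evalPoly_eq_sum, map_zero, map_sum] at h1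
    rw [hp, map_sum, map_zero, ← h1]
    refine Finset.sum_congr rfl fun m _ => ?_
    rw [wordVal_smul, map_smul, map_smul, list_prod_eq_eval, smul_eq_mul, smul_eq_mul,
      ← mul_one (f.coeff m * φ (wordVal e m)), ← MvPolynomial.C_mul_monomial, map_mul,
      MvPolynomial.eval_C]
    ring
  have h2 := congrArg (MvPolynomial.coeff (Multiset.toFinsupp μ)) hp0
  rw [hp, MvPolynomial.coeff_sum, MvPolynomial.coeff_zero] at h2
  rw [map_sum, Finset.sum_filter, ← h2]
  refine Finset.sum_congr rfl fun m _ => ?_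
  rw [MvPolynomial.coeff_monomial, map_smul, smul_eq_mul]
  congr 1
  exact propext (Multiset.toFinsupp.injective.eq_iff).symm

open Classical in
theorem mem_identities_of_part {f : FreeAlg F}
    (h : ∀ μ : Multiset ℕ, part (fun m => (letters m : Multiset ℕ) = μ) f ∈ identities F A) :
    f ∈ identities F A := by
  intro e
  rw [evalPoly_eq_sum, ← Finset.sum_fiberwise_of_maps_to
    (t := (words f).image fun m => (letters m : Multiset ℕ))
    (fun m hm => Finset.mem_image_of_mem _ hm)]
  refine Finset.sum_eq_zero fun μ _ => ?_
  have := h μ e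
  rw [evalPoly_part] at this
  rw [← this]
  exact Finset.sum_congr (by ext; simp) fun _ _ => rfl

/-- Substitution of `x + y` for the variable `x`. -/
def split (x y : ℕ) : ℕ → FreeAlg F :=
  Function.update (fun z => mono (FreeSemigroup.of z)) x
    (mono (FreeSemigroup.of x) + mono (FreeSemigroup.of y))

theorem mem_words_add {f g : FreeAlg F} {m : FreeSemigroup ℕ} (h : m ∈ words (f + g)) :
    m ∈ words f ∨ m ∈ words g := by
  classical
  exact Finset.mem_union.1 (Finsupp.support_add h)

/-- Identifying the new letter `y` with `x` recovers a word of `f`. The content of a word after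
splitting is thus determined by its number of occurrences of `y`. -/
theorem map_letters_of_mem_words_split {x y : ℕ} {f : FreeAlg F} {m : FreeSemigroup ℕ}
    {π : ℕ → ℕ} (hy : π y = x) (hπ : ∀ z, z ≠ y → π z = z) (hf : ∀ m ∈ words f, y ∉ letters m)
    (h : m ∈ words (evalPoly (split (F := F) x y) f)) :
    ∃ m' ∈ words f, (letters m).map π = letters m' := by
  have key : ∀ m' m : FreeSemigroup ℕ, y ∉ letters m' →
      m ∈ words (wordVal (split (F := F) x y) m') → (letters m).map π = letters m' := by
    clear * - hy hπ
    intro m'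
    induction m' using FreeSemigroup.recOnMul with
    | ih1 z =>
      intro m hyz h
      have hzy : z ≠ y := fun h => hyz (by simp [h])
      rw [wordVal_of, split, Function.update_apply] at h
      split_ifs at h with hzx
      · rcases mem_words_add h with h | h
        · rw [mem_words_single h, hzx, letters_of, List.map_singleton, hπ x (hzx ▸ hzy)]
        · rw [mem_words_single h, hzx, letters_of, List.map_singleton, hy, letters_of]
      · rw [mem_words_single h, letters_of, List.map_singleton, hπ z hzy]
    | ih2 z m' hz ih =>
      intro m hym h
      rw [letters_mul, List.mem_append, not_or] at hym
      rw [wordVal_mul] at h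
      obtain ⟨m₁, h1, m₂, h2, rfl⟩ := words_mul h
      rw [letters_mul, List.map_append, hz _ hym.1 h1, ih _ hym.2 h2, letters_mul]
  rw [evalPoly_eq_sum] at h
  obtain ⟨m', hm', h⟩ := mem_words_sum h
  exact ⟨m', hm', key m' m (hf m' hm') (mem_words_smul h)⟩

theorem list_prod_ite (l : List ℕ) (x : ℕ) (a : F) :
    (l.map fun z => if z = x then a else 1).prod = a ^ l.count x := by
  induction l with
  | nil => simp
  | cons b l ih =>
    rw [List.map_cons, List.prod_cons, ih, List.count_cons]
    by_cases h : b = x <;> simp [h, pow_succ, mul_comm]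

open Classical in
/-- Splitting off one occurrence of the variable `x` from a multihomogeneous polynomial and
identifying the new variable with `x` again multiplies the polynomial by its degree in `x`. -/
theorem evalPoly_part_split [CharZero F] {μ : Multiset ℕ} {f : FreeAlg F}
    (hf : ∀ m ∈ words f, (letters m : Multiset ℕ) = μ) {x y : ℕ} (hx : x ∈ μ) (hy : y ∉ μ)
    (e : ℕ → A) :
    evalPoly (Function.update e y (e x)) (part (fun m => (letters m : Multiset ℕ) = y ::ₘ μ.erase x)
      (evalPoly (split (F := F) x y) f)) = (μ.count x : F) • evalPoly e f := by
  have hxy : x ≠ y := fun h => hy (h ▸ hx)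
  set f' : FreeAlg F := evalPoly (split (F := F) x y) f with hf'
  set e' := Function.update e y (e x) with he'
  have hyf : ∀ m ∈ words f, y ∉ letters m := fun m hm h => hy (by rw [← hf m hm]; exact h)
  have hpart : ∀ m ∈ words f',
      ((letters m : Multiset ℕ) = y ::ₘ μ.erase x ↔ (letters m).count y = 1) := by
    intro m hm
    obtain ⟨m', hm', h⟩ := map_letters_of_mem_words_split (π := Function.update id y x)
      (Function.update_self _ _ _) (fun z hz => Function.update_of_ne hz _ _) hyf hm
    rw [← Multiset.coe_count]
    constructor
    · intro h
      rw [h, Multiset.count_cons_self, Multiset.count_eq_zero_of_notMem]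
      exact fun h => hy (Multiset.mem_of_mem_erase h)
    · intro hc
      obtain ⟨t, ht⟩ := Multiset.exists_cons_of_mem
        (Multiset.count_pos.1 (by rw [hc]; exact one_pos) : y ∈ (letters m : Multiset ℕ))
      have hyt : y ∉ t := by
        rw [ht, Multiset.count_cons_self] at hc
        exact Multiset.count_eq_zero.1 (by omega)
      have h1 : μ = x ::ₘ t := by
        rw [← hf m' hm', ← h, ← Multiset.map_coe, ht, Multiset.map_cons, Function.update_self]
        congr 1
        conv_rhs => rw [← Multiset.map_id t]
        exact Multiset.map_congr rfl fun z hz =>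
          Function.update_of_ne (fun h : z = y => hyt (h ▸ hz)) _ _
      rw [ht, h1, Multiset.erase_cons_head]
  rw [← sub_eq_zero, ← Module.forall_dual_apply_eq_zero_iff F]
  intro φ
  -- The exponent of the indeterminate counts the occurrences of `y`. Giving `y` the value t • e x
  -- amounts to evaluating `f` with `x` scaled by 1 + t, so p = φ(f(e)) (1 + X) ^ deg_x f. The
  -- coefficient of X is the part linear in `y`, and the binomial coefficient there is the degree in
  -- `x`.
  set p : Polynomial F := ∑ m ∈ words f', Polynomial.C (f'.coeff m * φ (wordVal e' m)) *
    Polynomial.X ^ (letters m).count y with hp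
  have hpq : p = Polynomial.C (φ (evalPoly e f)) * (Polynomial.X + 1) ^ μ.count x := by
    refine Polynomial.funext fun t => ?_
    have h1 : evalPoly (fun z => (if z = y then t else 1) • e' z) f'
        = evalPoly (fun z => (if z = x then 1 + t else 1) • e z) f := by
      rw [hf', evalPoly_evalPoly, evalPoly_eq_sum, evalPoly_eq_sum]
      refine Finset.sum_congr rfl fun m hm => ?_
      congr 1
      refine wordVal_congr fun z hz => ?_
      have hzy : z ≠ y := fun h => hyf m hm (h ▸ hz)
      rw [split, Function.update_apply]
      split_ifs with h
      · subst h
        simp [hxy, he', add_smul]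
      · simp [hzy, he']
    rw [evalPoly_eq_sum, evalPoly_eq_sum] at h1
    have h2 := congrArg φ h1
    simp only [map_sum, wordVal_smul, list_prod_ite, map_smul, smul_eq_mul] at h2
    rw [hp, Polynomial.eval_finsetSum]
    simp only [Polynomial.eval_mul, Polynomial.eval_C, Polynomial.eval_pow, Polynomial.eval_X,
      Polynomial.eval_add, Polynomial.eval_one]
    rw [evalPoly_eq_sum, map_sum, Finset.sum_mul]
    convert h2 using 1
    · exact Finset.sum_congr rfl fun m _ => by ring
    · refine Finset.sum_congr rfl fun m hm => ?_
      rw [← hf m hm, Multiset.coe_count, map_smul, smul_eq_mul]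
      ring
  have h3 := congrArg (fun q => Polynomial.coeff q 1) hpq
  simp only [hp, Polynomial.finsetSum_coeff, Polynomial.coeff_C_mul, Polynomial.coeff_X_pow,
    Polynomial.coeff_X_add_one_pow, Nat.choose_one_right] at h3
  rw [map_sub, map_smul, smul_eq_mul, mul_comm _ (φ _), ← h3, evalPoly_part, map_sum, sub_eq_zero,
    Finset.sum_filter]
  refine Finset.sum_congr rfl fun m hm => ?_
  by_cases hc : (letters m).count y = 1
  · rw [if_pos ((hpart m hm).2 hc), hc, if_pos rfl, map_smul, smul_eq_mul, mul_one]
  · rw [if_neg fun h => hc ((hpart m hm).1 h), if_neg (Ne.symm hc), mul_zero]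

/-- Induction on the degree minus the number of distinct variables. Splitting off one occurrence of
a repeated variable lowers this number, and by `evalPoly_part_split` the original polynomial is
recovered after division by a positive integer. -/
theorem identities_subset_of_homogeneous [CharZero F]
    {B : Type w} [NonUnitalRing B] [Module F B] [IsScalarTower F B B] [SMulCommClass F B B]
    (h : ∀ (S : Finset ℕ) (f : FreeAlg F), IsMultilinearIn S f → f ∈ identities F A →
      f ∈ identities F B) {μ : Multiset ℕ} {f : FreeAlg F}
    (hμ : ∀ m ∈ words f, (letters m : Multiset ℕ) = μ) (hf : f ∈ identities F A) :
    f ∈ identities F B := by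
  classical
  induction hn : Multiset.card μ - μ.toFinset.card using Nat.strong_induction_on
    generalizing μ f with
  | _ n ih =>
    by_cases hnd : μ.Nodup
    · exact h ⟨μ, hnd⟩ f hμ hf
    obtain ⟨x, hx⟩ : ∃ x, 1 < μ.count x := by
      simpa [Multiset.nodup_iff_count_le_one] using hnd
    obtain ⟨y, hy⟩ := Infinite.exists_notMem_finset μ.toFinset
    rw [Multiset.mem_toFinset] at hy
    have hxμ : x ∈ μ := Multiset.count_pos.1 (by omega)
    have h1 : evalPoly (split (F := F) x y) f ∈ identities F A := fun e => by
      rw [evalPoly_evalPoly]; exact hf _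
    have h2 := part_mem_identities h1 (y ::ₘ μ.erase x)
    have hlt : Multiset.card (y ::ₘ μ.erase x) - (y ::ₘ μ.erase x).toFinset.card < n := by
      have ha : (y ::ₘ μ.erase x).toFinset = insert y μ.toFinset := by
        ext z
        simp only [Multiset.mem_toFinset, Multiset.mem_cons, Finset.mem_insert]
        by_cases hz : z = x
        · subst hz
          have : z ∈ μ.erase z := Multiset.count_pos.1 (by rw [Multiset.count_erase_self]; omega)
          simp [this, hxμ]
        · rw [Multiset.mem_erase_of_ne hz]
      have hb : Multiset.card (y ::ₘ μ.erase x) = Multiset.card μ := by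
        rw [Multiset.card_cons, Multiset.card_erase_add_one hxμ]
      have hc : μ.toFinset.card < Multiset.card μ :=
        lt_of_le_of_ne μ.toFinset_card_le fun h =>
          hnd (Multiset.toFinset_card_eq_card_iff_nodup.1 h)
      rw [ha, hb, Finset.card_insert_of_notMem (by rwa [Multiset.mem_toFinset])]
      omega
    have h3 := ih _ hlt (fun m hm => (mem_words_part hm).2) h2 rfl
    intro e
    have h4 := evalPoly_part_split hμ hxμ hy e
    rw [h3] at h4
    exact (smul_eq_zero.1 h4.symm).resolve_left (by exact_mod_cast (by omega : μ.count x ≠ 0))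

/-- In characteristic zero, polynomial identities are determined by the multilinear ones. -/
theorem identities_subset_of_multilinear [CharZero F]
    {B : Type w} [NonUnitalRing B] [Module F B] [IsScalarTower F B B] [SMulCommClass F B B]
    (h : ∀ (S : Finset ℕ) (f : FreeAlg F), IsMultilinearIn S f → f ∈ identities F A →
      f ∈ identities F B) : identities F A ⊆ identities F B :=
  fun _ hf => mem_identities_of_part fun μ =>
    identities_subset_of_homogeneous h (fun _ hm => (mem_words_part hm).2)
      (part_mem_identities hf μ)

end Multilinearization

/-! ### Simple algebras over an algebraically closed field -/

section MatrixUnits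

variable {F : Type u} [Field F] [IsAlgClosed F]

variable (F) in
/-- The semisimple quotient of a finite-dimensional algebra is a product of matrix algebras. -/
theorem exists_surjective_pi_matrix (R : Type v) [Ring R] [Algebra F R] [FiniteDimensional F R] :
    ∃ (n : ℕ) (d : Fin n → ℕ) (π : R →ₐ[F] Π i, Matrix (Fin (d i)) (Fin (d i)) F),
      (∀ i, NeZero (d i)) ∧ Function.Surjective π ∧ ∀ x, π x = 0 ↔ x ∈ Ring.jacobson R := by
  have := IsArtinianRing.of_finite F R
  have : IsSemisimpleRing (R ⧸ Ring.jacobson R) := IsSemiprimaryRing.isSemisimpleRing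
  obtain ⟨n, d, hd, ⟨φ⟩⟩ :=
    IsSemisimpleRing.exists_algEquiv_pi_matrix_of_isAlgClosed F (R ⧸ Ring.jacobson R)
  refine ⟨n, d, φ.toAlgHom.comp (Ideal.Quotient.mkₐ F (Ring.jacobson R)), hd,
    φ.surjective.comp Ideal.Quotient.mk_surjective, fun x => ?_⟩
  rw [AlgHom.comp_apply]
  exact (map_eq_zero_iff φ φ.injective).trans Ideal.Quotient.eq_zero_iff_mem

variable {A : Type v} [NonUnitalRing A] [Module F A] [IsScalarTower F A A] [SMulCommClass F A A]
  [FiniteDimensional F A]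

/-- A simple finite-dimensional algebra that is not nil is a matrix algebra. -/
theorem exists_matrix_equiv [IsSimpleRing A]
    (h : ∃ a : A, ¬ IsNilpotent (Unitization.inr a : Unitization F A)) :
    ∃ (n : ℕ) (φ : A →ₗ[F] Matrix (Fin n) (Fin n) F), NeZero n ∧ Function.Bijective φ ∧
      ∀ x y, φ (x * y) = φ x * φ y := by
  obtain ⟨a, ha⟩ := h
  obtain ⟨k, d, π, hd, hsurj, hker⟩ := exists_surjective_pi_matrix F (Unitization F A)
  -- The kernel of `π` is nil, so the non-nilpotent `a` survives in some matrix block. The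
  -- projection to that block is injective on `A` because its kernel is an ideal of the simple
  -- algebra `A`.
  have hπa : π (Unitization.inr a) ≠ 0 := fun h0 =>
    ha (isNilpotent_of_mem_jacobson (F := F) _ ((hker _).1 h0))
  obtain ⟨i, hi⟩ := Function.ne_iff.1 hπa
  have := hd i
  set ψ : Unitization F A →ₐ[F] Matrix (Fin (d i)) (Fin (d i)) F :=
    (Pi.evalAlgHom F (fun i => Matrix (Fin (d i)) (Fin (d i)) F) i).comp π with hψ
  have hψsurj : Function.Surjective ψ := fun m => by
    obtain ⟨x, hx⟩ := hsurj (Pi.single i m)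
    exact ⟨x, by simp [hψ, hx]⟩
  set φ : A →ₗ[F] Matrix (Fin (d i)) (Fin (d i)) F :=
    ψ.toLinearMap ∘ₗ Unitization.inrHom F F A with hφ
  have hφ_apply : ∀ x, φ x = ψ (Unitization.inr x) := fun x => rfl
  have hmul : ∀ x y, φ (x * y) = φ x * φ y := fun x y => by
    rw [hφ_apply, Unitization.inr_mul, map_mul]; rfl
  refine ⟨d i, φ, hd i, ⟨?_, ?_⟩, hmul⟩
  · let K : TwoSidedIdeal A := TwoSidedIdeal.mk' {x | φ x = 0} (map_zero φ)
      (fun {x y} hx hy => by simp only [Set.mem_ofPred_eq] at *; rw [map_add, hx, hy, add_zero])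
      (fun {x} hx => by simp only [Set.mem_ofPred_eq] at *; rw [map_neg, hx, neg_zero])
      (fun {x y} hy => by simp only [Set.mem_ofPred_eq] at *; rw [hmul, hy, mul_zero])
      (fun {x y} hx => by simp only [Set.mem_ofPred_eq] at *; rw [hmul, hx, zero_mul])
    have hK : ∀ x, x ∈ K ↔ φ x = 0 := fun x => TwoSidedIdeal.mem_mk' _ _ _ _ _ _ _
    rcases eq_bot_or_eq_top K with hb | ht
    · rw [injective_iff_map_eq_zero]
      intro x hx
      rwa [← hK, hb, TwoSidedIdeal.mem_bot] at hx
    · exact absurd ((hK a).1 (ht ▸ trivial)) hi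
  -- `A` is an ideal of its unitization, which maps onto the block; hence the image of `A` is a
  -- nonzero ideal of a simple matrix algebra.
  · have hideal : ∀ (x : A) (m : Matrix (Fin (d i)) (Fin (d i)) F),
        (∃ y, φ y = m * φ x) ∧ ∃ y, φ y = φ x * m := by
      intro x m
      obtain ⟨r, rfl⟩ := hψsurj m
      obtain ⟨y, hy⟩ := exists_inr_eq (x := r * Unitization.inr x) (by simp)
      obtain ⟨z, hz⟩ := exists_inr_eq (x := Unitization.inr x * r) (by simp)
      exact ⟨⟨y, by rw [hφ_apply, hy, map_mul]; rfl⟩, ⟨z, by rw [hφ_apply, hz, map_mul]; rfl⟩⟩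
    let K : TwoSidedIdeal (Matrix (Fin (d i)) (Fin (d i)) F) := TwoSidedIdeal.mk' (Set.range φ)
      ⟨0, map_zero φ⟩
      (by rintro _ _ ⟨x, rfl⟩ ⟨y, rfl⟩; exact ⟨x + y, map_add _ _ _⟩)
      (by rintro _ ⟨x, rfl⟩; exact ⟨-x, map_neg _ _⟩)
      (by rintro m _ ⟨x, rfl⟩; exact (hideal x m).1)
      (by rintro _ m ⟨x, rfl⟩; exact (hideal x m).2)
    have hK : ∀ m, m ∈ K ↔ m ∈ Set.range φ := fun x => TwoSidedIdeal.mem_mk' _ _ _ _ _ _ _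
    have : Nontrivial (Matrix (Fin (d i)) (Fin (d i)) F) := inferInstance
    rcases eq_bot_or_eq_top K with hb | ht
    · have h1 := (hK (φ a)).2 ⟨a, rfl⟩
      rw [hb, TwoSidedIdeal.mem_bot] at h1
      exact absurd h1 hi
    · exact fun m => (hK m).1 (ht ▸ trivial)

end MatrixUnits

/-! ### Simple components and their matrix units -/

section Components

variable {F : Type u} [Field F] {A : Type v} [NonUnitalRing A] [Module F A] [IsScalarTower F A A]
  [SMulCommClass F A A] (W : WedderburnMalcev F A)

theorem WedderburnMalcev.comp_disjoint (i : Fin W.q) {a : A} (h : a ∈ W.comp i)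
    (hJ : a ∈ jacobsonRadical F A) : a = 0 :=
  Submodule.disjoint_def.1 W.isCompl.disjoint a
    (Submodule.mem_iSup_of_mem (p := fun i => (W.comp i).toSubmodule) i h) hJ

/-- The projection to a component along the other components. -/
theorem WedderburnMalcev.mul_mem_of_mem_iSup {i : Fin W.q} {a b : A} (ha : a ∈ W.comp i)
    (hb : b ∈ ⨆ j, (W.comp j).toSubmodule) :
    ∃ c ∈ W.comp i, a * b = a * c ∧ b * a = c * a := by
  induction hb using Submodule.iSup_induction' with
  | mem j x hx =>
    by_cases hij : i = j
    · subst hij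
      exact ⟨x, hx, rfl, rfl⟩
    · exact ⟨0, zero_mem _, by rw [W.mul_eq_zero i j hij a ha x hx, mul_zero],
        by rw [W.mul_eq_zero j i (Ne.symm hij) x hx a ha, zero_mul]⟩
  | zero => exact ⟨0, zero_mem _, rfl, rfl⟩
  | add x y _ _ hx hy =>
    obtain ⟨c, hc, h1, h2⟩ := hx
    obtain ⟨c', hc', h1', h2'⟩ := hy
    exact ⟨c + c', add_mem hc hc', by rw [mul_add, mul_add, h1, h1'],
      by rw [add_mul, add_mul, h2, h2']⟩

theorem WedderburnMalcev.exists_add (a : A) :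
    ∃ b ∈ ⨆ j, (W.comp j).toSubmodule, ∃ r ∈ jacobsonRadical F A, b + r = a :=
  Submodule.mem_sup.1 (W.isCompl.sup_eq_top ▸ Submodule.mem_top)

variable [FiniteDimensional F A]

/-- Simplicity of a nonunital ring does not by itself exclude nil components. If a component were
nil, then for `b` in it every element of bA would be nilpotent modulo the radical, hence nilpotent,
and `b` would lie in the radical, which meets the component trivially. -/
theorem WedderburnMalcev.exists_not_isNilpotent (i : Fin W.q) :
    ∃ a : W.comp i, ¬ IsNilpotent (Unitization.inr a : Unitization F (W.comp i)) := by
  have := W.simple i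
  have hnt : Nontrivial (W.comp i) := by
    by_contra hc
    rw [not_nontrivial_iff_subsingleton] at hc
    obtain ⟨I, K, hIK⟩ := exists_pair_ne (TwoSidedIdeal (W.comp i))
    exact hIK (TwoSidedIdeal.ext fun x => by
      rw [Subsingleton.elim x 0]; exact ⟨fun _ => K.zero_mem, fun _ => I.zero_mem⟩)
  obtain ⟨b, hb⟩ := exists_ne (0 : W.comp i)
  by_contra hc
  push Not at hc
  refine hb (Subtype.ext (W.comp_disjoint i b.2 fun a => ?_))
  obtain ⟨a', ha', r, hr, rfl⟩ := W.exists_add a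
  obtain ⟨c, hc', h1, -⟩ := W.mul_mem_of_mem_iSup b.2 ha'
  refine isQuasiregular_of_isNilpotent (F := F) ?_
  obtain ⟨n, hn⟩ := hc (b * ⟨c, hc'⟩)
  -- Up to radical terms, the powers of b(a' + r) are the powers of bc, with bc in the component.
  have hpow : ∀ n : ℕ, ∃ r' ∈ jacobsonRadical F A, ∃ x : W.comp i,
      (Unitization.inr ((b : A) * (a' + r)) : Unitization F A) ^ (n + 1)
        = Unitization.inr ((x : A) + r') ∧
      (Unitization.inr (b * ⟨c, hc'⟩) : Unitization F (W.comp i)) ^ (n + 1)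
        = Unitization.inr x := by
    intro n
    induction n with
    | zero =>
      refine ⟨(b : A) * r, mul_mem_jacobsonRadical_left hr _, b * ⟨c, hc'⟩, ?_, by simp⟩
      rw [zero_add, pow_one, mul_add, h1]; rfl
    | succ n ih =>
      obtain ⟨r', hr', x, hx1, hx2⟩ := ih
      refine ⟨(x : A) * ((b : A) * r) + r' * ((b : A) * (a' + r)), ?_, x * (b * ⟨c, hc'⟩), ?_, ?_⟩
      · exact add_mem (mul_mem_jacobsonRadical_left (mul_mem_jacobsonRadical_left hr _) _)
          (mul_mem_jacobsonRadical_right hr' _)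
      · rw [pow_succ, hx1, ← Unitization.inr_mul]
        congr 1
        have : ((x * (b * ⟨c, hc'⟩) : W.comp i) : A) = x * (b * c) := rfl
        rw [this, ← h1]
        noncomm_ring
      · rw [pow_succ, hx2, ← Unitization.inr_mul]
  obtain ⟨r', hr', x, hx1, hx2⟩ := hpow n
  have hx0 : x = 0 := by
    rw [pow_succ, hn, zero_mul] at hx2
    exact Unitization.inr_injective (R := F) (hx2.symm.trans (Unitization.inr_zero F).symm)
  rw [hx0, ZeroMemClass.coe_zero, zero_add] at hx1
  obtain ⟨k, hk⟩ := isNilpotent_inr_of_mem hr'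
  exact ⟨(n + 1) * k, by rw [pow_mul, hx1, hk]⟩

/-- Matrix units in the simple components of a Wedderburn–Malcev decomposition. -/
structure MatrixUnits where
  n : Fin W.q → ℕ
  n_pos : ∀ i, NeZero (n i)
  E : ∀ i, Fin (n i) → Fin (n i) → A
  mem : ∀ i a b, E i a b ∈ W.comp i
  mul_self : ∀ i a b c d, E i a b * E i c d = if b = c then E i a d else 0
  basis : ∀ i, LinearIndependent F (fun p : Fin (n i) × Fin (n i) => E i p.1 p.2)
  span : ∀ i, (W.comp i).toSubmodule
    = Submodule.span F (Set.range fun p : Fin (n i) × Fin (n i) => E i p.1 p.2)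

variable [IsAlgClosed F]

theorem WedderburnMalcev.exists_matrixUnits : Nonempty (MatrixUnits W) := by
  have key : ∀ i, ∃ (n : ℕ) (φ : W.comp i →ₗ[F] Matrix (Fin n) (Fin n) F), NeZero n ∧
      Function.Bijective φ ∧ ∀ x y, φ (x * y) = φ x * φ y := fun i => by
    have := W.simple i
    have : FiniteDimensional F (W.comp i) :=
      inferInstanceAs (FiniteDimensional F (W.comp i).toSubmodule)
    exact exists_matrix_equiv (W.exists_not_isNilpotent i)
  choose n φ hn hφ hmul using key
  let ψ : ∀ i, W.comp i ≃ₗ[F] Matrix (Fin (n i)) (Fin (n i)) F :=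
    fun i => LinearEquiv.ofBijective (φ i) (hφ i)
  have hψ : ∀ i x y, (ψ i).symm x * (ψ i).symm y = (ψ i).symm (x * y) := by
    intro i x y
    rw [LinearEquiv.eq_symm_apply]
    change φ i _ = _
    rw [hmul]
    exact congrArg₂ _ ((ψ i).apply_symm_apply x) ((ψ i).apply_symm_apply y)
  have hbasis : ∀ i, ∃ B : Module.Basis (Fin (n i) × Fin (n i)) F (W.comp i).toSubmodule,
      ∀ p, B p = (ψ i).symm (Matrix.single p.1 p.2 1) := fun i =>
    ⟨(Matrix.stdBasis F (Fin (n i)) (Fin (n i))).map (ψ i).symm, fun ⟨a, b⟩ => by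
      simp [Matrix.stdBasis_eq_single]⟩
  choose B hB using hbasis
  refine ⟨⟨n, hn, fun i a b => ((ψ i).symm (Matrix.single a b 1) : W.comp i),
    fun i a b => Subtype.coe_prop _, fun i a b c d => ?_, fun i => ?_, fun i => ?_⟩⟩
  · rw [← NonUnitalSubalgebra.coe_mul, hψ]
    split_ifs with h
    · subst h
      simp
    · rw [Matrix.single_mul_single_of_ne _ _ _ _ h]
      simp
  · have := (B i).linearIndependent.map' (W.comp i).toSubmodule.subtype (Submodule.ker_subtype _)
    have h2 : (fun p : Fin (n i) × Fin (n i) =>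
        (((ψ i).symm (Matrix.single p.1 p.2 1) : W.comp i) : A))
          = (W.comp i).toSubmodule.subtype ∘ B i := by
      funext p
      simp [hB]
    rw [← h2] at this
    exact this
  · have := congrArg (Submodule.map (W.comp i).toSubmodule.subtype) (B i).span_eq
    rw [Submodule.map_span, Submodule.map_top, Submodule.range_subtype, ← Set.range_comp] at this
    rw [← this]
    congr 2
    funext p
    simp [hB]

end Components

/-! ### Lifting idempotents and matrix units along nil ideals -/

section Lifting

variable {R : Type*} {S : Type*} [Ring R] [Ring S]

/-- Equivalences of idempotents lift along nil ideals. -/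
theorem exists_lift_equivalence (π : R →+* S) (hπ : Function.Surjective π)
    (hker : ∀ x ∈ RingHom.ker π, IsNilpotent x) {p q : R} (hp : IsIdempotentElem p)
    (hq : IsIdempotentElem q) {x y : S} (hx : π p * x * π q = x) (hy : π q * y * π p = y)
    (hxy : x * y = π p) (hyx : y * x = π q) :
    ∃ a b : R, π a = x ∧ π b = y ∧ p * a = a ∧ a * q = a ∧ q * b = b ∧ b * p = b ∧
      a * b = p ∧ b * a = q := by
  obtain ⟨a₀, rfl⟩ := hπ x
  obtain ⟨b₀, rfl⟩ := hπ y
  set a := p * a₀ * q with ha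
  set b₁ := q * b₀ * p with hb₁
  have hpa : p * a = a := by rw [ha, ← mul_assoc, ← mul_assoc, hp.eq]
  have haq : a * q = a := by rw [ha, mul_assoc, hq.eq]
  have hqb : q * b₁ = b₁ := by rw [hb₁, ← mul_assoc, ← mul_assoc, hq.eq]
  have hbp : b₁ * p = b₁ := by rw [hb₁, mul_assoc, hp.eq]
  have hπa : π a = π a₀ := by rw [ha, map_mul, map_mul, hx]
  have hπb : π b₁ = π b₀ := by rw [hb₁, map_mul, map_mul, hy]
  -- The error `j` is nilpotent and a * b₁ = p * (1 - j), so multiplying `b₁` on the right by the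
  -- inverse of 1 - j makes the first product exactly `p`.
  set j := p - a * b₁ with hj
  have hπj : π j = 0 := by rw [hj, map_sub, map_mul, hπa, hπb, hxy, sub_self]
  have hpj : p * j = j := by rw [hj, mul_sub, hp.eq, ← mul_assoc, hpa]
  have hjp : j * p = j := by rw [hj, sub_mul, hp.eq, mul_assoc, hbp]
  obtain ⟨k, hk1, hk2⟩ := isUnit_iff_exists.1 (hker j hπj).isUnit_one_sub
  have hpk : p * k = k * p := by
    have h1 : p * (1 - j) = (1 - j) * p := by rw [mul_sub, sub_mul, hpj, hjp, mul_one, one_mul]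
    calc p * k = k * (1 - j) * (p * k) := by rw [hk2, one_mul]
      _ = k * (p * (1 - j)) * k := by rw [h1]; noncomm_ring
      _ = k * p * ((1 - j) * k) := by noncomm_ring
      _ = k * p := by rw [hk1, mul_one]
  have hπk : π k = 1 := by
    have := congrArg π hk1
    rwa [map_mul, map_sub, map_one, hπj, sub_zero, one_mul] at this
  have hab : a * (b₁ * k) = p := by
    have : a * b₁ = p * (1 - j) := by rw [mul_sub, hpj, mul_one, hj]; abel
    rw [← mul_assoc, this, mul_assoc, hk1, mul_one]
  have hπb' : π (b₁ * k) = π b₀ := by rw [map_mul, hπk, mul_one, hπb]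
  have hqb' : q * (b₁ * k) = b₁ * k := by rw [← mul_assoc, hqb]
  have hbp' : b₁ * k * p = b₁ * k := by rw [mul_assoc, ← hpk, ← mul_assoc, hbp]
  refine ⟨a, b₁ * k, hπa, hπb', hpa, haq, hqb', hbp', hab, ?_⟩
  generalize b₁ * k = b at *
  -- The other product needs no correction: b * a and `q` are commuting idempotents with nilpotent
  -- difference, hence equal.
  have hidem : IsIdempotentElem (b * a) := by
    rw [IsIdempotentElem, mul_assoc, ← mul_assoc a, hab, hpa]
  refine eq_of_isNilpotent_sub_of_isIdempotentElem_of_commute hidem hq (hker _ ?_) ?_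
  · rw [RingHom.mem_ker, map_sub, map_mul, hπa, hπb', hyx, sub_self]
  · rw [Commute, SemiconjBy, mul_assoc b a q, haq, ← mul_assoc q b a, hqb']

/-- Matrix units lift along nil ideals. -/
theorem exists_lift_matrixUnits {ι : Type*} [Finite ι] {d : ι → ℕ} [∀ i, NeZero (d i)]
    (π : R →+* S) (hπ : Function.Surjective π) (hker : ∀ x ∈ RingHom.ker π, IsNilpotent x)
    (s : ∀ i, Fin (d i) → Fin (d i) → S)
    (hs : ∀ i a b c e, s i a b * s i c e = if b = c then s i a e else 0)
    (hs' : ∀ i j, i ≠ j → ∀ a b c e, s i a b * s j c e = 0) :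
    ∃ E : ∀ i, Fin (d i) → Fin (d i) → R, (∀ i a b, π (E i a b) = s i a b) ∧
      (∀ i a b c e, E i a b * E i c e = if b = c then E i a e else 0) ∧
      ∀ i j, i ≠ j → ∀ a b c e, E i a b * E j c e = 0 := by
  have horth : OrthogonalIdempotents fun p : Σ i, Fin (d i) => s p.1 p.2 p.2 := by
    refine ⟨fun p => by simp [IsIdempotentElem, hs], ?_⟩
    rintro ⟨i, a⟩ ⟨j, b⟩ hab
    by_cases hij : i = j
    · subst hij
      simp only [hs]
      exact if_neg fun h => hab (by rw [h])
    · exact hs' i j hij _ _ _ _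
  obtain ⟨t, ht, hπt⟩ := OrthogonalIdempotents.lift_of_isNilpotent_ker π hker horth
    fun p => hπ _
  have hπt' : ∀ i a, π (t ⟨i, a⟩) = s i a a := fun i a => congrFun hπt ⟨i, a⟩
  -- With the diagonal idempotents lifted, only the first row `u` and the first column `v` of each
  -- block are lifted; v a * u b is then the matrix unit at (a, b).
  have key : ∀ (i : ι) (a : Fin (d i)), ∃ u v : R, π u = s i 0 a ∧ π v = s i a 0 ∧
      t ⟨i, 0⟩ * u = u ∧ u * t ⟨i, a⟩ = u ∧ t ⟨i, a⟩ * v = v ∧ v * t ⟨i, 0⟩ = v ∧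
      u * v = t ⟨i, 0⟩ ∧ v * u = t ⟨i, a⟩ := fun i a =>
    exists_lift_equivalence π hπ hker (ht.idem _) (ht.idem _) (by simp [hπt', hs])
      (by simp [hπt', hs]) (by simp [hπt', hs]) (by simp [hπt', hs])
  choose u v hu hv h1 h2 h3 h4 h5 h6 using key
  have huv : ∀ i j a b, (⟨i, a⟩ : Σ i, Fin (d i)) ≠ ⟨j, b⟩ → u i a * v j b = 0 := by
    intro i j a b hne
    rw [← h2, ← h3, mul_assoc, ← mul_assoc (t _), ht.ortho hne, zero_mul, mul_zero]
  refine ⟨fun i a b => v i a * u i b, fun i a b => ?_, fun i a b c e => ?_,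
    fun i j hij a b c e => ?_⟩
  · rw [map_mul, hu, hv, hs, if_pos rfl]
  · split_ifs with h
    · subst h
      rw [mul_assoc, ← mul_assoc (u i b), h5, h1]
    · rw [mul_assoc, ← mul_assoc (u i b), huv i i b c (fun hbc => h (by simpa using hbc)),
        zero_mul, mul_zero]
  · rw [mul_assoc, ← mul_assoc (u i b), huv i j b c (fun hbc => hij (congrArg Sigma.fst hbc)),
      zero_mul, mul_zero]

end Lifting

/-! ### Wedderburn's principal theorem -/

section Existence

theorem isSimpleRing_of_ringEquiv {R : Type v} {S : Type w} [NonUnitalRing R] [NonUnitalRing S]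
    [hR : IsSimpleRing R] (e : R ≃+* S) : IsSimpleRing S := by
  let I (K : TwoSidedIdeal S) : TwoSidedIdeal R := TwoSidedIdeal.mk' {x | e x ∈ K}
      (by simp [K.zero_mem])
      (fun {x y} hx hy => by
        simp only [Set.mem_ofPred_eq] at *; rw [map_add]; exact K.add_mem hx hy)
      (fun {x} hx => by simp only [Set.mem_ofPred_eq] at *; rw [map_neg]; exact K.neg_mem hx)
      (fun {x y} hy => by
        simp only [Set.mem_ofPred_eq] at *; rw [map_mul]; exact K.mul_mem_left _ _ hy)
      (fun {x y} hx => by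
        simp only [Set.mem_ofPred_eq] at *; rw [map_mul]; exact K.mul_mem_right _ _ hx)
  have hI : ∀ K x, x ∈ I K ↔ e x ∈ K := fun K x => TwoSidedIdeal.mem_mk' _ _ _ _ _ _ _
  have hinj : Function.Injective I := fun K L h => TwoSidedIdeal.ext fun x => by
    obtain ⟨y, rfl⟩ := e.surjective x
    rw [← hI, h, hI]
  have hbot : I ⊥ = ⊥ := TwoSidedIdeal.ext fun x => by
    rw [hI, TwoSidedIdeal.mem_bot, TwoSidedIdeal.mem_bot, EmbeddingLike.map_eq_zero_iff]
  have htop : I ⊤ = ⊤ := TwoSidedIdeal.ext fun x => by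
    rw [hI]; exact ⟨fun _ => trivial, fun _ => trivial⟩
  have hnt : Nontrivial (TwoSidedIdeal S) := ⟨⊥, ⊤, fun h => ?_⟩
  · exact ⟨⟨fun K => (eq_bot_or_eq_top (I K)).imp (fun h => hinj (h.trans hbot.symm))
      fun h => hinj (h.trans htop.symm)⟩⟩
  · exact bot_ne_top (α := TwoSidedIdeal R) (by rw [← hbot, h, htop])

variable {F : Type u} [Field F] {A : Type v} [NonUnitalRing A] [Module F A] [IsScalarTower F A A]
  [SMulCommClass F A A]

/-- A Wedderburn–Malcev decomposition from components indexed by a finite type. -/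
theorem WedderburnMalcev.nonempty_of_fintype {ι : Type*} [Finite ι]
    (comp : ι → NonUnitalSubalgebra F A)
    (simple : ∀ i, IsSimpleRing (comp i))
    (mul_eq_zero : ∀ i j, i ≠ j → ∀ a ∈ comp i, ∀ b ∈ comp j, a * b = 0)
    (indep : iSupIndep fun i => (comp i).toSubmodule)
    (isCompl : IsCompl (⨆ i, (comp i).toSubmodule) (jacobsonRadical F A)) :
    Nonempty (WedderburnMalcev F A) := by
  cases nonempty_fintype ι
  let φ := (Fintype.equivFin ι).symm
  exact ⟨⟨Fintype.card ι, fun i => comp (φ i), fun i => simple _,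
    fun i j hij => mul_eq_zero _ _ fun h => hij (φ.injective h),
    indep.comp φ.injective, by
      rwa [φ.iSup_comp (g := fun i => (comp i).toSubmodule)]⟩⟩

variable [IsAlgClosed F] [FiniteDimensional F A]

variable (F A) in
/-- Wedderburn's principal theorem over an algebraically closed field. -/
theorem exists_wedderburnMalcev : Nonempty (WedderburnMalcev F A) := by
  obtain ⟨k, d, π, hd, hsurj, hker⟩ := exists_surjective_pi_matrix F (Unitization F A)
  have hnil : ∀ x ∈ RingHom.ker π.toRingHom, IsNilpotent x := fun x hx =>
    isNilpotent_of_mem_jacobson (F := F) _ ((hker x).1 hx)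
  obtain ⟨E, hE, hmul, hmul'⟩ := exists_lift_matrixUnits π.toRingHom hsurj hnil
    (fun i a b => Pi.single i (Matrix.single a b (1 : F)))
    (fun i a b c e => by
      rw [← Pi.single_mul]
      split_ifs with h
      · subst h; simp
      · simp [h])
    (fun i j hij a b c e => by
      funext l
      by_cases hl : l = i
      · subst hl; simp [hij]
      · simp [hl])
  have hE : ∀ i a b, π (E i a b) = Pi.single i (Matrix.single a b (1 : F)) := hE
  -- The scalar part is a ring homomorphism to a field, so it kills nilpotent elements.
  have hfst : ∀ x, π x = 0 → x.fst = 0 := fun x hx => by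
    have := (hnil x hx).map (Unitization.fstHom F A)
    exact this.eq_zero
  -- The blocks whose lifted matrix units lie in `A` itself; the other blocks come from the adjoined
  -- unit.
  let ι := {i : Fin k // ∀ a b, (E i a b).fst = 0}
  have : Fintype ι := Fintype.ofFinite ι
  -- If `x` had a nonzero entry (a, b) in block j, then E c a · x · E b e would agree with that
  -- multiple of E c e modulo the radical. The product has zero scalar part because `x` does, so
  -- every E c e would have zero scalar part too.
  have hout : ∀ (x : A) (j : Fin k), (¬ ∀ a b, (E j a b).fst = 0) →
      π (Unitization.inr x) j = 0 := by
    intro x j hj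
    by_contra hne
    apply hj
    obtain ⟨a, b, hab⟩ : ∃ a b, π (Unitization.inr x) j a b ≠ 0 := by
      by_contra hc
      push Not at hc
      exact hne (by ext a b; exact hc a b)
    intro c e
    set z := E j c a * Unitization.inr x * E j b e -
      π (Unitization.inr x) j a b • E j c e with hz
    have hz0 : π z = 0 := by
      rw [hz, map_sub, map_mul, map_mul, map_smul, hE, hE, hE]
      funext l
      by_cases hl : l = j
      · subst hl
        simp only [Pi.sub_apply, Pi.mul_apply, Pi.smul_apply, Pi.single_eq_same,
          Matrix.single_mul_mul_single, one_mul, mul_one, Pi.zero_apply,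
          Matrix.smul_single, smul_eq_mul, sub_self]
      · simp [hl]
    have := hfst z hz0
    rw [hz, sub_eq_add_neg, Unitization.fst_add, Unitization.fst_neg, Unitization.fst_smul] at this
    simpa [hab] using this
  let φ : ∀ i : ι, Matrix (Fin (d i)) (Fin (d i)) F →ₗ[F] A := fun i =>
    (Matrix.stdBasis F (Fin (d i)) (Fin (d i))).constr F fun p => (E i p.1 p.2).snd
  have hφ : ∀ (i : ι) a b, Unitization.inr (φ i (Matrix.single a b 1)) = E i a b := by
    intro i a b
    rw [← Matrix.stdBasis_eq_single, Module.Basis.constr_basis]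
    ext
    · simp [i.2 a b]
    · simp
  let ρ : ∀ i : Fin k, A →ₗ[F] Matrix (Fin (d i)) (Fin (d i)) F := fun i =>
    LinearMap.proj i ∘ₗ π.toLinearMap ∘ₗ Unitization.inrHom F F A
  have hρ : ∀ i x, ρ i x = π (Unitization.inr x) i := fun _ _ => rfl
  have hρφ : ∀ (i : ι) m, ρ i (φ i m) = m := by
    intro i m
    suffices h : ρ i ∘ₗ φ i = LinearMap.id from LinearMap.congr_fun h m
    refine (Matrix.stdBasis F (Fin (d i)) (Fin (d i))).ext fun p => ?_
    obtain ⟨a, b⟩ := p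
    rw [Matrix.stdBasis_eq_single, LinearMap.comp_apply, hρ, hφ, hE, Pi.single_eq_same]
    rfl
  have hρφ' : ∀ (i : ι) (j : Fin k), j ≠ i → ∀ m, ρ j (φ i m) = 0 := by
    intro i j hij m
    suffices h : ρ j ∘ₗ φ i = 0 from LinearMap.congr_fun h m
    refine (Matrix.stdBasis F (Fin (d i)) (Fin (d i))).ext fun p => ?_
    obtain ⟨a, b⟩ := p
    rw [Matrix.stdBasis_eq_single, LinearMap.comp_apply, hρ, hφ, hE, Pi.single_eq_of_ne hij]
    rfl
  have hφmul : ∀ (i : ι) m m', φ i m * φ i m' = φ i (m * m') := by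
    intro i m m'
    suffices h : (LinearMap.mul F A).compl₁₂ (φ i) (φ i) = (LinearMap.mul F _).compr₂ (φ i) from
      LinearMap.congr_fun (LinearMap.congr_fun h m) m'
    refine (Matrix.stdBasis F (Fin (d i)) (Fin (d i))).ext fun p =>
      (Matrix.stdBasis F (Fin (d i)) (Fin (d i))).ext fun p' => ?_
    obtain ⟨a, b⟩ := p
    obtain ⟨c, e⟩ := p'
    apply Unitization.inr_injective (R := F)
    simp only [Matrix.stdBasis_eq_single, LinearMap.compl₁₂_apply, LinearMap.compr₂_apply,
      LinearMap.mul_apply', Unitization.inr_mul, hφ, hmul]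
    split_ifs with h
    · subst h
      rw [Matrix.single_mul_single_same, mul_one, hφ]
    · rw [Matrix.single_mul_single_of_ne _ _ _ _ h, map_zero, Unitization.inr_zero]
  have hφmul' : ∀ (i j : ι), i ≠ j → ∀ m m', φ i m * φ j m' = 0 := by
    intro i j hij m m'
    suffices h : (LinearMap.mul F A).compl₁₂ (φ i) (φ j) = 0 from
      LinearMap.congr_fun (LinearMap.congr_fun h m) m'
    refine (Matrix.stdBasis F (Fin (d i)) (Fin (d i))).ext fun p =>
      (Matrix.stdBasis F (Fin (d j)) (Fin (d j))).ext fun p' => ?_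
    obtain ⟨a, b⟩ := p
    obtain ⟨c, e⟩ := p'
    apply Unitization.inr_injective (R := F)
    simp only [Matrix.stdBasis_eq_single, LinearMap.compl₁₂_apply,
      LinearMap.mul_apply', Unitization.inr_mul, hφ, LinearMap.zero_apply, Unitization.inr_zero]
    exact hmul' i j (fun h => hij (Subtype.ext h)) _ _ _ _
  let comp : ι → NonUnitalSubalgebra F A := fun i =>
    { LinearMap.range (φ i) with
      mul_mem' := by
        rintro _ _ ⟨m, rfl⟩ ⟨m', rfl⟩
        exact ⟨m * m', (hφmul i m m').symm⟩ }
  have hcomp : ∀ i x, x ∈ comp i ↔ ∃ m, φ i m = x := fun i x => Iff.rfl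
  have hcomp' : ∀ i, (comp i).toSubmodule = LinearMap.range (φ i) := fun i => rfl
  refine WedderburnMalcev.nonempty_of_fintype comp (fun i => ?_) ?_ ?_ ?_
  · have := hd i
    let e : Matrix (Fin (d i)) (Fin (d i)) F ≃+* comp i :=
      { toFun := fun m => ⟨φ i m, m, rfl⟩
        invFun := fun x => ρ i x
        left_inv := fun m => hρφ i m
        right_inv := by
          rintro ⟨_, m, rfl⟩
          exact Subtype.ext (congrArg (φ i) (hρφ i m))
        map_mul' := fun m m' => Subtype.ext (hφmul i m m').symm
        map_add' := fun m m' => Subtype.ext (map_add (φ i) m m') }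
    exact isSimpleRing_of_ringEquiv e
  · rintro i j hij _ ⟨m, rfl⟩ _ ⟨m', rfl⟩
    exact hφmul' i j hij m m'
  · intro i
    rw [Submodule.disjoint_def]
    rintro _ ⟨m, rfl⟩ hm
    have hle : (⨆ j, ⨆ (_ : j ≠ i), (comp j).toSubmodule) ≤ LinearMap.ker (ρ i) := by
      refine iSup₂_le fun j hj => ?_
      rintro _ ⟨m', rfl⟩
      exact hρφ' j i (fun h => hj (Subtype.ext h.symm)) m'
    have h1 : ρ i (φ i m) = 0 := hle hm
    rw [hρφ] at h1
    change φ i m = 0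
    rw [h1, map_zero]
  · constructor
    · rw [Submodule.disjoint_def]
      intro x hx hxJ
      -- The map Σ φ i ∘ ρ i is the identity on the semisimple part and zero on the radical.
      have hle : (⨆ j, (comp j).toSubmodule) ≤
          LinearMap.ker (LinearMap.id - ∑ i : ι, φ i ∘ₗ ρ i) := by
        refine iSup_le fun j => ?_
        rintro _ ⟨m', rfl⟩
        rw [LinearMap.mem_ker, LinearMap.sub_apply, LinearMap.sum_apply,
          Finset.sum_eq_single j, LinearMap.comp_apply]
        · change φ j m' - φ j (ρ j (φ j m')) = 0
          rw [hρφ, sub_self]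
        · intro i _ hij
          change φ i (ρ i (φ j m')) = 0
          rw [hρφ' j i (fun h => hij (Subtype.ext h)), map_zero]
        · exact fun h => absurd (Finset.mem_univ _) h
      have h1 : x - (∑ i : ι, φ i ∘ₗ ρ i) x = 0 := hle hx
      have h2 : π (Unitization.inr x) = 0 := (hker _).2 (inr_mem_jacobson hxJ)
      rw [LinearMap.sum_apply, Finset.sum_eq_zero, sub_zero] at h1
      · exact h1
      · intro i _
        rw [LinearMap.comp_apply, hρ, h2, Pi.zero_apply, map_zero]
    · rw [codisjoint_iff, Submodule.eq_top_iff']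
      intro x
      -- `y` has the same image as `x` in the blocks of `ι`, and in the other blocks both images
      -- vanish by `hout`; hence x - y lies in the radical.
      set y := ∑ i : ι, φ i (ρ i x) with hy
      refine Submodule.mem_sup.2 ⟨y, ?_, x - y, ?_, add_sub_cancel _ _⟩
      · exact Submodule.sum_mem _ fun i _ =>
          Submodule.mem_iSup_of_mem (p := fun i => (comp i).toSubmodule) i ⟨_, rfl⟩
      · rw [mem_jacobsonRadical_iff, ← hker]
        funext j
        rw [← hρ, map_sub, hy, map_sum, Pi.zero_apply]
        by_cases hj : ∀ a b, (E j a b).fst = 0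
        · rw [Finset.sum_eq_single (⟨j, hj⟩ : ι), hρφ ⟨j, hj⟩, sub_self]
          · intro i _ hij
            exact hρφ' i j (fun h => hij (Subtype.ext h.symm)) _
          · exact fun h => absurd (Finset.mem_univ _) h
        · rw [hρ, hout x j hj, Finset.sum_eq_zero, sub_zero]
          intro i _
          exact hρφ' i j (fun h => hj (h ▸ i.2)) _

end Existence

/-! ### Parameters and identities of subalgebras -/

section Subalgebras

variable {F : Type u} [Field F]
variable {A : Type v} [NonUnitalRing A] [Module F A] [IsScalarTower F A A] [SMulCommClass F A A]

theorem mul_mem_of_mem_span {s t : Set A} {P : Submodule F A}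
    (h : ∀ x ∈ s, ∀ y ∈ t, x * y ∈ P) {x y : A} (hx : x ∈ Submodule.span F s)
    (hy : y ∈ Submodule.span F t) : x * y ∈ P := by
  induction hx using Submodule.span_induction with
  | mem x hx =>
    induction hy using Submodule.span_induction with
    | mem y hy => exact h x hx y hy
    | zero => rw [mul_zero]; exact P.zero_mem
    | add y z _ _ hy hz => rw [mul_add]; exact P.add_mem hy hz
    | smul c y _ hy => rw [mul_smul_comm]; exact P.smul_mem c hy
  | zero => rw [zero_mul]; exact P.zero_mem
  | add y z _ _ hy hz => rw [add_mul]; exact P.add_mem hy hz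
  | smul c y _ hy => rw [smul_mul_assoc]; exact P.smul_mem c hy

/-- The subalgebra spanned by a subalgebra and an ideal. -/
def sumSubalgebra (s t : Set A) (hss : ∀ x ∈ s, ∀ y ∈ s, x * y ∈ Submodule.span F s)
    (hst : ∀ x ∈ s, ∀ y ∈ t, x * y ∈ Submodule.span F t ∧ y * x ∈ Submodule.span F t)
    (htt : ∀ x ∈ t, ∀ y ∈ t, x * y ∈ Submodule.span F t) : NonUnitalSubalgebra F A :=
  { Submodule.span F (s ∪ t) with
    mul_mem' := fun {x y} hx hy => by
      refine mul_mem_of_mem_span (P := Submodule.span F (s ∪ t)) ?_ hx hy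
      have h1 : Submodule.span F s ≤ Submodule.span F (s ∪ t) :=
        Submodule.span_mono Set.subset_union_left
      have h2 : Submodule.span F t ≤ Submodule.span F (s ∪ t) :=
        Submodule.span_mono Set.subset_union_right
      rintro x (hx | hx) y (hy | hy)
      · exact h1 (hss x hx y hy)
      · exact h2 (hst x hx y hy).1
      · exact h2 (hst y hy x hx).2
      · exact h2 (htt x hx y hy) }

/-- The inclusion of a subalgebra. -/
def subInclusion (B : NonUnitalSubalgebra F A) : B →ₗ[F] A := B.toSubmodule.subtype

theorem subspacePow_comap_le (B : NonUnitalSubalgebra F A) (N : Submodule F A) (n : ℕ) {x : B}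
    (hx : x ∈ subspacePow (N.comap (subInclusion B)) n) : (x : A) ∈ subspacePow N n := by
  match n with
  | 0 => exact Submodule.mem_top
  | 1 => exact hx
  | n + 2 =>
    rw [subspacePow] at hx
    induction hx using Submodule.span_induction with
    | mem z hz =>
      obtain ⟨u, hu, v, hv, rfl⟩ := hz
      exact mul_mem_subspacePow_succ (subspacePow_comap_le B N (n + 1) hu) hv
    | zero => exact Submodule.zero_mem _
    | add y z _ _ hy hz => exact Submodule.add_mem _ hy hz
    | smul c y _ hy => exact Submodule.smul_mem _ c hy

variable [FiniteDimensional F A]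

/-- The span of `t` is a nilpotent ideal, so it lies in the radical and the dimension is bounded by
that of the span of `s`. If this bound is attained, the span of `t` is the whole radical and its
nilpotency bounds the index. Thus one of the two coordinates of the parameter can always be
controlled. -/
theorem parameter_sumSubalgebra_le (s t : Set A)
    (hss : ∀ x ∈ s, ∀ y ∈ s, x * y ∈ Submodule.span F s)
    (hst : ∀ x ∈ s, ∀ y ∈ t, x * y ∈ Submodule.span F t ∧ y * x ∈ Submodule.span F t)
    (htt : ∀ x ∈ t, ∀ y ∈ t, x * y ∈ Submodule.span F t) {n : ℕ} (hn : 1 ≤ n)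
    (hpow : subspacePow (Submodule.span F t) n = ⊥) :
    dimSemisimple F (sumSubalgebra s t hss hst htt) ≤ Module.finrank F (Submodule.span F s) ∧
      (Module.finrank F (Submodule.span F s) ≤ dimSemisimple F (sumSubalgebra s t hss hst htt) →
        nilIndex F (sumSubalgebra s t hss hst htt) ≤ n) := by
  set B := sumSubalgebra s t hss hst htt with hB
  have : FiniteDimensional F B := inferInstanceAs (FiniteDimensional F B.toSubmodule)
  set V := (Submodule.span F s).comap (subInclusion B) with hV
  set N := (Submodule.span F t).comap (subInclusion B) with hN
  have hpowN : subspacePow N n = ⊥ := by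
    refine (Submodule.eq_bot_iff _).2 fun x hx => ?_
    have := subspacePow_comap_le B _ n hx
    rw [hpow, Submodule.mem_bot] at this
    exact Subtype.ext this
  have hmul : ∀ x ∈ N, ∀ a, x * a ∈ N := by
    intro x hx a
    refine mul_mem_of_mem_span (s := t) (t := s ∪ t) (P := Submodule.span F t) ?_ hx a.2
    rintro x hx y (hy | hy)
    · exact (hst y hy x hx).2
    · exact htt x hx y hy
  have hNJ : N ≤ jacobsonRadical F B := le_jacobsonRadical hmul fun x hx =>
    isNilpotent_inr_of_subspacePow hn hpowN hx
  have hsup : V ⊔ N = ⊤ := by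
    rw [Submodule.eq_top_iff']
    intro x
    have hx : (x : A) ∈ Submodule.span F (s ∪ t) := x.2
    rw [Submodule.span_union] at hx
    obtain ⟨y, hy, z, hz, hyz⟩ := Submodule.mem_sup.1 hx
    have h1 : y ∈ B := Submodule.span_mono Set.subset_union_left hy
    have h2 : z ∈ B := Submodule.span_mono Set.subset_union_right hz
    exact Submodule.mem_sup.2 ⟨⟨y, h1⟩, hy, ⟨z, h2⟩, hz, Subtype.ext hyz⟩
  have hVle : Module.finrank F V ≤ Module.finrank F (Submodule.span F s) := by
    refine LinearMap.finrank_le_finrank_of_injective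
      (f := (subInclusion B).restrict (p := V) (q := Submodule.span F s) fun x hx => hx) ?_
    intro x y hxy
    exact Subtype.ext (Subtype.ext (congrArg (Subtype.val : Submodule.span F s → A) hxy))
  refine ⟨(dimSemisimple_le_of_sup_eq_top hNJ hsup).trans hVle, fun h => ?_⟩
  rw [eq_jacobsonRadical_of_finrank_le hNJ hsup (hVle.trans h)] at hpowN
  exact nilIndex_le hn hpowN

theorem mem_identities_subalgebra {f : FreeAlg F} (hf : f ∈ identities F A)
    (B : NonUnitalSubalgebra F A) : f ∈ identities F B := by
  intro e
  have h := map_evalPoly (NonUnitalSubalgebraClass.subtype B) e f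
  rw [hf] at h
  exact Subtype.ext h

/-- Identities of a subalgebra vanish on arguments from the subalgebra. -/
theorem evalPoly_eq_zero_of_mem {B : NonUnitalSubalgebra F A} {f : FreeAlg F}
    (hf : f ∈ identities F B) {S : Finset ℕ} (hS : IsMultilinearIn S f) {e : ℕ → A}
    (he : ∀ x ∈ S, e x ∈ B) : evalPoly e f = 0 := by
  classical
  have h := map_evalPoly (NonUnitalSubalgebraClass.subtype B)
    (fun x => if hx : x ∈ S then (⟨e x, he x hx⟩ : B) else 0) f
  rw [hf, map_zero] at h
  rw [h]
  refine hS.evalPoly_congr fun x hx => ?_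
  rw [dif_pos hx]
  rfl

end Subalgebras

/-! ### Separating a basic algebra from smaller ones; extension of scalars -/

section Basic

variable {F : Type u} [Field F] [CharZero F]
variable {A : Type v} [NonUnitalRing A] [Module F A] [IsScalarTower F A A] [SMulCommClass F A A]

/-- Otherwise the product of the `B i` would be PI-equivalent to `A`: it satisfies the identities of
`A` because `D` does, and the reverse inclusion may be tested on multilinear polynomials. -/
theorem IsBasic.exists_multilinear {ι : Type*} [Finite ι] [Nonempty ι] {D : Type (max u v)}
    [NonUnitalRing D] [Module F D] [IsScalarTower F D D] [SMulCommClass F D D]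
    [FiniteDimensional F D] (hA : IsBasic F A) (hD : identities F A ⊆ identities F D)
    (B : ι → NonUnitalSubalgebra F D) (hB : ∀ i, parameter F (B i) < parameter F A) :
    ∃ (S : Finset ℕ) (f : FreeAlg F), IsMultilinearIn S f ∧ f ∉ identities F A ∧
      ∀ i, f ∈ identities F (B i) := by
  cases nonempty_fintype ι
  by_contra hc
  push Not at hc
  let φ := (Fintype.equivFin ι).symm
  refine hA ⟨Fintype.card ι, fun k => B (φ k), fun k => inferInstance, fun k => inferInstance,
    fun k => inferInstance, fun k => inferInstance, Fintype.card_pos,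
    fun k => inferInstanceAs (FiniteDimensional F (B (φ k)).toSubmodule), ?_, fun k => hB _⟩
  refine Set.Subset.antisymm (fun f hf => mem_identities_pi.2 fun k =>
    mem_identities_subalgebra (hD hf) _) (identities_subset_of_multilinear fun S f hS hf => ?_)
  by_contra hfA
  obtain ⟨i, hi⟩ := hc S f hS hfA
  obtain ⟨k, rfl⟩ := φ.surjective i
  exact hi (mem_identities_pi.1 hf k)

open TensorProduct

variable {K : Type u} [CommRing K] [Algebra F K]

theorem wordVal_tmul (a : ℕ → A) (c : ℕ → K) (m : FreeSemigroup ℕ) :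
    wordVal (fun x => a x ⊗ₜ[F] c x) m = wordVal a m ⊗ₜ[F] ((letters m).map c).prod := by
  induction m using FreeSemigroup.recOnMul with
  | ih1 x => simp
  | ih2 x y hx hy => simp [hy]

theorem IsMultilinearIn.evalPoly_tmul {f : FreeAlg F} {S : Finset ℕ} (hf : IsMultilinearIn S f)
    (a : ℕ → A) (c : ℕ → K) :
    evalPoly (fun x => a x ⊗ₜ[F] c x) f = evalPoly a f ⊗ₜ[F] ∏ x ∈ S, c x := by
  rw [evalPoly_eq_sum, evalPoly_eq_sum, TensorProduct.sum_tmul]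
  refine Finset.sum_congr rfl fun m hm => ?_
  rw [wordVal_tmul, TensorProduct.smul_tmul', Finset.prod, ← hf m hm, Multiset.map_coe,
    Multiset.prod_coe]

variable (A K) in
/-- Extension of scalars preserves polynomial identities. -/
theorem identities_subset_tensorProduct :
    identities F A ⊆ identities F (A ⊗[F] K) := by
  refine identities_subset_of_multilinear fun S f hS hf e => ?_
  by_contra hne
  obtain ⟨e', he', hne'⟩ := hS.exists_evalPoly_ne_zero
    (B := fun _ => {x : A ⊗[F] K | ∃ a c, a ⊗ₜ c = x})
    (fun x _ => by rw [TensorProduct.span_tmul_eq_top]; exact Submodule.mem_top) hne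
  choose! a c h using he'
  refine hne' ?_
  rw [← hS.evalPoly_congr h, hS.evalPoly_tmul, hf, TensorProduct.zero_tmul]

theorem eq_zero_of_tmul_eq_zero {a : A} {c : K} (h : a ⊗ₜ[F] c = 0) (hc : c ≠ 0) : a = 0 := by
  obtain ⟨φ, hφ⟩ : ∃ φ : Module.Dual F K, φ c ≠ 0 := by
    by_contra hn
    push Not at hn
    exact hc ((Module.forall_dual_apply_eq_zero_iff F c).1 hn)
  have := congrArg (TensorProduct.rid F A ∘ LinearMap.lTensor A φ) h
  simp only [Function.comp_apply, LinearMap.lTensor_tmul, TensorProduct.rid_tmul, map_zero] at this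
  exact (smul_eq_zero.1 this).resolve_left hφ

-- The powers of `t` will count the radical values in an evaluation.
variable (F) in
theorem exists_truncated (n : ℕ) : ∃ (K : Type u) (_ : CommRing K) (_ : Algebra F K) (t : K),
    FiniteDimensional F K ∧ t ^ n = 0 ∧ ∀ k < n, t ^ k ≠ 0 := by
  refine ⟨AdjoinRoot (Polynomial.X ^ n : Polynomial F), inferInstance, inferInstance,
    AdjoinRoot.root _, (Polynomial.monic_X_pow n).finite_adjoinRoot, ?_, fun k hk h => ?_⟩
  · rw [← AdjoinRoot.mk_X, ← map_pow, AdjoinRoot.mk_self]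
  · rw [← AdjoinRoot.mk_X, ← map_pow, AdjoinRoot.mk_eq_zero, Polynomial.X_pow_dvd_iff] at h
    simpa using h k hk

end Basic

/-! ### Subsums of simple components -/

section Components

variable {F : Type u} [Field F] {A : Type v} [NonUnitalRing A] [Module F A] [IsScalarTower F A A]
  [SMulCommClass F A A] (W : WedderburnMalcev F A)

/-- The union of the components with indices in a given set. -/
def WedderburnMalcev.compUnion (P : Set (Fin W.q)) : Set A := {x | ∃ i ∈ P, x ∈ W.comp i}

theorem WedderburnMalcev.mul_mem_compUnion {P : Set (Fin W.q)} {x y : A} (hx : x ∈ W.compUnion P)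
    (hy : y ∈ W.compUnion P) : x * y ∈ Submodule.span F (W.compUnion P) := by
  obtain ⟨i, hi, hx⟩ := hx
  obtain ⟨j, hj, hy⟩ := hy
  by_cases hij : i = j
  · subst hij
    exact Submodule.subset_span ⟨i, hi, mul_mem hx hy⟩
  · rw [W.mul_eq_zero i j hij x hx y hy]
    exact Submodule.zero_mem _

theorem WedderburnMalcev.span_compUnion (P : Set (Fin W.q)) :
    Submodule.span F (W.compUnion P) = ⨆ i ∈ P, (W.comp i).toSubmodule := by
  apply le_antisymm
  · refine Submodule.span_le.2 ?_
    rintro x ⟨i, hi, hx⟩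
    exact Submodule.mem_iSup_of_mem i (Submodule.mem_iSup_of_mem hi hx)
  · exact iSup₂_le fun i hi x hx => Submodule.subset_span ⟨i, hi, hx⟩

variable [FiniteDimensional F A]

theorem WedderburnMalcev.finrank_iSup :
    Module.finrank F (⨆ i, (W.comp i).toSubmodule : Submodule F A) = dimSemisimple F A :=
  (LinearEquiv.finrank_eq (Submodule.quotientEquivOfIsCompl _ _ W.isCompl.symm)).symm

theorem WedderburnMalcev.exists_ne_zero (i : Fin W.q) : ∃ a ∈ W.comp i, a ≠ 0 := by
  obtain ⟨a, ha⟩ := W.exists_not_isNilpotent i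
  refine ⟨a, a.2, fun h => ha ?_⟩
  have : a = 0 := Subtype.ext h
  rw [this, Unitization.inr_zero]
  exact IsNilpotent.zero

theorem WedderburnMalcev.finrank_compUnion_lt (i : Fin W.q) :
    Module.finrank F (Submodule.span F (W.compUnion {j | j ≠ i})) < dimSemisimple F A := by
  rw [← W.finrank_iSup, W.span_compUnion]
  refine Submodule.finrank_lt_finrank_of_lt (lt_of_le_of_ne ?_ fun h => ?_)
  · exact iSup₂_le fun j _ => le_iSup (fun i => (W.comp i).toSubmodule) j
  · obtain ⟨a, ha, ha0⟩ := W.exists_ne_zero i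
    refine ha0 (Submodule.disjoint_def.1 (W.indep i) a ha ?_)
    have : a ∈ ⨆ i, (W.comp i).toSubmodule :=
      Submodule.mem_iSup_of_mem (p := fun i => (W.comp i).toSubmodule) i ha
    rw [← h] at this
    exact this

end Components

/-! ### Basic algebras are full and satisfy property K: (1) ⇒ (2') -/

section BasicFull

variable {F : Type u} [Field F] [CharZero F]
variable {A : Type v} [NonUnitalRing A] [Module F A] [IsScalarTower F A A] [SMulCommClass F A A]
  [FiniteDimensional F A]

open TensorProduct

variable {K : Type u} [CommRing K] [Algebra F K] [FiniteDimensional F K]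

theorem finrank_span_tmul_le (s : Set A) (c : K) :
    Module.finrank F (Submodule.span F {x : A ⊗[F] K | ∃ a ∈ s, a ⊗ₜ[F] c = x})
      ≤ Module.finrank F (Submodule.span F s) := by
  have : {x : A ⊗[F] K | ∃ a ∈ s, a ⊗ₜ[F] c = x} = (TensorProduct.mk F A K).flip c '' s := rfl
  rw [this, ← Submodule.map_span]
  exact Submodule.finrank_map_le _ _

theorem tmul_mem_span {s : Set A} {c : K} {T : Set (A ⊗[F] K)} (h : ∀ a ∈ s, a ⊗ₜ[F] c ∈ T)
    {a : A} (ha : a ∈ Submodule.span F s) : a ⊗ₜ[F] c ∈ Submodule.span F T := by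
  have h1 := Submodule.mem_map_of_mem (f := (TensorProduct.mk F A K).flip c) ha
  rw [Submodule.map_span] at h1
  refine Submodule.span_mono ?_ h1
  rintro _ ⟨a, ha, rfl⟩
  exact h a ha

/-- The elements `a ⊗ 1` with `a` in one of the components with indices in `P`. -/
def semisimplePart (K : Type u) [CommRing K] [Algebra F K] (W : WedderburnMalcev F A)
    (P : Set (Fin W.q)) : Set (A ⊗[F] K) :=
  {x | ∃ a ∈ W.compUnion P, a ⊗ₜ[F] 1 = x}

variable (F A) in
/-- The elements `r ⊗ t ^ k` with `r` in the radical and `k ≥ m`. -/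
def radicalPart (t : K) (m : ℕ) : Set (A ⊗[F] K) :=
  {x | ∃ k ≥ m, ∃ a ∈ jacobsonRadical F A, a ⊗ₜ[F] (t ^ k) = x}

variable (W : WedderburnMalcev F A) (P : Set (Fin W.q)) (t : K) (m : ℕ)

theorem semisimplePart_mul : ∀ x ∈ semisimplePart K W P, ∀ y ∈ semisimplePart K W P,
    x * y ∈ Submodule.span F (semisimplePart K W P) := by
  rintro _ ⟨a, ha, rfl⟩ _ ⟨b, hb, rfl⟩
  rw [Algebra.TensorProduct.tmul_mul_tmul, one_mul]
  exact tmul_mem_span (T := semisimplePart K W P) (fun a ha => ⟨a, ha, rfl⟩)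
    (W.mul_mem_compUnion ha hb)

theorem semisimplePart_mul_radicalPart : ∀ x ∈ semisimplePart K W P, ∀ y ∈ radicalPart F A t m,
    x * y ∈ Submodule.span F (radicalPart F A t m) ∧
      y * x ∈ Submodule.span F (radicalPart F A t m) := by
  rintro _ ⟨a, ha, rfl⟩ _ ⟨k, hk, b, hb, rfl⟩
  rw [Algebra.TensorProduct.tmul_mul_tmul, Algebra.TensorProduct.tmul_mul_tmul, one_mul, mul_one]
  exact ⟨Submodule.subset_span ⟨k, hk, _, mul_mem_jacobsonRadical_left hb _, rfl⟩,
    Submodule.subset_span ⟨k, hk, _, mul_mem_jacobsonRadical_right hb _, rfl⟩⟩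

theorem radicalPart_mul : ∀ x ∈ radicalPart F A t m, ∀ y ∈ radicalPart F A t m,
    x * y ∈ Submodule.span F (radicalPart F A t m) := by
  rintro _ ⟨k, hk, a, ha, rfl⟩ _ ⟨l, hl, b, hb, rfl⟩
  rw [Algebra.TensorProduct.tmul_mul_tmul, ← pow_add]
  exact Submodule.subset_span ⟨k + l, by omega, _, mul_mem_jacobsonRadical_left hb _, rfl⟩

/-- Both the exponent of `t` and the power of J(A) grow with the number of factors. The power of
J(A) gives nilpotency for every `m`; for m = 1 the exponent of `t` gives it one step earlier when t
^ (n_A - 1) = 0. -/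
theorem subspacePow_radicalPart_le (n : ℕ) :
    subspacePow (Submodule.span F (radicalPart F A t m)) (n + 1)
    ≤ Submodule.span F {x : A ⊗[F] K | ∃ k ≥ m * (n + 1),
      ∃ a ∈ subspacePow (jacobsonRadical F A) (n + 1), a ⊗ₜ[F] (t ^ k) = x} := by
  induction n with
  | zero =>
    rw [zero_add, mul_one]
    exact le_rfl
  | succ n ih =>
    refine Submodule.span_le.2 ?_
    rintro _ ⟨x, hx, y, hy, rfl⟩
    refine mul_mem_of_mem_span ?_ (ih hx) hy
    rintro _ ⟨k, hk, a, ha, rfl⟩ _ ⟨l, hl, b, hb, rfl⟩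
    rw [Algebra.TensorProduct.tmul_mul_tmul, ← pow_add]
    exact Submodule.subset_span ⟨k + l, by rw [mul_add, mul_one]; exact add_le_add hk hl, _,
      mul_mem_subspacePow_succ ha hb, rfl⟩

/-- The subalgebra of `A ⊗ K` spanned by a semisimple and a radical part. -/
def partSubalgebra : NonUnitalSubalgebra F (A ⊗[F] K) :=
  sumSubalgebra (semisimplePart K W P) (radicalPart F A t m) (semisimplePart_mul W P)
    (semisimplePart_mul_radicalPart W P t m) (radicalPart_mul t m)

theorem tmul_one_mem_partSubalgebra {i : Fin W.q} (hi : i ∈ P) {a : A} (ha : a ∈ W.comp i) :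
    a ⊗ₜ[F] 1 ∈ partSubalgebra W P t m :=
  Submodule.subset_span (Or.inl ⟨a, ⟨i, hi, ha⟩, rfl⟩)

theorem tmul_pow_mem_partSubalgebra {k : ℕ} (hk : m ≤ k) {a : A} (ha : a ∈ jacobsonRadical F A) :
    a ⊗ₜ[F] (t ^ k) ∈ partSubalgebra W P t m :=
  Submodule.subset_span (Or.inr ⟨k, hk, a, ha, rfl⟩)

theorem parameter_partSubalgebra_lt_of_ne (i : Fin W.q) :
    parameter F (partSubalgebra W {j | j ≠ i} t m) < parameter F A := by
  refine parameter_lt_iff.2 (Or.inl ?_)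
  have hpow : subspacePow (Submodule.span F (radicalPart F A t m)) (nilIndex F A) = ⊥ := by
    obtain ⟨n, hn⟩ := Nat.exists_eq_add_of_le' (nilIndex_spec F A).1
    rw [hn, ← le_bot_iff]
    refine (subspacePow_radicalPart_le t m n).trans (Submodule.span_le.2 ?_)
    rintro _ ⟨k, -, a, ha, rfl⟩
    rw [← hn, (nilIndex_spec F A).2, Submodule.mem_bot] at ha
    rw [ha, TensorProduct.zero_tmul]
    exact Submodule.zero_mem _
  have h := (parameter_sumSubalgebra_le (semisimplePart K W {j | j ≠ i}) (radicalPart F A t m)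
    (semisimplePart_mul W _) (semisimplePart_mul_radicalPart W _ t m) (radicalPart_mul t m)
    (nilIndex_spec F A).1 hpow).1
  exact (h.trans (finrank_span_tmul_le _ _)).trans_lt (W.finrank_compUnion_lt i)

/-- A product of n_A - 1 elements of the radical part carries t ^ (n_A - 1) = 0. So either the
semisimple dimension is below d(A), or the nilpotency index is at most n_A - 1. -/
theorem parameter_partSubalgebra_lt (hs : 0 < nilIndex F A - 1) (ht : t ^ (nilIndex F A - 1) = 0) :
    parameter F (partSubalgebra W Set.univ t 1) < parameter F A := by
  have hpow : subspacePow (Submodule.span F (radicalPart F A t 1)) (nilIndex F A - 1) = ⊥ := by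
    obtain ⟨n, hn⟩ := Nat.exists_eq_add_of_le' (Nat.succ_le_of_lt hs)
    rw [hn, ← le_bot_iff]
    refine (subspacePow_radicalPart_le t 1 n).trans (Submodule.span_le.2 ?_)
    rintro _ ⟨k, hk, a, ha, rfl⟩
    rw [pow_eq_zero_of_le (by omega : nilIndex F A - 1 ≤ k) ht, TensorProduct.tmul_zero]
    exact Submodule.zero_mem _
  have h := parameter_sumSubalgebra_le (semisimplePart K W Set.univ) (radicalPart F A t 1)
    (semisimplePart_mul W _) (semisimplePart_mul_radicalPart W _ t 1) (radicalPart_mul t 1) hs hpow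
  have hd : Module.finrank F (Submodule.span F (semisimplePart K W Set.univ))
      ≤ dimSemisimple F A := by
    refine (finrank_span_tmul_le _ _).trans (le_of_eq ?_)
    have h1 : ⨆ i ∈ Set.univ, (W.comp i).toSubmodule = ⨆ i, (W.comp i).toSubmodule := by simp
    rw [W.span_compUnion, h1, W.finrank_iSup]
  rw [parameter_lt_iff]
  change dimSemisimple F (partSubalgebra W Set.univ t 1) ≤ _ ∧
    (_ ≤ dimSemisimple F (partSubalgebra W Set.univ t 1) → _) at h
  rcases lt_or_eq_of_le (h.1.trans hd) with h1 | h1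
  · exact Or.inl h1
  · refine Or.inr ⟨h1, ?_⟩
    have : nilIndex F (partSubalgebra W Set.univ t 1) ≤ nilIndex F A - 1 := h.2 (by omega)
    omega

-- An evaluation missing component i becomes one in the i-th subalgebra on tensoring all values with
-- 1. Tensoring only the radical values with `t` gives the value f(e) ⊗ t ^ k, where k is the number
-- of radical values.
open Classical in
theorem WedderburnMalcev.isFullWithPropertyK_of_identities {S : Finset ℕ} {f : FreeAlg F}
    (hS : IsMultilinearIn S f) (hf : f ∉ identities F A)
    (hi : ∀ i, f ∈ identities F (partSubalgebra W {j | j ≠ i} t 0))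
    (hK : 0 < nilIndex F A - 1 → f ∈ identities F (partSubalgebra W Set.univ t 1))
    (ht : ∀ k < nilIndex F A - 1, t ^ k ≠ 0) (h1 : (1 : K) ≠ 0) : W.IsFullWithPropertyK := by
  refine ⟨S, f, hS, hf, fun e he hne i => ?_, fun e he hlt => ?_⟩
  · by_contra hc
    push Not at hc
    refine hne (eq_zero_of_tmul_eq_zero (F := F) (c := ∏ x ∈ S, (1 : K)) ?_ (by simpa using h1))
    rw [← hS.evalPoly_tmul]
    refine evalPoly_eq_zero_of_mem (hi i) hS fun x hx => ?_
    rcases he x hx with ⟨j, hj⟩ | hJ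
    · refine tmul_one_mem_partSubalgebra W _ t 0 (i := j) ?_ hj
      rintro rfl
      exact hc x hx hj
    · rw [← pow_zero t]
      exact tmul_pow_mem_partSubalgebra W _ t 0 le_rfl hJ
  · refine eq_zero_of_tmul_eq_zero (F := F)
      (c := ∏ x ∈ S, if e x ∈ jacobsonRadical F A then t else 1) ?_ ?_
    · rw [← hS.evalPoly_tmul]
      refine evalPoly_eq_zero_of_mem (hK (by omega)) hS fun x hx => ?_
      split_ifs with hJ
      · simpa using tmul_pow_mem_partSubalgebra W Set.univ t 1 le_rfl hJ
      · obtain ⟨j, hj⟩ := (he x hx).resolve_right hJ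
        exact tmul_one_mem_partSubalgebra W _ t 1 (Set.mem_univ j) hj
    · rw [Finset.prod_ite, Finset.prod_const, Finset.prod_const_one, mul_one]
      exact ht _ hlt

/-- A basic algebra is full and satisfies property `K`, with respect to every decomposition. -/
theorem IsBasic.isFullWithPropertyK [Nontrivial A] (hA : IsBasic F A) : W.IsFullWithPropertyK := by
  -- The maximum with 1 keeps K ≠ 0 when n_A = 1.
  obtain ⟨K, _, _, t, _, ht, htk⟩ := exists_truncated F (max (nilIndex F A - 1) 1)
  have h1 : (1 : K) ≠ 0 := by simpa using htk 0 (by omega)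
  have htk' : ∀ k < nilIndex F A - 1, t ^ k ≠ 0 := fun k hk => htk k (by omega)
  have hD := identities_subset_tensorProduct (F := F) A K
  by_cases hs : 0 < nilIndex F A - 1
  · rw [max_eq_left hs] at ht
    obtain ⟨S, f, hS, hf, h⟩ := hA.exists_multilinear hD
      (fun o : Option (Fin W.q) => o.elim (partSubalgebra W Set.univ t 1)
        fun i => partSubalgebra W {j | j ≠ i} t 0)
      (fun o => by
        cases o with
        | none => exact parameter_partSubalgebra_lt W t hs ht
        | some i => exact parameter_partSubalgebra_lt_of_ne W t 0 i)
    exact W.isFullWithPropertyK_of_identities t hS hf (fun i => h (some i)) (fun _ => h none)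
      htk' h1
  -- Here property K is vacuous and the subalgebra with m = 1 is not needed. As A ≠ 0 is semisimple,
  -- it has a component, so the family of subalgebras is nonempty.
  · have hJ : jacobsonRadical F A = ⊥ := by
      have h := nilIndex_spec F A
      rw [show nilIndex F A = 1 by omega] at h
      exact h.2
    have : Nonempty (Fin W.q) := by
      by_contra hq
      rw [not_nonempty_iff] at hq
      have := W.isCompl.sup_eq_top
      rw [hJ, iSup_of_empty, sup_bot_eq] at this
      exact bot_ne_top this
    obtain ⟨S, f, hS, hf, h⟩ := hA.exists_multilinear hD
      (fun i : Fin W.q => partSubalgebra W {j | j ≠ i} t 0)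
      (fun i => parameter_partSubalgebra_lt_of_ne W t 0 i)
    exact W.isFullWithPropertyK_of_identities t hS hf h (fun h => absurd h hs) htk' h1

end BasicFull

/-! ### The Peirce decomposition -/

section Peirce

variable {F : Type u} [Field F] {A : Type v} [NonUnitalRing A] [Module F A] [IsScalarTower F A A]
  [SMulCommClass F A A] {W : WedderburnMalcev F A} (M : MatrixUnits W)

theorem MatrixUnits.E_ne_zero (i : Fin W.q) (a b : Fin (M.n i)) : M.E i a b ≠ 0 :=
  (M.basis i).ne_zero (a, b)

theorem MatrixUnits.E_notMem (i : Fin W.q) (a b : Fin (M.n i)) :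
    M.E i a b ∉ jacobsonRadical F A :=
  fun h => M.E_ne_zero i a b (W.comp_disjoint i (M.mem i a b) h)

theorem MatrixUnits.mul_of_ne {i j : Fin W.q} (h : i ≠ j) (a b : Fin (M.n i))
    (c d : Fin (M.n j)) : M.E i a b * M.E j c d = 0 :=
  W.mul_eq_zero i j h _ (M.mem i a b) _ (M.mem j c d)

/-- The unit of a component. -/
def MatrixUnits.idem (i : Fin W.q) : A := ∑ a, M.E i a a

theorem MatrixUnits.idem_mem (i : Fin W.q) : M.idem i ∈ W.comp i :=
  sum_mem fun a _ => M.mem i a a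

theorem MatrixUnits.idem_mul {i : Fin W.q} {x : A} (hx : x ∈ W.comp i) : M.idem i * x = x := by
  have hx' : x ∈ (W.comp i).toSubmodule := hx
  rw [M.span i] at hx'
  clear hx
  induction hx' using Submodule.span_induction with
  | mem x hx =>
    obtain ⟨⟨a, b⟩, rfl⟩ := hx
    simp [idem, Finset.sum_mul, M.mul_self]
  | zero => exact mul_zero _
  | add x y hx hy h1 h2 =>
    rw [mul_add, h1, h2]
  | smul c x hx h1 =>
    rw [mul_smul_comm, h1]

theorem MatrixUnits.mul_idem {i : Fin W.q} {x : A} (hx : x ∈ W.comp i) : x * M.idem i = x := by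
  have hx' : x ∈ (W.comp i).toSubmodule := hx
  rw [M.span i] at hx'
  clear hx
  induction hx' using Submodule.span_induction with
  | mem x hx =>
    obtain ⟨⟨a, b⟩, rfl⟩ := hx
    simp [idem, Finset.mul_sum, M.mul_self]
  | zero => exact zero_mul _
  | add x y hx hy h1 h2 =>
    rw [add_mul, h1, h2]
  | smul c x hx h1 =>
    rw [smul_mul_assoc, h1]

theorem MatrixUnits.idem_mul_idem (i j : Fin W.q) :
    M.idem i * M.idem j = if i = j then M.idem i else 0 := by
  split_ifs with h
  · subst h; exact M.idem_mul (M.idem_mem i)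
  · exact W.mul_eq_zero i j h _ (M.idem_mem i) _ (M.idem_mem j)

/-- The left Peirce components. The index `none` belongs to the complementary idempotent. -/
def MatrixUnits.leftPeirce : Option (Fin W.q) → Submodule F A
  | some i =>
    { carrier := {x | M.idem i * x = x}
      add_mem' := fun {x y} hx hy => by
        simp only [Set.mem_ofPred_eq] at *; rw [mul_add, hx, hy]
      zero_mem' := mul_zero _
      smul_mem' := fun c x hx => by
        simp only [Set.mem_ofPred_eq] at *; rw [mul_smul_comm, hx] }
  | none =>
    { carrier := {x | ∀ i, M.idem i * x = 0}
      add_mem' := fun {x y} hx hy i => by rw [mul_add, hx i, hy i, add_zero]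
      zero_mem' := fun _ => mul_zero _
      smul_mem' := fun c x hx i => by rw [mul_smul_comm, hx i, smul_zero] }

/-- The right Peirce components. The index `none` belongs to the complementary idempotent. -/
def MatrixUnits.rightPeirce : Option (Fin W.q) → Submodule F A
  | some i =>
    { carrier := {x | x * M.idem i = x}
      add_mem' := fun {x y} hx hy => by
        simp only [Set.mem_ofPred_eq] at *; rw [add_mul, hx, hy]
      zero_mem' := zero_mul _
      smul_mem' := fun c x hx => by
        simp only [Set.mem_ofPred_eq] at *; rw [smul_mul_assoc, hx] }
  | none =>
    { carrier := {x | ∀ i, x * M.idem i = 0}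
      add_mem' := fun {x y} hx hy i => by rw [add_mul, hx i, hy i, add_zero]
      zero_mem' := fun _ => zero_mul _
      smul_mem' := fun c x hx i => by rw [smul_mul_assoc, hx i, smul_zero] }

theorem MatrixUnits.mem_leftPeirce_some {i : Fin W.q} {x : A} :
    x ∈ M.leftPeirce (some i) ↔ M.idem i * x = x := Iff.rfl

theorem MatrixUnits.mem_leftPeirce_none {x : A} :
    x ∈ M.leftPeirce none ↔ ∀ i, M.idem i * x = 0 := Iff.rfl

theorem MatrixUnits.mem_rightPeirce_some {i : Fin W.q} {x : A} :
    x ∈ M.rightPeirce (some i) ↔ x * M.idem i = x := Iff.rfl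

theorem MatrixUnits.mem_rightPeirce_none {x : A} :
    x ∈ M.rightPeirce none ↔ ∀ i, x * M.idem i = 0 := Iff.rfl

theorem MatrixUnits.mul_mem_leftPeirce {o : Option (Fin W.q)} {x : A} (hx : x ∈ M.leftPeirce o)
    (y : A) : x * y ∈ M.leftPeirce o := by
  cases o with
  | none =>
    rw [mem_leftPeirce_none] at *
    intro i
    rw [← mul_assoc, hx i, zero_mul]
  | some i =>
    rw [mem_leftPeirce_some] at *
    rw [← mul_assoc, hx]

theorem MatrixUnits.mul_eq_zero_of_ne {o o' : Option (Fin W.q)} (h : o ≠ o') {x y : A}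
    (hx : x ∈ M.rightPeirce o) (hy : y ∈ M.leftPeirce o') : x * y = 0 := by
  cases o with
  | none =>
    cases o' with
    | none => exact absurd rfl h
    | some j =>
      rw [mem_rightPeirce_none] at hx
      rw [mem_leftPeirce_some] at hy
      rw [← hy, ← mul_assoc, hx, zero_mul]
  | some i =>
    rw [mem_rightPeirce_some] at hx
    cases o' with
    | none =>
      rw [mem_leftPeirce_none] at hy
      rw [← hx, mul_assoc, hy, mul_zero]
    | some j =>
      rw [mem_leftPeirce_some] at hy
      rw [← hx, ← hy, mul_assoc, ← mul_assoc (M.idem i), M.idem_mul_idem,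
        if_neg fun hij => h (by rw [hij]), zero_mul, mul_zero]

theorem MatrixUnits.comp_le_leftPeirce {i : Fin W.q} {x : A} (hx : x ∈ W.comp i) :
    x ∈ M.leftPeirce (some i) := M.idem_mul hx

theorem MatrixUnits.comp_le_rightPeirce {i : Fin W.q} {x : A} (hx : x ∈ W.comp i) :
    x ∈ M.rightPeirce (some i) := M.mul_idem hx

/-- The radical elements that are homogeneous for the Peirce decomposition. -/
def MatrixUnits.homogeneousRadical : Set A :=
  {x | x ∈ jacobsonRadical F A ∧ ∃ l r, x ∈ M.leftPeirce l ∧ x ∈ M.rightPeirce r}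

/-- The complementary idempotent 1 - Σ e_i need not lie in `A`, but multiplication by it is x ↦ x -
Σ e_i x on the left, and likewise on the right. Splitting first on the left and then on the right
stays inside the radical. -/
theorem MatrixUnits.mem_span_homogeneousRadical {x : A} (hx : x ∈ jacobsonRadical F A) :
    x ∈ Submodule.span F M.homogeneousRadical := by
  have h1 : ∀ y ∈ jacobsonRadical F A, ∀ l, y ∈ M.leftPeirce l →
      y ∈ Submodule.span F M.homogeneousRadical := by
    intro y hy l hl
    have hsum : y = (∑ i, y * M.idem i) + (y - ∑ i, y * M.idem i) := by abel
    rw [hsum]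
    refine Submodule.add_mem _ (Submodule.sum_mem _ fun i _ => Submodule.subset_span
      ⟨mul_mem_jacobsonRadical_right hy _, l, some i, M.mul_mem_leftPeirce hl _, ?_⟩)
      (Submodule.subset_span ⟨?_, l, none, ?_, ?_⟩)
    · rw [mem_rightPeirce_some, mul_assoc, M.idem_mul_idem, if_pos rfl]
    · exact Submodule.sub_mem _ hy (Submodule.sum_mem _ fun i _ =>
        mul_mem_jacobsonRadical_right hy _)
    · exact Submodule.sub_mem _ hl (Submodule.sum_mem _ fun i _ => M.mul_mem_leftPeirce hl _)
    · rw [mem_rightPeirce_none]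
      intro j
      simp [sub_mul, Finset.sum_mul, mul_assoc, M.idem_mul_idem]
  have hsum : x = (∑ i, M.idem i * x) + (x - ∑ i, M.idem i * x) := by abel
  rw [hsum]
  refine Submodule.add_mem _ (Submodule.sum_mem _ fun i _ =>
    h1 _ (mul_mem_jacobsonRadical_left hx _) (some i) ?_) (h1 _ ?_ none ?_)
  · rw [mem_leftPeirce_some, ← mul_assoc, M.idem_mul_idem, if_pos rfl]
  · exact Submodule.sub_mem _ hx (Submodule.sum_mem _ fun i _ => mul_mem_jacobsonRadical_left hx _)
  · rw [mem_leftPeirce_none]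
    intro j
    simp [mul_sub, Finset.mul_sum, ← mul_assoc, M.idem_mul_idem]

theorem MatrixUnits.span_homogeneous :
    Submodule.span F ({x | ∃ i, x ∈ W.comp i} ∪ M.homogeneousRadical) = ⊤ := by
  rw [Submodule.eq_top_iff']
  intro x
  obtain ⟨y, hy, r, hr, rfl⟩ := W.exists_add x
  refine Submodule.add_mem _ ?_
    (Submodule.span_mono Set.subset_union_right (M.mem_span_homogeneousRadical hr))
  have hle : (⨆ j, (W.comp j).toSubmodule) ≤
      Submodule.span F ({x | ∃ i, x ∈ W.comp i} ∪ M.homogeneousRadical) :=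
    iSup_le fun j x hx => Submodule.subset_span (Or.inl ⟨j, hx⟩)
  exact hle hy

theorem MatrixUnits.card_eq_dimSemisimple [FiniteDimensional F A] :
    Fintype.card (Σ i, Fin (M.n i) × Fin (M.n i)) = dimSemisimple F A := by
  have hli : LinearIndependent F
      (fun p : Σ i, Fin (M.n i) × Fin (M.n i) => M.E p.1 p.2.1 p.2.2) := by
    rw [Fintype.linearIndependent_iff]
    rintro g hg ⟨i, a, b⟩
    -- Multiplying by E_aa on the left and E_bb on the right isolates the coefficient of E_ab.
    have h1 := congrArg (fun x => M.E i a a * x * M.E i b b) hg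
    simp only [Finset.mul_sum, Finset.sum_mul, mul_zero, zero_mul, mul_smul_comm,
      smul_mul_assoc] at h1
    rw [Finset.sum_eq_single ⟨i, a, b⟩] at h1
    · simp only [M.mul_self, if_true] at h1
      exact (smul_eq_zero.1 h1).resolve_right (M.E_ne_zero i a b)
    · rintro ⟨j, c, d⟩ - hne
      by_cases hij : i = j
      · subst hij
        simp only [M.mul_self]
        split_ifs with h2
        · subst h2
          rw [M.mul_self, if_neg, smul_zero]
          rintro rfl
          exact hne rfl
        · simp
      · rw [M.mul_of_ne hij, zero_mul, smul_zero]
    · exact fun h => absurd (Finset.mem_univ _) h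
  rw [← W.finrank_iSup, ← finrank_span_eq_card hli]
  have h2 : Submodule.span F (Set.range fun p : Σ i, Fin (M.n i) × Fin (M.n i) =>
      M.E p.1 p.2.1 p.2.2) = ⨆ i, (W.comp i).toSubmodule := by
    simp only [M.span, ← Submodule.span_iUnion]
    congr 1
    ext x
    simp only [Set.mem_range, Set.mem_iUnion, Sigma.exists]
  rw [h2]

end Peirce

/-! ### Attaching idempotent variables to a word -/

section Slots

variable {F : Type u} [Field F] {A : Type v} [NonUnitalRing A] [Module F A] [IsScalarTower F A A]
  [SMulCommClass F A A] {W : WedderburnMalcev F A} (M : MatrixUnits W)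

theorem exists_injective_notMem (X : Type*) [Finite X] (S : Finset ℕ) :
    ∃ v : X → ℕ, Function.Injective v ∧ ∀ x, v x ∉ S := by
  obtain ⟨n, ⟨φ⟩⟩ := Finite.exists_equiv_fin X
  refine ⟨fun x => φ x + (S.sup id + 1), fun x y h => φ.injective (Fin.ext (by simpa using h)),
    fun x hx => ?_⟩
  have := Finset.le_sup (f := id) hx
  simp only [id] at this
  omega

theorem union_image_val {X : Type*} [Fintype X] {S : Finset ℕ} {v : X → ℕ}
    (hv : Function.Injective v) (hS : ∀ x, v x ∉ S) :
    (S ∪ Finset.univ.image v).val = S.val + ∑ x, ({v x} : Multiset ℕ) := by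
  have hd : Disjoint S (Finset.univ.map ⟨v, hv⟩) := by
    rw [Finset.disjoint_right]
    intro x hx
    obtain ⟨y, -, rfl⟩ := Finset.mem_map.1 hx
    exact hS y
  have h1 : Finset.univ.image v = Finset.univ.map ⟨v, hv⟩ := by
    ext x; simp
  rw [h1, ← Finset.disjUnion_eq_union S _ hd, Finset.disjUnion_val, Finset.map_val]
  congr 1
  rw [Finset.sum, ← Multiset.sum_map_singleton (Finset.univ.val.map _), Multiset.map_map]
  rfl

theorem MatrixUnits.wordVal_mem_leftPeirce {e : ℕ → A} {l : ℕ → Option (Fin W.q)}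
    {m : FreeSemigroup ℕ} (h : ∀ x ∈ letters m, e x ∈ M.leftPeirce (l x)) :
    wordVal e m ∈ M.leftPeirce (l m.head) := by
  induction m using FreeSemigroup.recOnMul with
  | ih1 x => exact h x (by simp)
  | ih2 x y hx hy =>
    rw [wordVal_mul]
    exact M.mul_mem_leftPeirce (h x (by simp)) _

/-- The letters of a word with a nonzero value are chained by their Peirce types. -/
theorem MatrixUnits.forall_eq_or_forall_ne {e : ℕ → A} {l r : ℕ → Option (Fin W.q)}
    {o : Option (Fin W.q)} {m : FreeSemigroup ℕ} (hl : ∀ x ∈ letters m, e x ∈ M.leftPeirce (l x))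
    (hr : ∀ x ∈ letters m, e x ∈ M.rightPeirce (r x))
    (ho : ∀ x ∈ letters m, l x = o ↔ r x = o) (hm : wordVal e m ≠ 0) :
    (∀ x ∈ letters m, l x = o) ∨ ∀ x ∈ letters m, l x ≠ o := by
  induction m using FreeSemigroup.recOnMul with
  | ih1 x =>
    by_cases h : l x = o
    · left; simpa using h
    · right; simpa using h
  | ih2 x m _ ih =>
    rw [wordVal_mul, wordVal_of] at hm
    have hm' : wordVal e m ≠ 0 := fun h => hm (by rw [h, mul_zero])
    have hlm : ∀ y ∈ letters m, e y ∈ M.leftPeirce (l y) := fun y hy => hl y (by simp [hy])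
    have hrm : ∀ y ∈ letters m, e y ∈ M.rightPeirce (r y) := fun y hy => hr y (by simp [hy])
    have hhead : m.head ∈ letters m := by simp [letters]
    have hchain : r x = l m.head := by
      by_contra hc
      exact hm (M.mul_eq_zero_of_ne hc (hr x (by simp)) (M.wordVal_mem_leftPeirce hlm))
    have hx : l x = o ↔ l m.head = o := by rw [ho x (by simp), hchain]
    rcases ih hlm hrm (fun y hy => ho y (by simp [hy])) hm' with h | h
    · left
      intro y hy
      rw [letters_mul, letters_of, List.singleton_append, List.mem_cons] at hy
      rcases hy with rfl | hy
      · exact hx.2 (h _ hhead)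
      · exact h y hy
    · right
      intro y hy
      rw [letters_mul, letters_of, List.singleton_append, List.mem_cons] at hy
      rcases hy with rfl | hy
      · exact fun hc => h _ hhead (hx.1 hc)
      · exact h y hy

/-- Attach variables to the left and to the right of the variable `x`. -/
def attach {X : Type*} (u : X → ℕ) (a b : Option X) (x : ℕ) : FreeSemigroup ℕ :=
  a.elim id (fun i m => FreeSemigroup.of (u i) * m)
    (b.elim (FreeSemigroup.of x) fun i => FreeSemigroup.of x * FreeSemigroup.of (u i))

/-- The variable `u i` is attached only at `y i`, on the left if the left type is i and on the right
if the right type is i. The hypothesis `h` is an exclusive or, so each `u i` is used exactly once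
and multilinearity survives. -/
theorem sum_letters_attach {X : Type*} [Fintype X] [DecidableEq X] {S : Finset ℕ} {u : X → ℕ}
    {y : X → ℕ} (hy : ∀ i, y i ∈ S) {l r : ℕ → Option X}
    (h : ∀ i, ¬ (l (y i) = some i ↔ r (y i) = some i)) :
    ∑ x ∈ S, (letters (attach u ((l x).filter fun i => y i = x) ((r x).filter fun i => y i = x) x)
      : Multiset ℕ) = S.val + ∑ i, ({u i} : Multiset ℕ) := by
  have h1 : ∀ x, (letters (attach u ((l x).filter fun i => y i = x)
      ((r x).filter fun i => y i = x) x) : Multiset ℕ) = {x} +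
      ((∑ i, if y i = x then if l x = some i then ({u i} : Multiset ℕ) else 0 else 0) +
        ∑ i, if y i = x then if r x = some i then ({u i} : Multiset ℕ) else 0 else 0) := by
    intro x
    have key : ∀ o : Option X,
        (∑ i, if y i = x then if o = some i then ({u i} : Multiset ℕ) else 0 else 0)
          = (o.filter fun i => y i = x).elim 0 fun i => {u i} := by
      intro o
      cases o with
      | none => simp
      | some j =>
        rw [Finset.sum_eq_single j]
        · by_cases hj : y j = x <;> simp [hj, Option.filter]
        · intro b _ hb
          simp [Ne.symm hb]
        · simp
    rw [key, key]
    cases (l x).filter fun i => y i = x <;> cases (r x).filter fun i => y i = x <;>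
      simp [attach, ← Multiset.singleton_add, ← Multiset.cons_coe] <;> abel
  rw [Finset.sum_congr rfl fun x _ => h1 x, Finset.sum_add_distrib, Finset.sum_add_distrib,
    Finset.sum_comm (s := S), Finset.sum_comm (s := S), ← Finset.sum_add_distrib,
    Finset.sum_multiset_singleton]
  congr 1
  refine Finset.sum_congr rfl fun i _ => ?_
  rw [Finset.sum_ite_eq, Finset.sum_ite_eq, if_pos (hy i), if_pos (hy i)]
  have := h i
  split_ifs <;> simp_all

end Slots

/-! ### Inserting the units of the components into the polynomial -/

section Slotted

variable {F : Type u} [Field F] {A : Type v} [NonUnitalRing A] [Module F A] [IsScalarTower F A A]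
  [SMulCommClass F A A] [FiniteDimensional F A] {W : WedderburnMalcev F A} (M : MatrixUnits W)

/-- Property `K`, in the form in which it is used: replacing some of the radical values by
semisimple ones makes the value vanish. -/
theorem WedderburnMalcev.HasPropertyKWrt.evalPoly_eq_zero {S R : Finset ℕ} {f : FreeAlg F}
    (hK : W.HasPropertyKWrt S f) (hcard : R.card = nilIndex F A - 1) {e : ℕ → A}
    (h1 : ∀ x ∈ S, x ∉ R → (∃ i, e x ∈ W.comp i) ∧ e x ∉ jacobsonRadical F A)
    (h2 : ∀ x ∈ R, (∃ i, e x ∈ W.comp i) ∨ e x ∈ jacobsonRadical F A)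
    (h3 : ∃ x ∈ R, e x ∉ jacobsonRadical F A) : evalPoly e f = 0 := by
  classical
  refine hK e (fun x hx => ?_) ?_
  · by_cases hxR : x ∈ R
    · exact h2 x hxR
    · exact Or.inl (h1 x hx hxR).1
  · obtain ⟨x, hx, hxJ⟩ := h3
    rw [← hcard]
    refine Finset.card_lt_card ((Finset.ssubset_iff_of_subset fun y hy => ?_).2 ⟨x, hx, ?_⟩)
    · rw [Finset.mem_filter] at hy
      by_contra hyR
      exact (h1 y hy.1 hyR).2 hy.2
    · exact fun hc => hxJ (Finset.mem_filter.1 hc).2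

/-- The data produced from a polynomial with respect to which the algebra is full and has property
`K`: the new variables `u i` take idempotent values from the components. -/
structure SlottedPolynomial where
  S : Finset ℕ
  R : Finset ℕ
  R_subset : R ⊆ S
  card_R : R.card = nilIndex F A - 1
  u : Fin W.q → ℕ
  u_inj : Function.Injective u
  u_notMem : ∀ i, u i ∉ S
  G : FreeAlg F
  multilinear : IsMultilinearIn (S ∪ Finset.univ.image u) G
  e : ℕ → A
  ne_zero : evalPoly e G ≠ 0
  left : ℕ → Option (Fin W.q)
  right : ℕ → Option (Fin W.q)
  mem_left : ∀ x ∈ R, e x ∈ M.leftPeirce (left x)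
  mem_right : ∀ x ∈ R, e x ∈ M.rightPeirce (right x)
  α : ∀ i, Fin (M.n i)
  e_u : ∀ i, e (u i) = M.E i (α i) (α i)
  eq_zero : ∀ e' : ℕ → A, (∀ x ∈ S, x ∉ R → e' x = e x) →
    (∀ x ∈ R, e' x = e x ∨ (left x = right x ∧ (∃ i, e' x ∈ W.comp i) ∧
      e' x ∉ jacobsonRadical F A)) → (∃ x ∈ R, e' x ∉ jacobsonRadical F A) → evalPoly e' G = 0

theorem wordVal_attach {X : Type*} (u : X → ℕ) (a b : Option X) (x : ℕ) (e : ℕ → A) :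
    wordVal e (attach u a b x) = a.elim id (fun i z => e (u i) * z)
      (b.elim (e x) fun i => e x * e (u i)) := by
  cases a <;> cases b <;> simp [attach]

/-- If no variable has type i₀ on exactly one side, a nonzero word cannot pass between i₀ and the
other types. Fullness makes i₀ occur, so every letter has type i₀; and since every component occurs
among the values, there is only one. -/
theorem MatrixUnits.exists_slots {S : Finset ℕ} {f : FreeAlg F} (hf : IsMultilinearIn S f)
    (hfull : W.IsFullWrt S f) {e : ℕ → A} (he : W.IsAdmissible S e) (hne : evalPoly e f ≠ 0)
    {l r : ℕ → Option (Fin W.q)} (hl : ∀ x ∈ S, e x ∈ M.leftPeirce (l x))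
    (hr : ∀ x ∈ S, e x ∈ M.rightPeirce (r x))
    (hlr : ∀ x ∈ S, ∀ i, e x ∈ W.comp i → l x = some i ∧ r x = some i) :
    (∃ y : Fin W.q → ℕ, ∀ i, y i ∈ S ∧ ¬ (l (y i) = some i ↔ r (y i) = some i)) ∨
      ∃ i₀, (∀ j, j = i₀) ∧ ∀ x ∈ S, l x = some i₀ := by
  by_cases h : ∀ i, ∃ x ∈ S, ¬ (l x = some i ↔ r x = some i)
  · choose y hy using h
    exact Or.inl ⟨y, hy⟩
  · right
    push Not at h
    obtain ⟨i₀, hi₀⟩ := h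
    obtain ⟨m, hm, hmne⟩ : ∃ m ∈ words f, wordVal e m ≠ 0 := by
      by_contra hc
      push Not at hc
      rw [evalPoly_eq_sum] at hne
      exact hne (Finset.sum_eq_zero fun m hm => by rw [hc m hm, smul_zero])
    have hiff := hf.mem_iff hm
    have hall : ∀ x ∈ S, l x = some i₀ := by
      rcases M.forall_eq_or_forall_ne (o := some i₀) (fun x hx => hl x ((hiff x).1 hx))
        (fun x hx => hr x ((hiff x).1 hx)) (fun x hx => by simpa using hi₀ x ((hiff x).1 hx)) hmne
        with h | h
      · exact fun x hx => h x ((hiff x).2 hx)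
      · obtain ⟨x, hx, hxi⟩ := hfull e he hne i₀
        exact absurd (hlr x hx i₀ hxi).1 (h x ((hiff x).2 hx))
    refine ⟨i₀, fun j => ?_, hall⟩
    obtain ⟨x, hx, hxj⟩ := hfull e he hne j
    have := hall x hx
    rw [(hlr x hx j hxj).1] at this
    exact Option.some_injective _ this

/-- The values chosen are homogeneous, so multiplying by the unit of a component on the side of
matching Peirce type changes nothing. This gives each component a place where products of its matrix
units can be inserted. -/
theorem MatrixUnits.exists_slottedPolynomial {S : Finset ℕ} {f : FreeAlg F}
    (hf : IsMultilinearIn S f) (hfA : f ∉ identities F A) (hfull : W.IsFullWrt S f)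
    (hK : W.HasPropertyKWrt S f) : Nonempty (SlottedPolynomial M) := by
  classical
  obtain ⟨e₀, he₀⟩ : ∃ e : ℕ → A, evalPoly e f ≠ 0 := by
    by_contra hc
    push Not at hc
    exact hfA hc
  obtain ⟨e, hB, hne⟩ := hf.exists_evalPoly_ne_zero
    (B := fun _ => {x | ∃ i, x ∈ W.comp i} ∪ M.homogeneousRadical)
    (fun x _ => by rw [M.span_homogeneous]; exact Submodule.mem_top) he₀
  have hadm : W.IsAdmissible S e := fun x hx => (hB x hx).imp id fun h => h.1
  have hlr : ∀ x, ∃ l r : Option (Fin W.q), x ∈ S → e x ∈ M.leftPeirce l ∧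
      e x ∈ M.rightPeirce r ∧ ∀ i, e x ∈ W.comp i → l = some i ∧ r = some i := by
    intro x
    by_cases hx : x ∈ S
    swap
    · exact ⟨none, none, fun h => absurd h hx⟩
    have hx0 : e x ≠ 0 := fun h0 => hne (hf.evalPoly_eq_zero_of_eq_zero hx h0)
    by_cases hc : ∃ i, e x ∈ W.comp i
    · obtain ⟨i, hi⟩ := hc
      refine ⟨some i, some i, fun _ => ⟨M.comp_le_leftPeirce hi, M.comp_le_rightPeirce hi,
        fun j hj => ?_⟩⟩
      have : i = j := by
        by_contra hij
        apply hx0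
        rw [← M.idem_mul hi]
        exact W.mul_eq_zero i j hij _ (M.idem_mem i) _ hj
      subst this
      exact ⟨rfl, rfl⟩
    · obtain ⟨-, l, r, h1, h2⟩ := (hB x hx).resolve_left hc
      exact ⟨l, r, fun _ => ⟨h1, h2, fun i hi => absurd ⟨i, hi⟩ hc⟩⟩
  choose l r hlr using hlr
  set R : Finset ℕ := S.filter fun x => e x ∈ jacobsonRadical F A with hRdef
  have hRS : R ⊆ S := Finset.filter_subset _ _
  -- More radical values would give zero by nilpotency, fewer by property K.
  have hcard : R.card = nilIndex F A - 1 := by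
    apply le_antisymm
    · by_contra hc
      exact hne (hf.evalPoly_eq_zero_of_card (by rw [← hRdef]; omega))
    · by_contra hc
      exact hne (hK e hadm (by rw [← hRdef]; omega))
  have hRJ : ∀ x ∈ R, e x ∈ jacobsonRadical F A := fun x hx => (Finset.mem_filter.1 hx).2
  have hSR : ∀ x ∈ S, x ∉ R → (∃ i, e x ∈ W.comp i) ∧ e x ∉ jacobsonRadical F A := by
    intro x hx hxR
    have hxJ : e x ∉ jacobsonRadical F A := fun h => hxR (Finset.mem_filter.2 ⟨hx, h⟩)
    exact ⟨(hB x hx).resolve_right fun h => hxJ h.1, hxJ⟩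
  obtain ⟨u, hu, huS⟩ := exists_injective_notMem (Fin W.q) S
  obtain ⟨G, hG, hGe, hGv⟩ : ∃ G : FreeAlg F, IsMultilinearIn (S ∪ Finset.univ.image u) G ∧
      (∀ e' : ℕ → A, (∀ x ∈ S, e' x = e x) → (∀ i, e' (u i) = M.idem i) → evalPoly e' G ≠ 0) ∧
      ∀ e' : ℕ → A, (∀ x ∈ S, x ∉ R → e' x = e x) →
        (∀ x ∈ R, e' x = e x ∨ (l x = r x ∧ (∃ i, e' x ∈ W.comp i) ∧
          e' x ∉ jacobsonRadical F A)) → (∃ x ∈ R, e' x ∉ jacobsonRadical F A) →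
        evalPoly e' G = 0 := by
    rcases M.exists_slots hf hfull hadm hne (fun x hx => (hlr x hx).1)
      (fun x hx => (hlr x hx).2.1) (fun x hx => (hlr x hx).2.2) with ⟨y, hy⟩ | ⟨i₀, hi₀, hall⟩
    · refine ⟨_, hf.subst (fun x => attach u ((l x).filter fun i => y i = x)
        ((r x).filter fun i => y i = x) x) ?_, ?_, ?_⟩
      · rw [sum_letters_attach (fun i => (hy i).1) (fun i => (hy i).2), union_image_val hu huS]
      · intro e' he' hu'
        simp only [evalPoly_evalPoly, evalPoly_mono]
        rw [hf.evalPoly_congr (e' := e)]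
        · exact hne
        · intro x hx
          rw [wordVal_attach, he' x hx]
          have h1 := (hlr x hx).1
          have h2 := (hlr x hx).2.1
          have h2' : (((r x).filter fun i => y i = x).elim (e x) fun i => e x * e' (u i))
              = e x := by
            rcases hr : (r x).filter fun i => y i = x with _ | i
            · rfl
            · rw [Option.filter_eq_some_iff] at hr
              rw [hr.1, M.mem_rightPeirce_some] at h2
              simp only [Option.elim, hu', h2]
          rw [h2']
          rcases hl : (l x).filter fun i => y i = x with _ | i
          · rfl
          · rw [Option.filter_eq_some_iff] at hl
            rw [hl.1, M.mem_leftPeirce_some] at h1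
            simp only [Option.elim, hu', h1]
      · intro e' h1 h2 h3
        simp only [evalPoly_evalPoly, evalPoly_mono]
        -- Variables are attached only where the two types differ. A variable with equal types is
        -- left alone, so a semisimple value substituted there remains in its component.
        have hslot : ∀ x, l x = r x → wordVal e' (attach u ((l x).filter fun i => y i = x)
            ((r x).filter fun i => y i = x) x) = e' x := by
          intro x hx
          have hno : ∀ o : Option (Fin W.q), o = l x → o.filter (fun i => y i = x) = none := by
            intro o ho
            rw [Option.filter_eq_none_iff]
            intro i hi
            simp only [decide_eq_true_eq]
            intro hyx
            have := (hy i).2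
            rw [hyx, ← hx] at this
            exact this Iff.rfl
          rw [hno _ rfl, hno _ hx.symm]
          rfl
        -- Where something is attached, the value stays radical whatever the values at `u i` are;
        -- hence property K needs no condition on them.
        have hJ : ∀ x, e' x ∈ jacobsonRadical F A → wordVal e' (attach u
            ((l x).filter fun i => y i = x) ((r x).filter fun i => y i = x) x)
              ∈ jacobsonRadical F A := by
          intro x hx
          rw [wordVal_attach]
          have : (((r x).filter fun i => y i = x).elim (e' x) fun i => e' x * e' (u i))
              ∈ jacobsonRadical F A := by
            cases (r x).filter fun i => y i = x
            · exact hx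
            · exact mul_mem_jacobsonRadical_right hx _
          cases (l x).filter fun i => y i = x
          · exact this
          · exact mul_mem_jacobsonRadical_left this _
        refine hK.evalPoly_eq_zero hcard (fun x hx hxR => ?_) (fun x hx => ?_) ?_
        · obtain ⟨⟨i, hi⟩, h4⟩ := hSR x hx hxR
          rw [hslot x (by rw [((hlr x hx).2.2 i hi).1, ((hlr x hx).2.2 i hi).2]), h1 x hx hxR]
          exact ⟨⟨i, hi⟩, h4⟩
        · rcases h2 x hx with h4 | ⟨h4, h5, -⟩
          · exact Or.inr (hJ x (by rw [h4]; exact hRJ x hx))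
          · exact Or.inl (by rw [hslot x h4]; exact h5)
        · obtain ⟨x, hx, hxJ⟩ := h3
          refine ⟨x, hx, ?_⟩
          rcases h2 x hx with h4 | ⟨h4, -, -⟩
          · exact absurd (hRJ x hx) (by rw [← h4]; exact hxJ)
          · rwa [hslot x h4]
    -- With a single component and all left types equal to i₀, the unit can be multiplied on the
    -- left of the whole polynomial.
    · have hd : Disjoint {u i₀} S := Finset.disjoint_singleton_left.2 (huS i₀)
      refine ⟨mono (FreeSemigroup.of (u i₀)) * f, ?_, ?_, ?_⟩
      · have h1 := (isMultilinearIn_mono (F := F) (S := {u i₀})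
          (m := FreeSemigroup.of (u i₀)) rfl).mul hf hd
        have h2 : S ∪ Finset.univ.image u = Finset.disjUnion {u i₀} S hd := by
          ext x
          simp only [Finset.mem_union, Finset.mem_image, Finset.mem_univ, true_and,
            Finset.mem_disjUnion, Finset.mem_singleton]
          constructor
          · rintro (h | ⟨i, rfl⟩)
            · exact Or.inr h
            · exact Or.inl (by rw [hi₀ i])
          · rintro (rfl | h)
            · exact Or.inr ⟨i₀, rfl⟩
            · exact Or.inl h
        rw [h2]
        exact h1
      · intro e' he' hu'
        have h1 : evalPoly e f ∈ M.leftPeirce (some i₀) := by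
          rw [evalPoly_eq_sum]
          refine Submodule.sum_mem _ fun m hm => Submodule.smul_mem _ _ ?_
          refine M.wordVal_mem_leftPeirce (l := fun _ => some i₀) fun x hx => ?_
          have hxS := (hf.mem_iff hm x).1 hx
          rw [← hall x hxS]
          exact (hlr x hxS).1
        rw [evalPoly_mul, evalPoly_mono, wordVal_of, hu', hf.evalPoly_congr he', h1]
        exact hne
      · intro e' h1 h2 h3
        rw [evalPoly_mul, hK.evalPoly_eq_zero hcard (fun x hx hxR => ?_) (fun x hx => ?_) h3,
          mul_zero]
        · rw [h1 x hx hxR]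
          exact hSR x hx hxR
        · rcases h2 x hx with h4 | ⟨-, h5, -⟩
          · exact Or.inr (by rw [h4]; exact hRJ x hx)
          · exact Or.inl h5
  set e₁ : ℕ → A := Function.extend u M.idem e with he₁
  have he₁u : ∀ i, e₁ (u i) = M.idem i := fun i => hu.extend_apply _ _ _
  have he₁S : ∀ x ∈ S, e₁ x = e x := by
    intro x hx
    refine Function.extend_apply' _ _ _ ?_
    rintro ⟨i, rfl⟩
    exact huS i hx
  -- The unit of a component is the sum of its diagonal matrix units. By multilinearity one summand
  -- `E i (α i) (α i)` in each component keeps the value nonzero.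
  obtain ⟨e₂, h2, hne2⟩ := hG.exists_evalPoly_ne_zero (e := e₁)
    (B := fun x => {z | (x ∈ S → z = e x) ∧ ∀ i, x = u i → ∃ a, z = M.E i a a})
    (fun x hx => by
      rcases Finset.mem_union.1 hx with hx | hx
      · refine Submodule.subset_span ⟨fun _ => he₁S x hx, ?_⟩
        rintro i rfl
        exact absurd hx (huS i)
      · obtain ⟨i, -, rfl⟩ := Finset.mem_image.1 hx
        rw [he₁u]
        refine Submodule.sum_mem _ fun a _ => Submodule.subset_span
          ⟨fun h => absurd h (huS i), fun j hj => ?_⟩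
        obtain rfl := hu hj
        exact ⟨a, rfl⟩) (hGe e₁ he₁S he₁u)
  have h2S : ∀ x ∈ S, e₂ x = e x := fun x hx => (h2 x (Finset.mem_union_left _ hx)).1 hx
  choose α hα using fun i => (h2 (u i) (Finset.mem_union_right _
    (Finset.mem_image_of_mem _ (Finset.mem_univ i)))).2 i rfl
  exact ⟨{
    S := S
    R := R
    R_subset := hRS
    card_R := hcard
    u := u
    u_inj := hu
    u_notMem := huS
    G := G
    multilinear := hG
    e := e₂
    ne_zero := hne2
    left := l
    right := r
    mem_left := fun x hx => by rw [h2S x (hRS hx)]; exact (hlr x (hRS hx)).1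
    mem_right := fun x hx => by rw [h2S x (hRS hx)]; exact (hlr x (hRS hx)).2.1
    α := α
    e_u := hα
    eq_zero := fun e' h1 h3 => hGv e' (fun x hx hxR => by rw [h1 x hx hxR, h2S x hx])
      fun x hx => by rw [← h2S x (hRS hx)]; exact h3 x hx }⟩

end Slotted

/-! ### Frames of matrix units and the alternating polynomial: (2) ⇒ (3) -/

section Frames

variable {F : Type u} [Field F] {A : Type v} [NonUnitalRing A] [Module F A] [IsScalarTower F A A]
  [SMulCommClass F A A] [FiniteDimensional F A] {W : WedderburnMalcev F A} {M : MatrixUnits W}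

variable (A) in
/-- The product, in some order, of a finite nonempty family of words. -/
theorem exists_word_prod {T : Type*} [Fintype T] [Nonempty T] (p : T → FreeSemigroup ℕ) :
    ∃ m : FreeSemigroup ℕ, (letters m : Multiset ℕ) = ∑ t, (letters (p t) : Multiset ℕ) ∧
      (∀ e : ℕ → A, wordVal e m ≠ 0 → ∀ t, wordVal e (p t) ≠ 0) ∧
      ∀ (e : ℕ → A) (c : A), c * c = c → (∀ t, wordVal e (p t) = c) → wordVal e m = c := by
  classical
  suffices h : ∀ s : Finset T, s.Nonempty → ∃ m : FreeSemigroup ℕ,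
      (letters m : Multiset ℕ) = ∑ t ∈ s, (letters (p t) : Multiset ℕ) ∧
      (∀ e : ℕ → A, wordVal e m ≠ 0 → ∀ t ∈ s, wordVal e (p t) ≠ 0) ∧
      ∀ (e : ℕ → A) (c : A), c * c = c → (∀ t, wordVal e (p t) = c) → wordVal e m = c by
    obtain ⟨m, h1, h2, h3⟩ := h Finset.univ Finset.univ_nonempty
    exact ⟨m, h1, fun e he t => h2 e he t (Finset.mem_univ t), h3⟩
  intro s hs
  induction hs using Finset.Nonempty.cons_induction with
  | singleton t =>
    exact ⟨p t, by simp, fun e he t' ht' => by rwa [Finset.mem_singleton.1 ht'],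
      fun e c _ h => h t⟩
  | cons t s ht hs ih =>
    obtain ⟨m, h1, h2, h3⟩ := ih
    refine ⟨p t * m, ?_, fun e he t' ht' => ?_, fun e c hc h => ?_⟩
    · rw [letters_mul, ← Multiset.coe_add, h1, Finset.sum_cons]
    · rw [wordVal_mul] at he
      rcases Finset.mem_cons.1 ht' with rfl | ht'
      · exact left_ne_zero_of_mul he
      · exact h2 e (right_ne_zero_of_mul he) t' ht'
    · rw [wordVal_mul, h t, h3 e c hc h, hc]

/-- The value of the `k`-th of the three variables belonging to a matrix unit: they multiply
to an idempotent, and the middle one is the matrix unit itself. -/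
def MatrixUnits.frameVal (M : MatrixUnits W) (i : Fin W.q) (α a b : Fin (M.n i)) : Fin 3 → A :=
  ![M.E i α a, M.E i a b, M.E i b α]

/-- The variable `u i` is replaced by a product of framed matrix units with total value E_αα. The
frames and property K together ensure that alternation does not cancel the nonzero value. -/
theorem SlottedPolynomial.hasAlternatingOutside [CharZero F] (P : SlottedPolynomial M) {ν : ℕ}
    (hν : 0 < ν) :
    HasAlternatingOutside (identities F A) ν (dimSemisimple F A) (nilIndex F A - 1) := by
  classical
  set s := nilIndex F A - 1 with hs
  -- Indices of the alternating sets. Every set contains one middle variable for each matrix unit of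
  -- each component, d(A) in all; the set `Sum.inr k` also contains the radical variable `w k`.
  let C := Fin ν ⊕ Fin s
  let Y := Σ i, (C × Fin (M.n i) × Fin (M.n i)) × Fin 3
  let D := Σ i, Fin (M.n i) × Fin (M.n i)
  -- Words of the free semigroup are nonempty, so ν > 0 is needed to have at least one factor.
  have hne : ∀ i, Nonempty (C × Fin (M.n i) × Fin (M.n i)) := fun i =>
    haveI := M.n_pos i
    ⟨(Sum.inl ⟨0, hν⟩, 0, 0)⟩
  let w : Fin s → ℕ := fun k => (P.R.equivFinOfCardEq P.card_R).symm k
  have hwR : ∀ k, w k ∈ P.R := fun k => Subtype.property _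
  have hw_inj : Function.Injective w :=
    Subtype.val_injective.comp (P.R.equivFinOfCardEq P.card_R).symm.injective
  have hw_surj : ∀ x ∈ P.R, ∃ k, w k = x := fun x hx =>
    ⟨P.R.equivFinOfCardEq P.card_R ⟨x, hx⟩, by simp [w]⟩
  obtain ⟨v, hv, hvS⟩ := exists_injective_notMem Y (P.S ∪ Finset.univ.image P.u)
  have hvS' : ∀ y, v y ∉ P.S := fun y h => hvS y (Finset.mem_union_left _ h)
  let val : Y → A := fun y => M.frameVal y.1 (P.α y.1) y.2.1.2.1 y.2.1.2.2 y.2.2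
  let piece : ∀ i, C × Fin (M.n i) × Fin (M.n i) → FreeSemigroup ℕ := fun i t =>
    FreeSemigroup.of (v ⟨i, t, 0⟩) * FreeSemigroup.of (v ⟨i, t, 1⟩) *
      FreeSemigroup.of (v ⟨i, t, 2⟩)
  choose frame hfl hfne hfval using fun i => haveI := hne i; exists_word_prod A (piece i)
  let p : ℕ → FreeSemigroup ℕ := Function.extend P.u frame FreeSemigroup.of
  have hpu : ∀ i, p (P.u i) = frame i := fun i => P.u_inj.extend_apply _ _ _
  have hpS : ∀ x ∈ P.S, p x = FreeSemigroup.of x := by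
    intro x hx
    refine Function.extend_apply' _ _ _ ?_
    rintro ⟨i, rfl⟩
    exact P.u_notMem i hx
  let e₁ : ℕ → A := Function.extend v val P.e
  have he₁v : ∀ y, e₁ (v y) = val y := fun y => hv.extend_apply _ _ _
  have he₁S : ∀ x ∈ P.S, e₁ x = P.e x := by
    intro x hx
    refine Function.extend_apply' _ _ _ ?_
    rintro ⟨y, rfl⟩
    exact hvS' y hx
  set S' : Finset ℕ := P.S ∪ Finset.univ.image v with hS'
  set h : FreeAlg F := evalPoly (fun x => (mono (p x) : FreeAlg F)) P.G with hh
  have heval : ∀ e : ℕ → A, evalPoly e h = evalPoly (fun x => wordVal e (p x)) P.G := by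
    intro e
    simp only [hh, evalPoly_evalPoly, evalPoly_mono]
  have hmul : IsMultilinearIn S' h := by
    refine P.multilinear.subst p ?_
    have hd : Disjoint P.S (Finset.univ.image P.u) := by
      rw [Finset.disjoint_right]
      intro x hx
      obtain ⟨i, -, rfl⟩ := Finset.mem_image.1 hx
      exact P.u_notMem i
    rw [Finset.sum_union hd, Finset.sum_image P.u_inj.injOn, union_image_val hv hvS']
    congr 1
    · have h1 : ∀ x ∈ P.S, (letters (p x) : Multiset ℕ) = {x} := fun x hx => by
        rw [hpS x hx]
        rfl
      rw [Finset.sum_congr rfl h1, Finset.sum_multiset_singleton]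
    · refine Eq.trans ?_ (Fintype.sum_sigma fun y : Y => ({v y} : Multiset ℕ)).symm
      refine Finset.sum_congr rfl fun i _ => ?_
      rw [hpu, hfl]
      refine Eq.trans ?_ (Fintype.sum_prod_type _).symm
      refine Finset.sum_congr rfl fun t _ => ?_
      rw [Fin.sum_univ_three]
      rfl
  have hne₁ : evalPoly e₁ h ≠ 0 := by
    rw [heval, P.multilinear.evalPoly_congr (e' := P.e)]
    · exact P.ne_zero
    · intro x hx
      rcases Finset.mem_union.1 hx with hx | hx
      · rw [hpS x hx, wordVal_of, he₁S x hx]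
      · obtain ⟨i, -, rfl⟩ := Finset.mem_image.1 hx
        rw [hpu, P.e_u]
        refine hfval i _ _ (by simp [M.mul_self]) fun t => ?_
        simp [piece, he₁v, val, MatrixUnits.frameVal, M.mul_self]
  let z : C → D → ℕ := fun c t => v ⟨t.1, (c, t.2), 1⟩
  have hz : ∀ {c c' t t'}, z c t = z c' t' → c = c' ∧ t = t' := by
    rintro c c' ⟨i, t⟩ ⟨i', t'⟩ hzz
    cases hv hzz
    exact ⟨rfl, rfl⟩
  have hzS : ∀ c t, z c t ∉ P.S := fun c t => hvS' _
  have hzw : ∀ c t k, z c t ≠ w k := fun c t k h =>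
    hzS c t (by rw [h]; exact P.R_subset (hwR k))
  let X : C → Finset ℕ := fun c =>
    Finset.univ.image (z c) ∪ (Finset.univ.filter fun k => c = Sum.inr k).image w
  have memX : ∀ c x, x ∈ X c ↔ (∃ t, z c t = x) ∨ ∃ k, c = Sum.inr k ∧ w k = x := by
    intro c x
    simp [X]
  have hXS : ∀ c, X c ⊆ S' := by
    intro c x hx
    rcases (memX c x).1 hx with ⟨t, rfl⟩ | ⟨k, -, rfl⟩
    · exact Finset.mem_union_right _ (Finset.mem_image_of_mem _ (Finset.mem_univ _))
    · exact Finset.mem_union_left _ (P.R_subset (hwR k))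
  have hXd : Pairwise fun a b => Disjoint (X a) (X b) := by
    intro a b hab
    rw [Finset.disjoint_left]
    intro x hxa hxb
    rcases (memX a x).1 hxa with ⟨t, rfl⟩ | ⟨k, rfl, rfl⟩
    · rcases (memX b _).1 hxb with ⟨t', ht⟩ | ⟨k, -, hk⟩
      · exact hab (hz ht).1.symm
      · exact hzw _ _ _ hk.symm
    · rcases (memX b _).1 hxb with ⟨t', ht⟩ | ⟨k', rfl, hk⟩
      · exact hzw _ _ _ ht
      · exact hab (by rw [hw_inj hk])
  have hzcard : ∀ c, (Finset.univ.image (z c)).card = dimSemisimple F A := by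
    intro c
    rw [Finset.card_image_of_injective _ fun t t' htt => (hz htt).2, Finset.card_univ,
      M.card_eq_dimSemisimple]
  have hv_fix : ∀ {i t k}, k ≠ 1 → ∀ c, v ⟨i, t, k⟩ ∉ X c := by
    intro i t k hk c hx
    rcases (memX c _).1 hx with ⟨⟨i', t'⟩, ht⟩ | ⟨k', -, hk'⟩
    · cases hv ht
      exact hk rfl
    · exact hvS' _ (by rw [← hk']; exact P.R_subset (hwR k'))
  have key : ∀ σ : Equiv.Perm ℕ, (∀ c, ∀ x ∈ X c, σ x ∈ X c) → (∀ x, (∀ c, x ∉ X c) → σ x = x) →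
      evalPoly (e₁ ∘ σ) h ≠ 0 → σ = 1 := by
    intro σ hσX hσ hσne
    rw [heval] at hσne
    -- The outer variables of a frame are fixed by `σ`, so each middle value must survive between
    -- E_αa and E_bα.
    have hpiece : ∀ c (t : D), M.E t.1 (P.α t.1) t.2.1 * e₁ (σ (z c t)) *
        M.E t.1 t.2.2 (P.α t.1) ≠ 0 := by
      rintro c ⟨i, a, b⟩
      have h1 : wordVal (e₁ ∘ σ) (frame i) ≠ 0 := by
        intro h0
        refine hσne (P.multilinear.evalPoly_eq_zero_of_eq_zero (x := P.u i)
          (Finset.mem_union_right _ (Finset.mem_image_of_mem _ (Finset.mem_univ i))) ?_)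
        rw [hpu, h0]
      have h2 := hfne i _ h1 (c, a, b)
      simp only [piece, wordVal_mul, wordVal_of, Function.comp_apply,
        hσ _ (hv_fix (i := i) (t := (c, a, b)) (k := 0) (by decide)),
        hσ _ (hv_fix (i := i) (t := (c, a, b)) (k := 2) (by decide)), he₁v] at h2
      exact h2
    -- Between E_αa and E_bα only E_ab survives among the matrix units. A radical value survives
    -- only if both its Peirce types are the component of the frame, so its left and right types
    -- agree.
    have hz_or : ∀ c t, σ (z c t) = z c t ∨
        ∃ k, c = Sum.inr k ∧ σ (z c t) = w k ∧ P.left (w k) = P.right (w k) := by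
      intro c t
      have h1 := hpiece c t
      rcases (memX c _).1 (hσX c (z c t) ((memX c _).2 (Or.inl ⟨t, rfl⟩))) with
        ⟨t', ht⟩ | ⟨k, hk, hkw⟩
      · left
        rw [← ht] at h1 ⊢
        obtain ⟨i, a, b⟩ := t
        obtain ⟨i', a', b'⟩ := t'
        have h2 : e₁ (z c ⟨i', a', b'⟩) = M.E i' a' b' := he₁v _
        rw [h2] at h1
        by_cases hi : i = i'
        · subst hi
          rw [M.mul_self] at h1
          split_ifs at h1 with haa
          · subst haa
            rw [M.mul_self] at h1
            split_ifs at h1 with hbb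
            · subst hbb
              rfl
            · exact absurd rfl h1
          · exact absurd (zero_mul _) h1
        · exact absurd (by rw [M.mul_of_ne hi, zero_mul]) h1
      · right
        refine ⟨k, hk, hkw.symm, ?_⟩
        rw [← hkw, he₁S _ (P.R_subset (hwR k))] at h1
        have hl : P.left (w k) = some t.1 := by
          by_contra hc
          refine h1 ?_
          rw [M.mul_eq_zero_of_ne (Ne.symm hc) (M.comp_le_rightPeirce (M.mem _ _ _))
            (P.mem_left _ (hwR k)), zero_mul]
        have hr : P.right (w k) = some t.1 := by
          by_contra hc
          refine h1 ?_
          rw [mul_assoc, M.mul_eq_zero_of_ne hc (P.mem_right _ (hwR k))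
            (M.comp_le_leftPeirce (M.mem _ _ _)), mul_zero]
        rw [hl, hr]
    have hw_or : ∀ k, σ (w k) = w k ∨ (P.left (w k) = P.right (w k) ∧
        (∃ i, e₁ (σ (w k)) ∈ W.comp i) ∧ e₁ (σ (w k)) ∉ jacobsonRadical F A) := by
      intro k
      have hwX : w k ∈ X (Sum.inr k) := (memX _ _).2 (Or.inr ⟨k, rfl, rfl⟩)
      rcases (memX _ _).1 (hσX _ _ hwX) with ⟨t', ht⟩ | ⟨k', hk, hkw⟩
      · right
        have h2 : e₁ (σ (w k)) = M.E t'.1 t'.2.1 t'.2.2 := by rw [← ht]; exact he₁v _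
        refine ⟨?_, ⟨_, by rw [h2]; exact M.mem _ _ _⟩, by rw [h2]; exact M.E_notMem _ _ _⟩
        -- If `w k` is moved, some variable of the same set is sent to it. That must be a middle
        -- variable, and `hz_or` then shows that the two types of `w k` agree.
        have himg : (X (Sum.inr k)).image σ = X (Sum.inr k) :=
          Finset.eq_of_subset_of_card_le (Finset.image_subset_iff.2 (hσX _))
            (Finset.card_image_of_injective _ σ.injective).ge
        obtain ⟨y, hy, hyw⟩ := Finset.mem_image.1 (by rw [himg]; exact hwX)
        rcases (memX _ _).1 hy with ⟨t, rfl⟩ | ⟨k', hk', rfl⟩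
        · rcases hz_or _ t with h3 | ⟨k', hk', h4, h5⟩
          · exact absurd (h3.symm.trans hyw) (hzw _ _ _)
          · obtain rfl := Sum.inr_injective hk'
            exact h5
        · obtain rfl := Sum.inr_injective hk'
          exact absurd (ht.trans hyw) (hzw _ _ _)
      · left
        obtain rfl := Sum.inr_injective hk
        exact hkw.symm
    have hw_fix : ∀ k, σ (w k) = w k := by
      by_contra hc
      push Not at hc
      obtain ⟨k, hk⟩ := hc
      -- A moved radical variable receives a matrix unit, so fewer than n_A - 1 radical values
      -- remain. Its types agree, hence `eq_zero` applies, whatever the values of the frames have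
      -- become.
      refine hσne (P.eq_zero _ (fun x hx hxR => ?_) (fun x hx => ?_) ⟨w k, hwR k, ?_⟩)
      · have : σ x = x := by
          refine hσ x fun c hxc => ?_
          rcases (memX c x).1 hxc with ⟨t, rfl⟩ | ⟨k, -, rfl⟩
          · exact hzS _ _ hx
          · exact hxR (hwR k)
        rw [hpS x hx, wordVal_of, Function.comp_apply, this, he₁S x hx]
      · obtain ⟨k, rfl⟩ := hw_surj x hx
        rw [hpS _ (P.R_subset hx), wordVal_of, Function.comp_apply]
        exact (hw_or k).imp (fun h => by rw [h, he₁S _ (P.R_subset hx)]) id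
      · rw [hpS _ (P.R_subset (hwR k)), wordVal_of, Function.comp_apply]
        exact ((hw_or k).resolve_left hk).2.2
    ext x
    by_cases hx : ∀ c, x ∉ X c
    · exact hσ x hx
    · push Not at hx
      obtain ⟨c, hx⟩ := hx
      rcases (memX c x).1 hx with ⟨t, rfl⟩ | ⟨k, -, rfl⟩
      · rcases hz_or c t with h | ⟨k, -, h, -⟩
        · exact h
        · exact absurd (σ.injective (h.trans (hw_fix k).symm)) (hzw _ _ _)
      · exact hw_fix k
  obtain ⟨g, hg, hgne, hgalt⟩ := exists_alternating_of_eval hmul hXS hXd hne₁ key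
  refine ⟨g, fun hc => hgne (hc e₁), ⟨S', hg⟩, X, hXd, fun a => ?_, fun b => ?_, hgalt⟩
  · have : X (Sum.inl a) = Finset.univ.image (z (Sum.inl a)) := by simp [X]
    rw [this, hzcard]
  · have : X (Sum.inr b) = Finset.univ.image (z (Sum.inr b)) ∪ {w b} := by
      ext x
      rw [memX, Finset.mem_union, Finset.mem_image, Finset.mem_singleton]
      refine or_congr (by simp) ⟨?_, fun h => ⟨b, rfl, h.symm⟩⟩
      rintro ⟨k, hk, rfl⟩
      rw [Sum.inr_injective hk]
    rw [this, Finset.card_union_of_disjoint, hzcard, Finset.card_singleton]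
    rw [Finset.disjoint_singleton_right, Finset.mem_image]
    rintro ⟨t, -, ht⟩
    exact hzw _ _ _ ht

theorem WedderburnMalcev.IsFullWithPropertyK.kemerIndex_eq_parameter [IsAlgClosed F] [CharZero F]
    (h : W.IsFullWithPropertyK) : kemerIndex (identities F A) = parameter F A := by
  obtain ⟨M⟩ := W.exists_matrixUnits
  obtain ⟨S, f, hf, hfA, hfull, hK⟩ := h
  obtain ⟨P⟩ := M.exists_slottedPolynomial hf hfA hfull hK
  -- The construction needs ν > 0, so it is applied to ν + 1 and one set is dropped.
  exact KemerPI.kemerIndex_eq_parameter fun ν =>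
    (P.hasAlternatingOutside ν.succ_pos).mono ν.le_succ le_rfl

end Frames

end

end KemerPI

/-! ### The equivalence -/

theorem mainTheorem5 (F : Type u) [Field F] [IsAlgClosed F] [CharZero F]
    (A : Type v) [NonUnitalRing A] [Module F A] [IsScalarTower F A A] [SMulCommClass F A A]
    [FiniteDimensional F A] [Nontrivial A] :
    List.TFAE
      [ KemerPI.IsBasic F A,
        ∃ W : KemerPI.WedderburnMalcev F A, W.IsFullWithPropertyK,
        ∀ W : KemerPI.WedderburnMalcev F A, W.IsFullWithPropertyK,
        KemerPI.kemerIndex (KemerPI.identities F A) = KemerPI.parameter F A ] := by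
  tfae_have 1 → 3 := fun h W => h.isFullWithPropertyK W
  tfae_have 3 → 2 := fun h =>
    let ⟨W⟩ := KemerPI.exists_wedderburnMalcev F A
    ⟨W, h W⟩
  tfae_have 2 → 4 := fun ⟨_, h⟩ => h.kemerIndex_eq_parameter
  tfae_have 4 → 1 := KemerPI.isBasic_of_kemerIndex_eq
  tfae_finish
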